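/- Let $n\ge 5$ and let $(M^n,g)$ be a smooth Riemannian manifold without boundary (not necessarily complete), with scalar curvature $R$. Assume that $g$ is a critical metric of the functional $\mathfrak S^2=\int R_g^2\,dV_g$ with respect to compactly supported variations, that is, for every compact set $K\subset M$ and every smooth symmetric $2$-tensor field $h$ on $M$ vanishing outside $K$, $$\left.\frac{d}{dt}\right|_{t=0}\int_K R_{g+th}^2\,dV_{g+th}=0 .$$ Assume moreover that $R<0$ everywhere on $M$. Then the conformal metric $$\tilde g=|R|^{\frac{6}{n-4}}\,g$$ is a smooth Riemannian metric on $M$, the function $$f=\frac{2(n-1)}{n-4}\log|R|$$ is smooth, and $$\mathrm{Ric}_{\tilde g}+\nabla^2_{\tilde g}f-\frac{n-10}{4(n-1)}\,df\otimes df=0 .$$ That is, $(M,\tilde g,f)$ is a steady quasi-Einstein structure, where a quasi-Einstein structure is a solution, with $f$ smooth, of $\mathrm{Ric}_{\tilde g}+\nabla^2_{\tilde g}f-\mu\,df\otimes df=\lambda\tilde g$ with real constants $\mu,\lambda$ (here $\mu=\frac{n-10}{4(n-1)}$), called steady if $\lambda=0$. In particular, if $n=10$, then $(M,\tilde g,f)$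 is a steady gradient Ricci soliton, i.e. $\mathrm{Ric}_{\tilde g}+\nabla^2_{\tilde g}f=0$. -/

import Mathlib

open scoped Manifold ContDiff Bundle Topology
open MeasureTheory

noncomputable section

namespace CriticalMetric

/-! ### Riemannian geometry in local coordinates

Partial derivatives, Christoffel symbols, Ricci and scalar curvature of a matrix-valued function
`G = (g_ij)` on `ℝⁿ`, and the Hessian of a function with respect to it. -/

/-- The `i`-th standard basis vector of `ℝⁿ`. -/
def stdVec {n : ℕ} (i : Fin n) : EuclideanSpace ℝ (Fin n) := EuclideanSpace.single i (1 : ℝ)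

/-- The partial derivative `∂ᵢ F` at `y`. -/
def pd {n : ℕ} (i : Fin n) (F : EuclideanSpace ℝ (Fin n) → ℝ)
    (y : EuclideanSpace ℝ (Fin n)) : ℝ :=
  fderiv ℝ F y (stdVec i)

/-- Christoffel symbols `Γᵏᵢⱼ = ½ ∑ₗ gᵏˡ (∂ᵢ gⱼₗ + ∂ⱼ gᵢₗ - ∂ₗ gᵢⱼ)`. -/
def christoffel {n : ℕ} (G : EuclideanSpace ℝ (Fin n) → Matrix (Fin n) (Fin n) ℝ)
    (k i j : Fin n) (y : EuclideanSpace ℝ (Fin n)) : ℝ :=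
  (1 / 2 : ℝ) * ∑ l : Fin n, (G y)⁻¹ k l *
    (pd i (fun z => G z j l) y + pd j (fun z => G z i l) y - pd l (fun z => G z i j) y)

/-- Components of the Ricci tensor:
`Ricᵢⱼ = ∑ₖ (∂ₖ Γᵏᵢⱼ - ∂ⱼ Γᵏᵢₖ) + ∑ₖₗ (Γᵏₖₗ Γˡᵢⱼ - Γᵏⱼₗ Γˡᵢₖ)`
(positive on round spheres). -/
def ricciCoord {n : ℕ} (G : EuclideanSpace ℝ (Fin n) → Matrix (Fin n) (Fin n) ℝ)
    (i j : Fin n) (y : EuclideanSpace ℝ (Fin n)) : ℝ :=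
  (∑ k : Fin n, (pd k (christoffel G k i j) y - pd j (christoffel G k i k) y)) +
    ∑ k : Fin n, ∑ l : Fin n,
      (christoffel G k k l y * christoffel G l i j y -
        christoffel G k j l y * christoffel G l i k y)

/-- Scalar curvature `∑ᵢⱼ gⁱʲ Ricᵢⱼ`. -/
def scalarCoord {n : ℕ} (G : EuclideanSpace ℝ (Fin n) → Matrix (Fin n) (Fin n) ℝ)
    (y : EuclideanSpace ℝ (Fin n)) : ℝ :=
  ∑ i : Fin n, ∑ j : Fin n, (G y)⁻¹ i j * ricciCoord G i j y

/-- Components of the Hessian: `(∇²F)ᵢⱼ = ∂ᵢ∂ⱼ F - ∑ₖ Γᵏᵢⱼ ∂ₖ F`. -/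
def hessCoord {n : ℕ} (G : EuclideanSpace ℝ (Fin n) → Matrix (Fin n) (Fin n) ℝ)
    (F : EuclideanSpace ℝ (Fin n) → ℝ) (i j : Fin n) (y : EuclideanSpace ℝ (Fin n)) : ℝ :=
  pd i (pd j F) y - ∑ k : Fin n, christoffel G k i j y * pd k F y

/-! ### The same objects on a manifold -/

/-- Fields of bilinear forms on the tangent spaces of `M` (no regularity or symmetry imposed). -/
abbrev BilinField (n : ℕ) (M : Type*) [TopologicalSpace M]
    [ChartedSpace (EuclideanSpace ℝ (Fin n)) M] : Type _ :=
  ∀ x : M, TangentSpace (𝓡 n) x →L[ℝ] TangentSpace (𝓡 n) x →L[ℝ] ℝ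

/-- Smoothness of a field of bilinear forms, as a section of the corresponding vector bundle. -/
def SmoothField {n : ℕ} {M : Type*} [TopologicalSpace M]
    [ChartedSpace (EuclideanSpace ℝ (Fin n)) M] [IsManifold (𝓡 n) ∞ M]
    (h : BilinField n M) : Prop :=
  ContMDiff (𝓡 n)
    ((𝓡 n).prod 𝓘(ℝ, EuclideanSpace ℝ (Fin n) →L[ℝ] EuclideanSpace ℝ (Fin n) →L[ℝ] ℝ)) ∞
    (fun x : M => Bundle.TotalSpace.mk'
      (EuclideanSpace ℝ (Fin n) →L[ℝ] EuclideanSpace ℝ (Fin n) →L[ℝ] ℝ) x (h x))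

/-- A smooth Riemannian metric on `M`. -/
abbrev Metric (n : ℕ) (M : Type*) [TopologicalSpace M]
    [ChartedSpace (EuclideanSpace ℝ (Fin n)) M] [IsManifold (𝓡 n) ∞ M] : Type _ :=
  Bundle.ContMDiffRiemannianMetric (𝓡 n) ∞ (EuclideanSpace ℝ (Fin n))
    (fun x : M => TangentSpace (𝓡 n) x)

section Geometry

variable {n : ℕ} {M : Type*} [TopologicalSpace M] [ChartedSpace (EuclideanSpace ℝ (Fin n)) M]

/-- The components `gᵢⱼ = g(∂ᵢ, ∂ⱼ)` of `g` in the chart `c`, as functions on `c.target`; the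
coordinate field `∂ᵢ` is the image of the `i`-th basis vector under the differential of `c⁻¹`. -/
def gram (g : BilinField n M) (c : OpenPartialHomeomorph M (EuclideanSpace ℝ (Fin n)))
    (y : EuclideanSpace ℝ (Fin n)) : Matrix (Fin n) (Fin n) ℝ :=
  Matrix.of fun i j =>
    g (c.symm y) (mfderiv (𝓡 n) (𝓡 n) c.symm y (stdVec i))
      (mfderiv (𝓡 n) (𝓡 n) c.symm y (stdVec j))

/-- The `i`-th component of the tangent vector `v` at `x` in the preferred chart at `x`. -/
def comp (x : M) (v : TangentSpace (𝓡 n) x) (i : Fin n) : ℝ :=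
  let u : EuclideanSpace ℝ (Fin n) :=
    mfderiv (𝓡 n) (𝓡 n) (chartAt (EuclideanSpace ℝ (Fin n)) x) x v
  u i

/-- The Ricci tensor of `g`, evaluated on tangent vectors at `x`. -/
def ricci (g : BilinField n M) (x : M) (v w : TangentSpace (𝓡 n) x) : ℝ :=
  ∑ i : Fin n, ∑ j : Fin n,
    ricciCoord (gram g (chartAt (EuclideanSpace ℝ (Fin n)) x)) i j
      (chartAt (EuclideanSpace ℝ (Fin n)) x x) * comp x v i * comp x w j

/-- The scalar curvature of `g`. -/
def scalarCurvature (g : BilinField n M) (x : M) : ℝ :=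
  scalarCoord (gram g (chartAt (EuclideanSpace ℝ (Fin n)) x))
    (chartAt (EuclideanSpace ℝ (Fin n)) x x)

/-- The Hessian `∇²f` of `f` with respect to `g`, evaluated on tangent vectors at `x`. -/
def hessian (g : BilinField n M) (f : M → ℝ) (x : M) (v w : TangentSpace (𝓡 n) x) : ℝ :=
  ∑ i : Fin n, ∑ j : Fin n,
    hessCoord (gram g (chartAt (EuclideanSpace ℝ (Fin n)) x))
      (f ∘ (chartAt (EuclideanSpace ℝ (Fin n)) x).symm) i j
      (chartAt (EuclideanSpace ℝ (Fin n)) x x) * comp x v i * comp x w j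

/-- The differential `df` of `f`, evaluated on a tangent vector at `x`. -/
def differential (f : M → ℝ) (x : M) (v : TangentSpace (𝓡 n) x) : ℝ :=
  (mfderiv (𝓡 n) 𝓘(ℝ, ℝ) f x v : ℝ)

/-- The measure `√(det gᵢⱼ) dy` of the chart `c`, transported to `c.source ⊆ M`
(and vanishing outside of it). -/
def chartVolume [MeasurableSpace M] (g : BilinField n M)
    (c : OpenPartialHomeomorph M (EuclideanSpace ℝ (Fin n))) : Measure M :=
  ((volume.restrict c.target).withDensity
    (fun y => ENNReal.ofReal (Real.sqrt (gram g c y).det))).map c.symm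

/-- The Riemannian volume measure `dV_g`. By the change of variables formula the chart measures
agree on overlaps, so on a second countable manifold their least upper bound is the one Borel
measure that restricts to `√(det gᵢⱼ) dy` on the domain of each chart. -/
def riemannianVolume [MeasurableSpace M] (g : BilinField n M) : Measure M :=
  ⨆ x : M, chartVolume g (chartAt (EuclideanSpace ℝ (Fin n)) x)

/-- `g` is a critical metric of `𝔖² = ∫ R_g² dV_g`: for all compactly supported variations, the
first variation of `𝔖²` vanishes. Here `h` is a smooth symmetric 2-tensor field that vanishes
outside the compact set `K`, and the functional is restricted to `K`, outside of which the metrics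
`g + t h` do not depend on `t` (over all of `M` the integral may be infinite). Since `K` is compact,
`g + t h` is a Riemannian metric for all small `t`, and only these matter for the derivative. -/
def IsCritical [IsManifold (𝓡 n) ∞ M] [MeasurableSpace M] (g : Metric n M) : Prop :=
  ∀ (K : Set M), IsCompact K → ∀ h : BilinField n M, SmoothField h →
    (∀ (x : M) (v w : TangentSpace (𝓡 n) x), h x v w = h x w v) →
    (∀ x ∉ K, h x = 0) →
    HasDerivAt
      (fun t : ℝ => ∫ x in K, scalarCurvature (fun p => g.inner p + t • h p) x ^ 2
        ∂(riemannianVolume (fun p => g.inner p + t • h p)))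
      0 0

/-- `(M, g, f)` is a quasi-Einstein structure with constants `μ` and `lam`: `f` is smooth and
`Ric_g + ∇²_g f - μ df ⊗ df = lam g`. It is called *steady* if `lam = 0`. -/
def IsQuasiEinstein [IsManifold (𝓡 n) ∞ M] (g : Metric n M) (f : M → ℝ) (μ lam : ℝ) : Prop :=
  ContMDiff (𝓡 n) 𝓘(ℝ, ℝ) ∞ f ∧
    ∀ (x : M) (v w : TangentSpace (𝓡 n) x),
      ricci g.inner x v w + hessian g.inner f x v w
        - μ * (differential f x v * differential f x w) = lam * g.inner x v w

/-- `(M, g, f)` is a gradient Ricci soliton with constant `lam`: `f` is smooth and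
`Ric_g + ∇²_g f = lam g`. It is called *steady* if `lam = 0`. -/
def IsGradientRicciSoliton [IsManifold (𝓡 n) ∞ M] (g : Metric n M) (f : M → ℝ) (lam : ℝ) :
    Prop :=
  ContMDiff (𝓡 n) 𝓘(ℝ, ℝ) ∞ f ∧
    ∀ (x : M) (v w : TangentSpace (𝓡 n) x),
      ricci g.inner x v w + hessian g.inner f x v w = lam * g.inner x v w

end Geometry

end CriticalMetric

end

/-! Criticality is equivalent to the Euler-Lagrange equation 2∇²R - 2(ΔR)g - 2R Ric + (R²/2)g = 0,
of which only necessity is needed. Its trace is 4(n-1)ΔR = (n-4)R². Since R never vanishes, the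
equation can be solved for Ric in terms of ∇²R, ΔR and R. Put φ = 3/(n-4) log|R|, so that the
conformal metric is e^{2φ}g, and substitute into the conformal transformation laws of Ric and of the
Hessian of f. The coefficients of ∇²R and of |dR|²g then cancel because of the choice of the two
constants, the multiples of g cancel by the trace equation, and the surviving multiple of dR⊗dR is
exactly what μ df⊗df removes. This is `quasiEinstein_coord`; it rests on `conf_ricciCoord`,
`conf_hessCoord` and `lapCoord_of_gradS2`.

The Euler-Lagrange equation comes from a Palatini argument. With the density P = √(det g) g⁻¹ one
has R√(det g) = PⁱʲRicᵢⱼ, and P is parallel, so PⁱʲδRicᵢⱼ is a divergence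
(`IsVariationAt.palatini_identity`). Multiplying by R and integrating by parts twice leaves δP
paired with ∇²R, plus the trace of h times ΔR, up to a divergence (`IsVariationAt.div_current`). The
variation δΓ is never computed: only the t-derivatives of identities valid for every metric g + th
are used. The fundamental lemma of the calculus of variations then yields the pointwise equation
(`gradS2_eq_zero`).

The passage from the manifold to coordinates has two ingredients. Scalar curvature is defined at
each point in that point's own preferred chart, so its invariance is needed before one fixed chart
can be used in a neighbourhood (`scalarCoord_change`, `scalarCurvature_chart`). It follows from the
gauge transformation law of connection matrices, which in turn follows from uniqueness of the
symmetric metric connection. The Riemannian measure is a supremum of chart measures, and it is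
identified with the density of a single chart inside that chart's domain
(`riemannianVolume_apply_of_subset`). Variations supported in one chart (`bumpField`) then turn the
hypothesis into the coordinate one (`gradS2_gram_eq_zero`). -/

noncomputable section
namespace CriticalMetric

set_option linter.unusedSectionVars false

/-! ### Calculus of matrix-valued functions: products, inverses, determinants. -/

section MatrixCalculus

variable {X : Type*} [NormedAddCommGroup X] [NormedSpace ℝ X] {m : Type*} [Fintype m]

/-- Entrywise smoothness at a point of a matrix-valued function. -/
def MatSmoothAt (A : X → Matrix m m ℝ) (x : X) : Prop :=
  ∀ i j, ContDiffAt ℝ ∞ (fun z => A z i j) x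

/-- Entrywise directional derivative of a matrix-valued function. -/
def dMat (A : X → Matrix m m ℝ) (x v : X) : Matrix m m ℝ :=
  Matrix.of fun i j => fderiv ℝ (fun z => A z i j) x v

theorem dMat_apply (A : X → Matrix m m ℝ) (x v : X) (i j : m) :
    dMat A x v i j = fderiv ℝ (fun z => A z i j) x v := rfl

theorem _root_.ContDiffAt.differentiableAt_of_smooth {Y : Type*} [NormedAddCommGroup Y]
    [NormedSpace ℝ Y] {f : X → Y} {x : X} (h : ContDiffAt ℝ ∞ f x) : DifferentiableAt ℝ f x :=
  h.differentiableAt (by simp)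

theorem MatSmoothAt.diff {A : X → Matrix m m ℝ} {x : X} (h : MatSmoothAt A x) (i j : m) :
    DifferentiableAt ℝ (fun z => A z i j) x := (h i j).differentiableAt_of_smooth

theorem fderiv_sum_apply {ι : Type*} (s : Finset ι) {F : ι → X → ℝ} {x : X}
    (h : ∀ i ∈ s, DifferentiableAt ℝ (F i) x) (v : X) :
    fderiv ℝ (fun z => ∑ i ∈ s, F i z) x v = ∑ i ∈ s, fderiv ℝ (F i) x v := by
  rw [fderiv_fun_sum h]; simp

theorem fderiv_mul_apply {f g : X → ℝ} {x : X} (hf : DifferentiableAt ℝ f x)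
    (hg : DifferentiableAt ℝ g x) (v : X) :
    fderiv ℝ (fun z => f z * g z) x v = fderiv ℝ f x v * g x + f x * fderiv ℝ g x v := by
  rw [fderiv_fun_mul hf hg]; simp; ring

theorem MatSmoothAt.mul {A B : X → Matrix m m ℝ} {x : X} (hA : MatSmoothAt A x)
    (hB : MatSmoothAt B x) : MatSmoothAt (fun z => A z * B z) x := by
  intro i j
  simp only [Matrix.mul_apply]
  exact ContDiffAt.sum fun k _ => (hA i k).mul (hB k j)

theorem MatSmoothAt.transpose {A : X → Matrix m m ℝ} {x : X} (hA : MatSmoothAt A x) :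
    MatSmoothAt (fun z => (A z).transpose) x := fun i j => hA j i

theorem MatSmoothAt.sum {ι : Type*} {s : Finset ι} {A : ι → X → Matrix m m ℝ} {x : X}
    (hA : ∀ i ∈ s, MatSmoothAt (A i) x) : MatSmoothAt (fun z => ∑ i ∈ s, A i z) x := by
  intro i j
  simp only [Matrix.sum_apply]
  exact ContDiffAt.sum fun k hk => hA k hk i j

theorem MatSmoothAt.smul {f : X → ℝ} {A : X → Matrix m m ℝ} {x : X} (hf : ContDiffAt ℝ ∞ f x)
    (hA : MatSmoothAt A x) : MatSmoothAt (fun z => f z • A z) x := fun i j => hf.mul (hA i j)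

theorem dMat_congr {A B : X → Matrix m m ℝ} {x : X} (h : ∀ᶠ z in 𝓝 x, A z = B z) (v : X) :
    dMat A x v = dMat B x v := by
  ext i j
  simp only [dMat_apply]
  have h' : (fun z => A z i j) =ᶠ[𝓝 x] fun z => B z i j := h.mono fun z hz => by simp [hz]
  rw [h'.fderiv_eq]

theorem dMat_mul {A B : X → Matrix m m ℝ} {x : X} (hA : MatSmoothAt A x)
    (hB : MatSmoothAt B x) (v : X) :
    dMat (fun z => A z * B z) x v = dMat A x v * B x + A x * dMat B x v := by
  ext i j
  simp only [dMat_apply, Matrix.mul_apply, Matrix.add_apply]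
  rw [fderiv_sum_apply (F := fun k z => A z i k * B z k j) _
    fun k _ => (hA.diff i k).mul (hB.diff k j), ← Finset.sum_add_distrib]
  exact Finset.sum_congr rfl fun k _ => fderiv_mul_apply (hA.diff i k) (hB.diff k j) v

theorem dMat_add {A B : X → Matrix m m ℝ} {x : X} (hA : MatSmoothAt A x)
    (hB : MatSmoothAt B x) (v : X) :
    dMat (fun z => A z + B z) x v = dMat A x v + dMat B x v := by
  ext i j
  simp only [dMat_apply, Matrix.add_apply]
  rw [fderiv_fun_add (hA.diff i j) (hB.diff i j)]; rfl

theorem dMat_sum {ι : Type*} (s : Finset ι) {A : ι → X → Matrix m m ℝ} {x : X}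
    (hA : ∀ i ∈ s, MatSmoothAt (A i) x) (v : X) :
    dMat (fun z => ∑ i ∈ s, A i z) x v = ∑ i ∈ s, dMat (A i) x v := by
  ext i j
  simp only [dMat_apply, Matrix.sum_apply]
  exact fderiv_sum_apply s (fun k hk => (hA k hk).diff i j) v

theorem dMat_smul {f : X → ℝ} {A : X → Matrix m m ℝ} {x : X} (hf : DifferentiableAt ℝ f x)
    (hA : MatSmoothAt A x) (v : X) :
    dMat (fun z => f z • A z) x v = fderiv ℝ f x v • A x + f x • dMat A x v := by
  ext i j
  simp only [dMat_apply, Matrix.smul_apply, Matrix.add_apply, smul_eq_mul]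
  exact fderiv_mul_apply hf (hA.diff i j) v

theorem dMat_transpose (A : X → Matrix m m ℝ) (x v : X) :
    dMat (fun z => (A z).transpose) x v = (dMat A x v).transpose := rfl

variable [DecidableEq m]

theorem dMat_const (C : Matrix m m ℝ) (x v : X) : dMat (fun _ : X => C) x v = 0 := by
  ext i j; simp [dMat_apply]

theorem MatSmoothAt.det {A : X → Matrix m m ℝ} {x : X} (hA : MatSmoothAt A x) :
    ContDiffAt ℝ ∞ (fun z => (A z).det) x := by
  simp only [Matrix.det_apply']
  exact ContDiffAt.sum fun σ _ => contDiffAt_const.mul (contDiffAt_prod fun i _ => hA _ _)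

theorem MatSmoothAt.adjugate {A : X → Matrix m m ℝ} {x : X} (hA : MatSmoothAt A x) :
    MatSmoothAt (fun z => (A z).adjugate) x := by
  intro i j
  simp only [Matrix.adjugate_apply]
  apply MatSmoothAt.det
  intro k l
  simp only [Matrix.updateRow_apply]
  split_ifs
  · exact contDiffAt_const
  · exact hA k l

theorem MatSmoothAt.inv {A : X → Matrix m m ℝ} {x : X} (hA : MatSmoothAt A x)
    (h : (A x).det ≠ 0) : MatSmoothAt (fun z => (A z)⁻¹) x := by
  intro i j
  simp only [Matrix.inv_def, Matrix.smul_apply, smul_eq_mul, Ring.inverse_eq_inv']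
  exact (hA.det.inv h).mul (hA.adjugate i j)

theorem MatSmoothAt.eventually_det_ne {A : X → Matrix m m ℝ} {x : X} (hA : MatSmoothAt A x)
    (h : (A x).det ≠ 0) : ∀ᶠ z in 𝓝 x, (A z).det ≠ 0 :=
  hA.det.continuousAt.eventually_ne h

/-- Differentiate A A⁻¹ = 1, which holds on a neighbourhood because the determinant stays nonzero
there. -/
theorem dMat_inv {A : X → Matrix m m ℝ} {x : X} (hA : MatSmoothAt A x)
    (h : (A x).det ≠ 0) (v : X) :
    dMat (fun z => (A z)⁻¹) x v = -((A x)⁻¹ * dMat A x v * (A x)⁻¹) := by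
  have h1 : dMat (fun z => A z * (A z)⁻¹) x v = 0 := by
    rw [← dMat_const (1 : Matrix m m ℝ) x v]
    refine dMat_congr ?_ v
    filter_upwards [hA.eventually_det_ne h] with z hz
    exact Matrix.mul_nonsing_inv _ (isUnit_iff_ne_zero.2 hz)
  rw [dMat_mul hA (hA.inv h)] at h1
  have h2 := congrArg (fun B => (A x)⁻¹ * B) h1
  simp only [mul_add, mul_zero, ← mul_assoc] at h2
  rw [Matrix.nonsing_inv_mul _ (isUnit_iff_ne_zero.2 h), one_mul] at h2
  rw [eq_neg_iff_add_eq_zero, add_comm]; exact h2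

/-- Jacobi's formula. The determinant is multilinear in the rows, so its derivative is a sum of
determinants with one row replaced, and Cramer's rule expresses each through the adjugate. -/
theorem fderiv_det_apply {A : X → Matrix m m ℝ} {x : X} (hA : MatSmoothAt A x) (v : X) :
    fderiv ℝ (fun z => (A z).det) x v = ((A x).adjugate * dMat A x v).trace := by
  have key : ∀ B : Matrix m m ℝ, HasFDerivAt (fun B : m → m → ℝ => (Matrix.of B).det)
      ((∑ i : m, ∑ j : m, (Matrix.adjugate B) j i •
        ((ContinuousLinearMap.proj (R := ℝ) (φ := fun _ : m => ℝ) j).comp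
          (ContinuousLinearMap.proj (R := ℝ) (φ := fun _ : m => m → ℝ) i)))) (fun i j => B i j) := by
    intro B
    let D : ContinuousMultilinearMap ℝ (fun _ : m => m → ℝ) ℝ :=
      { (Matrix.detRowAlternating (n := m) (R := ℝ)).toMultilinearMap with
        cont := by
          show Continuous fun B : m → m → ℝ => (Matrix.of B).det
          simp only [Matrix.det_apply']; fun_prop }
    have hD := D.hasFDerivAt (fun i j => B i j)
    refine hD.congr_fderiv ?_
    ext w
    rw [ContinuousMultilinearMap.linearDeriv_apply]
    simp only [_root_.sum_apply, _root_.smul_apply,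
      ContinuousLinearMap.comp_apply, ContinuousLinearMap.proj_apply, smul_eq_mul]
    refine Finset.sum_congr rfl fun i _ => ?_
    show Matrix.det (Matrix.updateRow B i (w i)) = _
    rw [← Matrix.cramer_transpose_apply, Matrix.cramer_eq_adjugate_mulVec]
    simp only [Matrix.mulVec, dotProduct, ← Matrix.adjugate_transpose, Matrix.transpose_apply]
  have hA' : HasFDerivAt (fun z => (fun i j => A z i j : m → m → ℝ))
      (ContinuousLinearMap.pi fun i => ContinuousLinearMap.pi fun j =>
        fderiv ℝ (fun z => A z i j) x) x :=
    hasFDerivAt_pi.2 fun i => hasFDerivAt_pi.2 fun j => (hA.diff i j).hasFDerivAt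
  have h := (key (A x)).comp x hA'
  have h2 : HasFDerivAt (fun z => (A z).det) _ x := h
  rw [h2.fderiv]
  simp only [ContinuousLinearMap.comp_apply, _root_.sum_apply,
    _root_.smul_apply, ContinuousLinearMap.proj_apply, smul_eq_mul,
    Matrix.trace, Matrix.diag, Matrix.mul_apply, dMat_apply]
  rw [Finset.sum_comm]
  rfl

theorem fderiv_sqrt_det_apply {A : X → Matrix m m ℝ} {x : X} (hA : MatSmoothAt A x)
    (h : 0 < (A x).det) (v : X) :
    fderiv ℝ (fun z => Real.sqrt (A z).det) x v =
      Real.sqrt (A x).det * (((A x)⁻¹ * dMat A x v).trace / 2) := by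
  rw [(hA.det.differentiableAt_of_smooth.hasFDerivAt.sqrt h.ne').fderiv]
  simp only [_root_.smul_apply, smul_eq_mul]
  rw [fderiv_det_apply hA, Matrix.inv_def, Ring.inverse_eq_inv', Matrix.smul_mul,
    Matrix.trace_smul, smul_eq_mul]
  have h1 : Real.sqrt (A x).det * Real.sqrt (A x).det = (A x).det := Real.mul_self_sqrt h.le
  have h2 : 0 < Real.sqrt (A x).det := Real.sqrt_pos.2 h
  set s := Real.sqrt (A x).det
  rw [← h1]; field_simp

theorem MatSmoothAt.sqrt_det {A : X → Matrix m m ℝ} {x : X} (hA : MatSmoothAt A x)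
    (h : 0 < (A x).det) : ContDiffAt ℝ ∞ (fun z => Real.sqrt (A z).det) x :=
  hA.det.sqrt h.ne'

theorem MatSmoothAt.comp {Y : Type*} [NormedAddCommGroup Y] [NormedSpace ℝ Y]
    {A : X → Matrix m m ℝ} {φ : Y → X} {y : Y} (hA : MatSmoothAt A (φ y))
    (hφ : ContDiffAt ℝ ∞ φ y) : MatSmoothAt (fun z => A (φ z)) y :=
  fun i j => (hA i j).comp y hφ

end MatrixCalculus


/-! ### Joint smoothness of curvature in a parameter and the point. -/

section Smoothness

variable {n : ℕ} {P : Type*} [NormedAddCommGroup P] [NormedSpace ℝ P]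

/-- Differentiating in the space slot alone preserves joint smoothness. This is what makes the
curvature of G + tH smooth in (t, y) together, as needed for exchanging derivatives and for
differentiating under the integral. -/
theorem contDiffAt_pd_param {F : P → EuclideanSpace ℝ (Fin n) → ℝ} {p : P}
    {y : EuclideanSpace ℝ (Fin n)}
    (hF : ContDiffAt ℝ ∞ (fun q : P × EuclideanSpace ℝ (Fin n) => F q.1 q.2) (p, y)) (i : Fin n) :
    ContDiffAt ℝ ∞ (fun q : P × EuclideanSpace ℝ (Fin n) => pd i (F q.1) q.2) (p, y) := by
  have h : ContDiffAt ℝ ∞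
      (fun q : P × EuclideanSpace ℝ (Fin n) => fderiv ℝ (F q.1) q.2) (p, y) := by
    refine ContDiffAt.fderiv (n := ∞) (f := fun q : P × EuclideanSpace ℝ (Fin n) => F q.1)
      (g := fun q : P × EuclideanSpace ℝ (Fin n) => q.2) ?_ contDiffAt_snd (by simp)
    exact ContDiffAt.comp (((p, y), y) : (P × EuclideanSpace ℝ (Fin n)) × EuclideanSpace ℝ (Fin n))
      (g := fun q : P × EuclideanSpace ℝ (Fin n) => F q.1 q.2)
      (f := fun r : (P × EuclideanSpace ℝ (Fin n)) × EuclideanSpace ℝ (Fin n) => (r.1.1, r.2))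
      hF (by fun_prop)
  exact h.clm_apply contDiffAt_const

theorem ContDiffAt.slice {F : P → EuclideanSpace ℝ (Fin n) → ℝ} {p : P}
    {y : EuclideanSpace ℝ (Fin n)}
    (hF : ContDiffAt ℝ ∞ (fun q : P × EuclideanSpace ℝ (Fin n) => F q.1 q.2) (p, y)) :
    ContDiffAt ℝ ∞ (F p) y :=
  ContDiffAt.comp y (f := fun z => (p, z))
    (g := fun q : P × EuclideanSpace ℝ (Fin n) => F q.1 q.2) hF (by fun_prop)

theorem ContDiffAt.slice_left {F : P → EuclideanSpace ℝ (Fin n) → ℝ} {p : P}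
    {y : EuclideanSpace ℝ (Fin n)}
    (hF : ContDiffAt ℝ ∞ (fun q : P × EuclideanSpace ℝ (Fin n) => F q.1 q.2) (p, y)) :
    ContDiffAt ℝ ∞ (fun p => F p y) p :=
  ContDiffAt.comp p (f := fun p => (p, y))
    (g := fun q : P × EuclideanSpace ℝ (Fin n) => F q.1 q.2) hF (by fun_prop)

variable {G : P → EuclideanSpace ℝ (Fin n) → Matrix (Fin n) (Fin n) ℝ} {p : P}
    {y : EuclideanSpace ℝ (Fin n)}

theorem contDiffAt_christoffel_param
    (hG : MatSmoothAt (fun q : P × EuclideanSpace ℝ (Fin n) => G q.1 q.2) (p, y))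
    (h : (G p y).det ≠ 0) (k i j : Fin n) :
    ContDiffAt ℝ ∞ (fun q : P × EuclideanSpace ℝ (Fin n) => christoffel (G q.1) k i j q.2)
      (p, y) := by
  unfold christoffel
  refine contDiffAt_const.mul (ContDiffAt.sum fun l _ => ((hG.inv h) k l).mul ?_)
  have hp : ∀ a b c, ContDiffAt ℝ ∞ (fun q : P × EuclideanSpace ℝ (Fin n) =>
      pd c (fun z => G q.1 z a b) q.2) (p, y) := fun a b c =>
    contDiffAt_pd_param (F := fun p z => G p z a b) (hG a b) c
  exact ((hp j l i).add (hp i l j)).sub (hp i j l)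

theorem contDiffAt_ricciCoord_param
    (hG : MatSmoothAt (fun q : P × EuclideanSpace ℝ (Fin n) => G q.1 q.2) (p, y))
    (h : (G p y).det ≠ 0) (i j : Fin n) :
    ContDiffAt ℝ ∞ (fun q : P × EuclideanSpace ℝ (Fin n) => ricciCoord (G q.1) i j q.2)
      (p, y) := by
  unfold ricciCoord
  have hc := contDiffAt_christoffel_param hG h
  refine (ContDiffAt.sum fun k _ => ?_).add (ContDiffAt.sum fun k _ => ContDiffAt.sum fun l _ => ?_)
  · exact (contDiffAt_pd_param (F := fun p => christoffel (G p) k i j) (hc k i j) k).sub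
      (contDiffAt_pd_param (F := fun p => christoffel (G p) k i k) (hc k i k) j)
  · exact ((hc k k l).mul (hc l i j)).sub ((hc k j l).mul (hc l i k))

theorem contDiffAt_scalarCoord_param
    (hG : MatSmoothAt (fun q : P × EuclideanSpace ℝ (Fin n) => G q.1 q.2) (p, y))
    (h : (G p y).det ≠ 0) :
    ContDiffAt ℝ ∞ (fun q : P × EuclideanSpace ℝ (Fin n) => scalarCoord (G q.1) q.2)
      (p, y) := by
  unfold scalarCoord
  exact ContDiffAt.sum fun i _ => ContDiffAt.sum fun j _ =>
    ((hG.inv h) i j).mul (contDiffAt_ricciCoord_param hG h i j)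

end Smoothness

/-! ### The Levi-Civita connection in matrix form. -/

section Christoffel

variable {n : ℕ} {G : EuclideanSpace ℝ (Fin n) → Matrix (Fin n) (Fin n) ℝ}
    {y : EuclideanSpace ℝ (Fin n)}

/-- Regarding a single metric as a constant family lets the parametric smoothness results cover it
as well. -/
theorem MatSmoothAt.const_param
    (hG : MatSmoothAt G y) :
    MatSmoothAt (fun q : ℝ × EuclideanSpace ℝ (Fin n) => G q.2) ((0 : ℝ), y) := fun i j =>
  ContDiffAt.comp ((0 : ℝ), y) (f := fun q : ℝ × EuclideanSpace ℝ (Fin n) => q.2)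
    (hG i j) contDiffAt_snd

theorem contDiffAt_pd {F : EuclideanSpace ℝ (Fin n) → ℝ} (hF : ContDiffAt ℝ ∞ F y) (i : Fin n) :
    ContDiffAt ℝ ∞ (pd i F) y :=
  (hF.fderiv_right (m := ∞) (by simp)).clm_apply contDiffAt_const

theorem contDiffAt_christoffel (hG : MatSmoothAt G y) (h : (G y).det ≠ 0) (k i j : Fin n) :
    ContDiffAt ℝ ∞ (christoffel G k i j) y :=
  ContDiffAt.slice (F := fun _ : ℝ => christoffel G k i j)
    (contDiffAt_christoffel_param (G := fun _ => G) hG.const_param h k i j)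

theorem contDiffAt_ricciCoord (hG : MatSmoothAt G y) (h : (G y).det ≠ 0) (i j : Fin n) :
    ContDiffAt ℝ ∞ (ricciCoord G i j) y :=
  ContDiffAt.slice (F := fun _ : ℝ => ricciCoord G i j)
    (contDiffAt_ricciCoord_param (G := fun _ => G) hG.const_param h i j)

theorem contDiffAt_scalarCoord (hG : MatSmoothAt G y) (h : (G y).det ≠ 0) :
    ContDiffAt ℝ ∞ (scalarCoord G) y :=
  ContDiffAt.slice (F := fun _ : ℝ => scalarCoord G)
    (contDiffAt_scalarCoord_param (G := fun _ => G) hG.const_param h)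

theorem pd_congr {F F' : EuclideanSpace ℝ (Fin n) → ℝ} (h : F =ᶠ[𝓝 y] F') (i : Fin n) :
    pd i F y = pd i F' y := by
  unfold pd; rw [h.fderiv_eq]

theorem pd_eventuallyEq {F F' : EuclideanSpace ℝ (Fin n) → ℝ} (h : F =ᶠ[𝓝 y] F') (i : Fin n) :
    pd i F =ᶠ[𝓝 y] pd i F' :=
  (eventually_eventuallyEq_nhds.2 h).mono fun _ hz => pd_congr hz i

theorem pd_comm {F : EuclideanSpace ℝ (Fin n) → ℝ} (hF : ContDiffAt ℝ ∞ F y) (i j : Fin n) :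
    pd i (pd j F) y = pd j (pd i F) y := by
  have hd : DifferentiableAt ℝ (fderiv ℝ F) y :=
    (hF.fderiv_right (m := ∞) (by simp)).differentiableAt_of_smooth
  have key : ∀ i j : Fin n, pd i (pd j F) y = fderiv ℝ (fderiv ℝ F) y (stdVec i) (stdVec j) := by
    intro i j
    unfold pd
    rw [fderiv_clm_apply hd (differentiableAt_const _)]
    simp
  rw [key, key]
  exact (hF.isSymmSndFDerivAt (by simpa using ENat.LEInfty.out)).eq _ _

/-- Near a point, a matrix-valued function is smooth, symmetric and invertible. -/
structure IsMetricAt (G : EuclideanSpace ℝ (Fin n) → Matrix (Fin n) (Fin n) ℝ)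
    (y : EuclideanSpace ℝ (Fin n)) : Prop where
  smooth : MatSmoothAt G y
  symm : ∀ᶠ z in 𝓝 y, (G z).transpose = G z
  det_ne : (G y).det ≠ 0

/-- The connection matrix `(Γᵏᵢⱼ)ₖⱼ`. -/
def conn (G : EuclideanSpace ℝ (Fin n) → Matrix (Fin n) (Fin n) ℝ) (i : Fin n)
    (y : EuclideanSpace ℝ (Fin n)) : Matrix (Fin n) (Fin n) ℝ :=
  Matrix.of fun k j => christoffel G k i j y

theorem conn_apply (i k j : Fin n) : conn G i y k j = christoffel G k i j y := rfl

theorem IsMetricAt.isUnit (h : IsMetricAt G y) : IsUnit (G y).det := isUnit_iff_ne_zero.2 h.det_ne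

theorem IsMetricAt.apply_comm (h : IsMetricAt G y) (i j : Fin n) : G y i j = G y j i :=
  congrFun (congrFun h.symm.self_of_nhds j) i

theorem IsMetricAt.inv_transpose (h : IsMetricAt G y) : ((G y)⁻¹).transpose = (G y)⁻¹ := by
  rw [Matrix.transpose_nonsing_inv, h.symm.self_of_nhds]

theorem IsMetricAt.inv_apply_comm (h : IsMetricAt G y) (i j : Fin n) :
    (G y)⁻¹ i j = (G y)⁻¹ j i :=
  congrFun (congrFun h.inv_transpose j) i

theorem IsMetricAt.pd_symm (h : IsMetricAt G y) (l i j : Fin n) :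
    pd l (fun z => G z i j) y = pd l (fun z => G z j i) y :=
  pd_congr (h.symm.mono fun _ hz => congrFun (congrFun hz j) i) l

theorem IsMetricAt.christoffel_comm (h : IsMetricAt G y) (k i j : Fin n) :
    christoffel G k i j y = christoffel G k j i y := by
  unfold christoffel
  congr 1
  refine Finset.sum_congr rfl fun l _ => ?_
  rw [h.pd_symm l i j]; ring

theorem IsMetricAt.matSmoothAt_conn (h : IsMetricAt G y) (i : Fin n) : MatSmoothAt (conn G i) y :=
  fun k j => contDiffAt_christoffel h.smooth h.det_ne k i j

theorem IsMetricAt.mul_conn_apply (h : IsMetricAt G y) (i l j : Fin n) :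
    (G y * conn G i y) l j = (1 / 2 : ℝ) * (pd i (fun z => G z j l) y + pd j (fun z => G z i l) y
      - pd l (fun z => G z i j) y) := by
  let B : Matrix (Fin n) (Fin n) ℝ := Matrix.of fun l j =>
    (1 / 2 : ℝ) * (pd i (fun z => G z j l) y + pd j (fun z => G z i l) y
      - pd l (fun z => G z i j) y)
  have : conn G i y = (G y)⁻¹ * B := by
    ext k j
    simp only [conn_apply, christoffel, Matrix.mul_apply, B, Matrix.of_apply, Finset.mul_sum]
    exact Finset.sum_congr rfl fun l _ => by ring
  rw [this, Matrix.mul_nonsing_inv_cancel_left _ _ h.isUnit]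
  rfl

/-- Metric compatibility, ∇g = 0: in the lowered Christoffel symbol two of the three derivatives are
antisymmetric in (l, j) and drop out on adding the transpose. -/
theorem IsMetricAt.dMat_eq (h : IsMetricAt G y) (i : Fin n) :
    dMat G y (stdVec i) = G y * conn G i y + (conn G i y).transpose * G y := by
  have : (conn G i y).transpose * G y = (G y * conn G i y).transpose := by
    rw [Matrix.transpose_mul, h.symm.self_of_nhds]
  rw [this]
  ext l j
  rw [Matrix.add_apply, Matrix.transpose_apply, h.mul_conn_apply, h.mul_conn_apply, h.pd_symm j i l,
    h.pd_symm l i j, h.pd_symm i j l]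
  show pd i (fun z => G z l j) y = _
  ring

theorem IsMetricAt.dMat_inv_eq (h : IsMetricAt G y) (i : Fin n) :
    dMat (fun z => (G z)⁻¹) y (stdVec i) =
      -(conn G i y * (G y)⁻¹ + (G y)⁻¹ * (conn G i y).transpose) := by
  rw [dMat_inv h.smooth h.det_ne, h.dMat_eq, mul_add, add_mul,
    Matrix.nonsing_inv_mul_cancel_left _ _ h.isUnit, ← mul_assoc,
    Matrix.mul_nonsing_inv_cancel_right _ _ h.isUnit]

/-- In g⁻¹∂ᵢg = Γᵢ + g⁻¹Γᵢᵀg the two summands have the same trace. With Jacobi's formula this makes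
the traced Christoffel symbol a logarithmic derivative of √(det g). -/
theorem IsMetricAt.trace_conn (h : IsMetricAt G y) (i : Fin n) :
    (conn G i y).trace = ((G y)⁻¹ * dMat G y (stdVec i)).trace / 2 := by
  rw [h.dMat_eq, mul_add, Matrix.trace_add, Matrix.nonsing_inv_mul_cancel_left _ _ h.isUnit,
    ← mul_assoc, Matrix.trace_mul_comm _ (G y), ← mul_assoc,
    Matrix.mul_nonsing_inv _ h.isUnit, one_mul, Matrix.trace_transpose]
  ring

theorem IsMetricAt.pd_sqrt_det (h : IsMetricAt G y) (hpos : 0 < (G y).det) (i : Fin n) :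
    pd i (fun z => Real.sqrt (G z).det) y =
      Real.sqrt (G y).det * ∑ k, christoffel G k i k y := by
  rw [pd, fderiv_sqrt_det_apply h.smooth hpos, ← h.trace_conn]
  rfl

theorem IsMetricAt.pd_inv (h : IsMetricAt G y) (k i j : Fin n) :
    pd k (fun z => (G z)⁻¹ i j) y = -((∑ l, christoffel G i k l y * (G y)⁻¹ l j) +
      ∑ l, (G y)⁻¹ i l * christoffel G j k l y) := by
  have := congrFun (congrFun (h.dMat_inv_eq k) i) j
  exact this

theorem IsMetricAt.pd_eq (h : IsMetricAt G y) (k i j : Fin n) :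
    pd k (fun z => G z i j) y = ((∑ l, G y i l * christoffel G l k j y) +
      ∑ l, christoffel G l k i y * G y l j) := by
  have := congrFun (congrFun (h.dMat_eq k) i) j
  exact this

end Christoffel


/-! ### Invariance of curvature under changes of coordinates. -/

section ChangeOfCoordinates

variable {n : ℕ} {G G' : EuclideanSpace ℝ (Fin n) → Matrix (Fin n) (Fin n) ℝ}
    {φ : EuclideanSpace ℝ (Fin n) → EuclideanSpace ℝ (Fin n)} {y : EuclideanSpace ℝ (Fin n)}

/-- The Jacobian matrix `∂ᵢ φᵃ`. -/
def jac (φ : EuclideanSpace ℝ (Fin n) → EuclideanSpace ℝ (Fin n)) (y : EuclideanSpace ℝ (Fin n)) :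
    Matrix (Fin n) (Fin n) ℝ :=
  Matrix.of fun a i => pd i (fun z => φ z a) y

theorem jac_apply (a i : Fin n) : jac φ y a i = pd i (fun z => φ z a) y := rfl

theorem contDiffAt_coord (hφ : ContDiffAt ℝ ∞ φ y) (a : Fin n) :
    ContDiffAt ℝ ∞ (fun z => φ z a) y :=
  ((EuclideanSpace.proj (𝕜 := ℝ) a).contDiff.contDiffAt).comp y hφ

theorem matSmoothAt_jac (hφ : ContDiffAt ℝ ∞ φ y) : MatSmoothAt (jac φ) y := fun a i =>
  contDiffAt_pd (contDiffAt_coord hφ a) i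

theorem dMat_jac_comm (hφ : ContDiffAt ℝ ∞ φ y) (i j a : Fin n) :
    dMat (jac φ) y (stdVec i) a j = dMat (jac φ) y (stdVec j) a i :=
  pd_comm (contDiffAt_coord hφ a) i j

theorem sum_smul_stdVec (v : EuclideanSpace ℝ (Fin n)) : ∑ b, v b • stdVec b = v := by
  ext a
  simp [stdVec, Finset.sum_apply, Pi.single_apply]

theorem pd_comp {F : EuclideanSpace ℝ (Fin n) → ℝ} (hF : DifferentiableAt ℝ F (φ y))
    (hφ : DifferentiableAt ℝ φ y) (i : Fin n) :
    pd i (fun z => F (φ z)) y = ∑ b, jac φ y b i * pd b F (φ y) := by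
  have h1 : pd i (fun z => F (φ z)) y = fderiv ℝ F (φ y) (fderiv ℝ φ y (stdVec i)) := by
    unfold pd
    rw [show (fun z => F (φ z)) = F ∘ φ from rfl, fderiv_comp y hF hφ]; rfl
  have h2 : ∀ b, jac φ y b i = fderiv ℝ φ y (stdVec i) b := by
    intro b
    rw [jac_apply, pd]
    have := ((EuclideanSpace.proj (𝕜 := ℝ) b).hasFDerivAt.comp y hφ.hasFDerivAt).fderiv
    exact congrArg (fun L => L (stdVec i)) this
  rw [h1]
  conv_lhs => rw [← sum_smul_stdVec (fderiv ℝ φ y (stdVec i))]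
  simp only [map_sum, map_smul, smul_eq_mul, h2, pd]

theorem dMat_comp {A : EuclideanSpace ℝ (Fin n) → Matrix (Fin n) (Fin n) ℝ}
    (hA : MatSmoothAt A (φ y)) (hφ : DifferentiableAt ℝ φ y) (i : Fin n) :
    dMat (fun z => A (φ z)) y (stdVec i) = ∑ b, jac φ y b i • dMat A (φ y) (stdVec b) := by
  ext k l
  rw [Matrix.sum_apply]
  exact pd_comp (hA.diff k l) hφ i

/-- A connection is determined by being symmetric and metric. -/
theorem IsMetricAt.conn_unique (h : IsMetricAt G y) (C : Fin n → Matrix (Fin n) (Fin n) ℝ)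
    (hs : ∀ i j k, C i k j = C j k i)
    (hc : ∀ i, dMat G y (stdVec i) = G y * C i + (C i).transpose * G y) (i : Fin n) :
    conn G i y = C i := by
  -- The difference of the two connections with its upper index lowered is symmetric under one swap
  -- of slots and antisymmetric under another. Alternating the swaps returns to the same component
  -- with the opposite sign, so it is zero.
  let T : Fin n → Matrix (Fin n) (Fin n) ℝ := fun i => G y * (conn G i y - C i)
  have h1 : ∀ i l j, T i l j = T j l i := by
    intro i l j
    simp only [T, Matrix.mul_apply, Matrix.sub_apply, conn_apply]
    exact Finset.sum_congr rfl fun k _ => by rw [h.christoffel_comm, hs]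
  have h2 : ∀ i l j, T i l j = - T i j l := by
    intro i l j
    have h3 : T i + (T i).transpose = 0 := by
      have := (h.dMat_eq i).symm.trans (hc i)
      simp only [T, Matrix.transpose_mul, Matrix.transpose_sub, h.symm.self_of_nhds, mul_sub]
      rw [show ∀ a b c d : Matrix (Fin n) (Fin n) ℝ, a - b + (c - d) = (a + c) - (b + d) by
        intros; abel, this, sub_self]
    exact eq_neg_of_add_eq_zero_left (congrFun (congrFun h3 l) j)
  have h0 : T i = 0 := by
    ext l j
    have : T i l j = - T i l j := by
      conv_lhs => rw [h1, h2, h1, h2, h1]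
      rw [neg_neg, h2]
    rw [Matrix.zero_apply]; linarith
  have := congrArg (fun B => (G y)⁻¹ * B) h0
  simp only [T, mul_zero] at this
  rw [Matrix.nonsing_inv_mul_cancel_left _ _ h.isUnit] at this
  exact sub_eq_zero.1 this

/-- The pullback of the connection matrices under a change of coordinates. -/
def pullConn (G' : EuclideanSpace ℝ (Fin n) → Matrix (Fin n) (Fin n) ℝ)
    (φ : EuclideanSpace ℝ (Fin n) → EuclideanSpace ℝ (Fin n)) (i : Fin n)
    (y : EuclideanSpace ℝ (Fin n)) : Matrix (Fin n) (Fin n) ℝ :=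
  ∑ b, jac φ y b i • conn G' b (φ y)

theorem IsMetricAt.det_jac_ne (h : IsMetricAt G y)
    (hG : G y = (jac φ y).transpose * G' (φ y) * jac φ y) : IsUnit (jac φ y).det := by
  have := h.det_ne
  rw [hG, Matrix.det_mul] at this
  exact isUnit_iff_ne_zero.2 (right_ne_zero_of_mul this)

/-- The inhomogeneous transformation law of a connection. Rather than transforming the Christoffel
formula, one checks that the expected answer J⁻¹(φ*Γ' J + dJ) is symmetric, by equality of mixed
partials, and metric, by differentiating G = JᵀG'J; uniqueness does the rest. -/
theorem jac_mul_conn (h : IsMetricAt G y) (h' : IsMetricAt G' (φ y)) (hφ : ContDiffAt ℝ ∞ φ y)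
    (hG : ∀ᶠ z in 𝓝 y, G z = (jac φ z).transpose * G' (φ z) * jac φ z) (i : Fin n) :
    jac φ y * conn G i y = pullConn G' φ i y * jac φ y + dMat (jac φ) y (stdVec i) := by
  have hJ := h.det_jac_ne hG.self_of_nhds
  have hφd := hφ.differentiableAt_of_smooth
  set J := jac φ y with hJdef
  let C : Fin n → Matrix (Fin n) (Fin n) ℝ := fun i =>
    J⁻¹ * (pullConn G' φ i y * J + dMat (jac φ) y (stdVec i))
  have hJC : ∀ i, J * C i = pullConn G' φ i y * J + dMat (jac φ) y (stdVec i) := fun i =>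
    Matrix.mul_nonsing_inv_cancel_left _ _ hJ
  have hCs : ∀ i j k, C i k j = C j k i := by
    intro i j k
    simp only [C]
    rw [Matrix.mul_apply, Matrix.mul_apply]
    refine Finset.sum_congr rfl fun a _ => ?_
    rw [Matrix.add_apply, Matrix.add_apply, dMat_jac_comm hφ]
    congr 2
    simp only [pullConn, Matrix.mul_apply, Matrix.sum_apply, Matrix.smul_apply, smul_eq_mul,
      conn_apply, Finset.sum_mul]
    rw [Finset.sum_comm]
    refine Finset.sum_congr rfl fun b _ => Finset.sum_congr rfl fun c _ => ?_
    rw [h'.christoffel_comm]; ring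
  have hd : ∀ i, dMat G y (stdVec i) = G y * C i + (C i).transpose * G y := by
    intro i
    have hs := matSmoothAt_jac hφ
    have hG's := h'.smooth.comp hφ
    rw [dMat_congr hG, dMat_mul (hs.transpose.mul hG's) hs, dMat_mul hs.transpose hG's,
      dMat_transpose, dMat_comp h'.smooth hφd, ← hJdef]
    have e1 : ∑ b, J b i • dMat G' (φ y) (stdVec b) =
        G' (φ y) * pullConn G' φ i y + (pullConn G' φ i y).transpose * G' (φ y) := by
      simp only [pullConn, h'.dMat_eq, smul_add, Finset.sum_add_distrib, Finset.mul_sum,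
        Finset.sum_mul, Matrix.transpose_sum, Matrix.transpose_smul, Matrix.mul_smul,
        Matrix.smul_mul]
      rfl
    have e2 : G y * C i = J.transpose * G' (φ y) *
        (pullConn G' φ i y * J + dMat (jac φ) y (stdVec i)) := by
      rw [hG.self_of_nhds, mul_assoc, hJC]
    have e3 : (C i).transpose * G y =
        (pullConn G' φ i y * J + dMat (jac φ) y (stdVec i)).transpose * G' (φ y) * J := by
      rw [hG.self_of_nhds, ← hJC, show (J * C i).transpose = (C i).transpose * J.transpose from
        Matrix.transpose_mul _ _, ← hJdef]
      simp only [mul_assoc]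
    rw [e1, e2, e3, Matrix.transpose_add, Matrix.transpose_mul]
    noncomm_ring
  rw [h.conn_unique C hCs hd i, hJC]

/-- The curvature matrix `∂ᵢAⱼ - ∂ⱼAᵢ + [Aᵢ, Aⱼ]` of the connection matrices. -/
def curvMat (G : EuclideanSpace ℝ (Fin n) → Matrix (Fin n) (Fin n) ℝ) (i j : Fin n)
    (y : EuclideanSpace ℝ (Fin n)) : Matrix (Fin n) (Fin n) ℝ :=
  dMat (conn G j) y (stdVec i) - dMat (conn G i) y (stdVec j) +
    (conn G i y * conn G j y - conn G j y * conn G i y)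

/-- The upper index is contracted with the first form index. The symmetry of Γ is needed near the
point, since it is used under a derivative. -/
theorem ricciCoord_eq_curvMat (h : ∀ᶠ z in 𝓝 y, IsMetricAt G z) (i j : Fin n) :
    ricciCoord G i j y = ∑ k, curvMat G k j y k i := by
  have h0 := h.self_of_nhds
  simp only [ricciCoord, curvMat, Matrix.add_apply, Matrix.sub_apply, Matrix.mul_apply,
    conn_apply, Finset.sum_add_distrib, Finset.sum_sub_distrib]
  have e1 : ∀ k, pd k (christoffel G k i j) y = dMat (conn G j) y (stdVec k) k i := fun k =>
    pd_congr (h.mono fun z hz => hz.christoffel_comm k i j) k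
  have e2 : ∀ k, pd j (christoffel G k i k) y = dMat (conn G k) y (stdVec j) k i := fun k =>
    pd_congr (h.mono fun z hz => hz.christoffel_comm k i k) j
  simp only [e1, e2, fun l => h0.christoffel_comm l i]

/-- Curvature transforms by conjugation: differentiate JΓ = (φ*Γ')J + dJ and antisymmetrise, so that
the second derivatives of J cancel. Keeping J on the left avoids differentiating J⁻¹. -/
theorem jac_mul_curvMat (h : ∀ᶠ z in 𝓝 y, IsMetricAt G z) (h' : ∀ᶠ z in 𝓝 (φ y), IsMetricAt G' z)
    (hφ : ∀ᶠ z in 𝓝 y, ContDiffAt ℝ ∞ φ z)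
    (hG : ∀ᶠ z in 𝓝 y, G z = (jac φ z).transpose * G' (φ z) * jac φ z) (i j : Fin n) :
    jac φ y * curvMat G i j y =
      (∑ b, ∑ c, (jac φ y b i * jac φ y c j) • curvMat G' b c (φ y)) * jac φ y := by
  have h0 := h.self_of_nhds
  have h0' := h'.self_of_nhds
  have hφ0 := hφ.self_of_nhds
  have hφd := hφ0.differentiableAt_of_smooth
  have hJs := matSmoothAt_jac hφ0
  have hT : ∀ᶠ z in 𝓝 y, ∀ i, jac φ z * conn G i z =
      pullConn G' φ i z * jac φ z + dMat (jac φ) z (stdVec i) := by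
    filter_upwards [h, hφ0.continuousAt.eventually h', hφ, eventually_eventually_nhds.2 hG]
      with z h1 h2 h3 h4 i using jac_mul_conn h1 h2 h3 h4 i
  have hJi : ∀ b i, ContDiffAt ℝ ∞ (fun z => jac φ z b i) y := fun b i => hJs b i
  have hPterm : ∀ i, ∀ b ∈ Finset.univ, MatSmoothAt (fun z => jac φ z b i • conn G' b (φ z)) y :=
    fun i b _ => MatSmoothAt.smul (hJi b i) ((h0'.matSmoothAt_conn b).comp hφ0)
  have hPs : ∀ i, MatSmoothAt (pullConn G' φ i) y := fun i => MatSmoothAt.sum (hPterm i)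
  have hdJs : ∀ i, MatSmoothAt (fun z => dMat (jac φ) z (stdVec i)) y := fun i a b =>
    contDiffAt_pd (hJi a b) i
  have hdd : ∀ i j, dMat (fun z => dMat (jac φ) z (stdVec j)) y (stdVec i) =
      dMat (fun z => dMat (jac φ) z (stdVec i)) y (stdVec j) := by
    intro i j; ext a b; exact pd_comm (hJi a b) i j
  have hD : ∀ i j, dMat (jac φ) y (stdVec i) * conn G j y + jac φ y * dMat (conn G j) y (stdVec i)
      = dMat (pullConn G' φ j) y (stdVec i) * jac φ y + pullConn G' φ j y *
        dMat (jac φ) y (stdVec i) + dMat (fun z => dMat (jac φ) z (stdVec j)) y (stdVec i) := by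
    intro i j
    rw [← dMat_mul hJs (h0.matSmoothAt_conn j), ← dMat_mul (hPs j) hJs,
      ← dMat_add ((hPs j).mul hJs) (hdJs j)]
    exact dMat_congr (hT.mono fun z hz => hz j) _
  have hP : ∀ i j, dMat (pullConn G' φ j) y (stdVec i) =
      (∑ c, dMat (jac φ) y (stdVec i) c j • conn G' c (φ y)) +
      ∑ c, ∑ b, (jac φ y b i * jac φ y c j) • dMat (conn G' c) (φ y) (stdVec b) := by
    intro i j
    have : dMat (pullConn G' φ j) y (stdVec i) = _ :=
      dMat_sum Finset.univ (A := fun b z => jac φ z b j • conn G' b (φ z)) (hPterm j) (stdVec i)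
    rw [this, ← Finset.sum_add_distrib]
    refine Finset.sum_congr rfl fun c _ => ?_
    rw [dMat_smul (hJi c j).differentiableAt_of_smooth ((h0'.matSmoothAt_conn c).comp hφ0),
      dMat_comp (h0'.matSmoothAt_conn c) hφd, Finset.smul_sum]
    simp only [smul_smul, mul_comm]
    rfl
  have hPQ : ∀ i j, pullConn G' φ i y * pullConn G' φ j y =
      ∑ b, ∑ c, (jac φ y b i * jac φ y c j) • (conn G' b (φ y) * conn G' c (φ y)) := by
    intro i j
    simp only [pullConn, Finset.sum_mul, Finset.mul_sum, Matrix.smul_mul, Matrix.mul_smul,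
      smul_smul]
    rw [Finset.sum_comm]
    exact Finset.sum_congr rfl fun b _ => Finset.sum_congr rfl fun c _ => by
      rw [mul_comm (jac φ y b i)]
  have hsum : ∑ b, ∑ c, (jac φ y b i * jac φ y c j) • curvMat G' b c (φ y) =
      dMat (pullConn G' φ j) y (stdVec i) - dMat (pullConn G' φ i) y (stdVec j) +
      (pullConn G' φ i y * pullConn G' φ j y - pullConn G' φ j y * pullConn G' φ i y) := by
    rw [hP, hP, hPQ, hPQ]
    have e1 : ∀ c, dMat (jac φ) y (stdVec j) c i = dMat (jac φ) y (stdVec i) c j := fun c =>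
      dMat_jac_comm hφ0 j i c
    simp only [e1, curvMat, smul_add, smul_sub, Finset.sum_add_distrib, Finset.sum_sub_distrib]
    rw [add_sub_add_left_eq_sub, Finset.sum_comm (f := fun c b => (jac φ y b i * jac φ y c j) •
      dMat (conn G' c) (φ y) (stdVec b)), Finset.sum_comm (f := fun b c =>
      (jac φ y b j * jac φ y c i) • (conn G' b (φ y) * conn G' c (φ y)))]
    simp only [mul_comm (jac φ y _ j)]
  rw [hsum, curvMat]
  have hT0 := hT.self_of_nhds
  have a1 := hD i j
  have a2 := hD j i
  rw [hdd j i] at a2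
  have b1 : jac φ y * (conn G i y * conn G j y) = pullConn G' φ i y * (pullConn G' φ j y * jac φ y
      + dMat (jac φ) y (stdVec j)) + dMat (jac φ) y (stdVec i) * conn G j y := by
    rw [← mul_assoc, hT0 i, add_mul, mul_assoc, hT0 j]
  have b2 : jac φ y * (conn G j y * conn G i y) = pullConn G' φ j y * (pullConn G' φ i y * jac φ y
      + dMat (jac φ) y (stdVec i)) + dMat (jac φ) y (stdVec j) * conn G i y := by
    rw [← mul_assoc, hT0 j, add_mul, mul_assoc, hT0 i]
  have a1' := eq_sub_of_add_eq' a1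
  have a2' := eq_sub_of_add_eq' a2
  rw [mul_add, mul_sub, mul_sub, a1', a2', b1, b2]
  noncomm_ring

/-- In the contraction defining Ricci, the J⁻¹ of the conjugation meets the J of the contracted form
index and the pair collapses to a Kronecker delta. -/
theorem ricciCoord_change (h : ∀ᶠ z in 𝓝 y, IsMetricAt G z)
    (h' : ∀ᶠ z in 𝓝 (φ y), IsMetricAt G' z) (hφ : ∀ᶠ z in 𝓝 y, ContDiffAt ℝ ∞ φ z)
    (hG : ∀ᶠ z in 𝓝 y, G z = (jac φ z).transpose * G' (φ z) * jac φ z) :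
    (Matrix.of fun i j => ricciCoord G i j y) =
      (jac φ y).transpose * (Matrix.of fun i j => ricciCoord G' i j (φ y)) * jac φ y := by
  have hJ := h.self_of_nhds.det_jac_ne hG.self_of_nhds
  have hF : ∀ i j, curvMat G i j y = (jac φ y)⁻¹ *
      ((∑ b, ∑ c, (jac φ y b i * jac φ y c j) • curvMat G' b c (φ y)) * jac φ y) := fun i j => by
    rw [← jac_mul_curvMat h h' hφ hG, Matrix.nonsing_inv_mul_cancel_left _ _ hJ]
  ext i j
  rw [Matrix.of_apply, ricciCoord_eq_curvMat h]
  have hone : ∀ a b, ∑ k, jac φ y b k * (jac φ y)⁻¹ k a = if b = a then 1 else 0 := by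
    intro a b
    rw [← Matrix.mul_apply, Matrix.mul_nonsing_inv _ hJ, Matrix.one_apply]
  calc ∑ k, curvMat G k j y k i
      = ∑ k, ∑ a, ∑ d, ∑ b, ∑ c, (jac φ y b k * (jac φ y)⁻¹ k a) *
          (jac φ y c j * curvMat G' b c (φ y) a d * jac φ y d i) := by
        refine Finset.sum_congr rfl fun k _ => ?_
        rw [hF, Matrix.mul_apply]
        refine Finset.sum_congr rfl fun a _ => ?_
        rw [Matrix.mul_apply, Finset.mul_sum]
        refine Finset.sum_congr rfl fun d _ => ?_
        simp only [Matrix.sum_apply, Matrix.smul_apply, smul_eq_mul, Finset.sum_mul,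
          Finset.mul_sum]
        exact Finset.sum_congr rfl fun b _ => Finset.sum_congr rfl fun c _ => by ring
    _ = ∑ a, ∑ d, ∑ b, ∑ c, (if b = a then 1 else 0) *
          (jac φ y c j * curvMat G' b c (φ y) a d * jac φ y d i) := by
        simp only [← hone, Finset.sum_mul]
        rw [Finset.sum_comm]
        refine Finset.sum_congr rfl fun a _ => ?_
        rw [Finset.sum_comm]
        refine Finset.sum_congr rfl fun d _ => ?_
        rw [Finset.sum_comm]
        refine Finset.sum_congr rfl fun b _ => ?_
        rw [Finset.sum_comm]
    _ = ∑ a, ∑ d, ∑ c, (jac φ y c j * curvMat G' a c (φ y) a d * jac φ y d i) := by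
        simp only [ite_mul, one_mul, zero_mul]
        refine Finset.sum_congr rfl fun a _ => Finset.sum_congr rfl fun d _ => ?_
        rw [Finset.sum_comm]
        simp
    _ = _ := by
        simp only [Matrix.mul_apply, Matrix.transpose_apply, Matrix.of_apply, Finset.sum_mul,
          ricciCoord_eq_curvMat h', Finset.mul_sum]
        rw [Finset.sum_comm]
        refine (Finset.sum_congr rfl fun d _ => Finset.sum_comm).trans
          (Finset.sum_comm.trans ?_)
        exact Finset.sum_congr rfl fun c _ => Finset.sum_congr rfl fun d _ =>
          Finset.sum_congr rfl fun a _ => by ring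

theorem scalarCoord_eq_trace (h : IsMetricAt G y) :
    scalarCoord G y = ((G y)⁻¹ * Matrix.of fun i j => ricciCoord G i j y).trace := by
  simp only [scalarCoord, Matrix.trace, Matrix.diag, Matrix.mul_apply, Matrix.of_apply]
  rw [Finset.sum_comm]
  exact Finset.sum_congr rfl fun i _ => Finset.sum_congr rfl fun j _ => by
    rw [h.inv_apply_comm]

theorem scalarCoord_change (h : ∀ᶠ z in 𝓝 y, IsMetricAt G z)
    (h' : ∀ᶠ z in 𝓝 (φ y), IsMetricAt G' z) (hφ : ∀ᶠ z in 𝓝 y, ContDiffAt ℝ ∞ φ z)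
    (hG : ∀ᶠ z in 𝓝 y, G z = (jac φ z).transpose * G' (φ z) * jac φ z) :
    scalarCoord G y = scalarCoord G' (φ y) := by
  have hJ := h.self_of_nhds.det_jac_ne hG.self_of_nhds
  have hJt : IsUnit (jac φ y).transpose.det := by rwa [Matrix.det_transpose]
  rw [scalarCoord_eq_trace h.self_of_nhds, scalarCoord_eq_trace h'.self_of_nhds,
    ricciCoord_change h h' hφ hG, hG.self_of_nhds, Matrix.mul_inv_rev, Matrix.mul_inv_rev,
    mul_assoc (jac φ y)⁻¹, Matrix.trace_mul_comm (jac φ y)⁻¹, ← mul_assoc,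
    Matrix.mul_nonsing_inv_cancel_right _ _ hJ, mul_assoc,
    Matrix.nonsing_inv_mul_cancel_left _ _ hJt]

end ChangeOfCoordinates


/-! ### Contractions of the conformal difference tensor. -/

section DifferenceTensor

variable {n : ℕ}

/-- The difference `δᵏᵢ aⱼ + δᵏⱼ aᵢ - gᵢⱼ uᵏ` of the Christoffel symbols of conformal metrics. -/
def confTensor (g : Matrix (Fin n) (Fin n) ℝ) (a u : Fin n → ℝ) (k i j : Fin n) : ℝ :=
  (if k = i then a j else 0) + (if k = j then a i else 0) - g i j * u k

variable {g : Matrix (Fin n) (Fin n) ℝ} {a u : Fin n → ℝ}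

theorem confTensor_trace (hs : ∀ i j, g i j = g j i)
    (hu : ∀ i, ∑ k, g i k * u k = a i) (l : Fin n) : ∑ k, confTensor g a u k k l = n * a l := by
  simp only [confTensor, Finset.sum_add_distrib, Finset.sum_sub_distrib, if_true,
    Finset.sum_ite_eq', Finset.mem_univ]
  simp only [fun k => hs k l, hu, Finset.sum_const, Finset.card_univ, Fintype.card_fin,
    nsmul_eq_mul]
  ring

theorem confTensor_trace' (hs : ∀ i j, g i j = g j i)
    (hu : ∀ i, ∑ k, g i k * u k = a i) (l : Fin n) : ∑ k, confTensor g a u k l k = n * a l := by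
  rw [← confTensor_trace hs hu]
  refine Finset.sum_congr rfl fun k _ => ?_
  rw [confTensor, confTensor, hs l k]; ring

theorem sum_mul_confTensor (b : Fin n → ℝ) (i j : Fin n) :
    ∑ l, b l * confTensor g a u l i j = b i * a j + b j * a i - g i j * ∑ l, b l * u l := by
  simp only [confTensor, mul_add, mul_sub, Finset.sum_add_distrib, Finset.sum_sub_distrib,
    mul_ite, mul_zero, Finset.sum_ite_eq', Finset.mem_univ, if_true, Finset.mul_sum]
  congr 1
  exact Finset.sum_congr rfl fun l _ => by ring

/-- Keeping `B` arbitrary serves two purposes: Christoffel symbols give the cross terms of the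
conformal Ricci formula, and the difference tensor itself gives the quadratic term. -/
theorem sum_confTensor_mul (B : Matrix (Fin n) (Fin n) ℝ) (j : Fin n) :
    ∑ k, ∑ l, confTensor g a u k j l * B l k =
      (∑ l, a l * B l j) + a j * (∑ k, B k k) - ∑ k, (∑ l, g j l * B l k) * u k := by
  have e1 : ∑ k, ∑ l, (if k = j then a l else 0) * B l k = ∑ l, a l * B l j := by
    rw [Finset.sum_comm]
    simp
  have e2 : ∑ k, ∑ l, (if k = l then a j else 0) * B l k = a j * ∑ k, B k k := by
    simp [Finset.mul_sum]
  have e3 : ∑ k, ∑ l, g j l * u k * B l k = ∑ k, (∑ l, g j l * B l k) * u k :=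
    Finset.sum_congr rfl fun k _ => by
      rw [Finset.sum_mul]
      exact Finset.sum_congr rfl fun l _ => by ring
  rw [← e1, ← e2, ← e3]
  simp only [confTensor, sub_mul, add_mul, Finset.sum_add_distrib, Finset.sum_sub_distrib]

theorem confTensor_sq (hs : ∀ i j, g i j = g j i)
    (hu : ∀ i, ∑ k, g i k * u k = a i) (i j : Fin n) :
    ∑ k, ∑ l, confTensor g a u k j l * confTensor g a u l i k =
      (n + 2) * (a i * a j) - 2 * (g i j * ∑ l, a l * u l) := by
  have h0 := sum_confTensor_mul (g := g) (a := a) (u := u)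
    (Matrix.of fun l k => confTensor g a u l i k) j
  simp only [Matrix.of_apply] at h0
  rw [h0]
  have e := sum_mul_confTensor (g := g) (a := a) (u := u)
  rw [e a, confTensor_trace' hs hu]
  simp only [fun k => e (fun l => g j l) i k, hu]
  simp only [sub_mul, add_mul, Finset.sum_add_distrib, Finset.sum_sub_distrib, mul_assoc,
    ← Finset.mul_sum]
  have e2 : ∑ k, g i k * (a j * u k) = a j * a i := by
    rw [← hu i, Finset.mul_sum]; exact Finset.sum_congr rfl fun k _ => by ring
  have e3 : ∑ k, g j k * (a i * u k) = a i * a j := by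
    rw [← hu j, Finset.mul_sum]; exact Finset.sum_congr rfl fun k _ => by ring
  rw [e2, e3, hs j i]
  ring

end DifferenceTensor

/-! ### Conformal change of connection, Ricci tensor and Hessian. -/

section Conformal

variable {n : ℕ} {G : EuclideanSpace ℝ (Fin n) → Matrix (Fin n) (Fin n) ℝ}
    {y : EuclideanSpace ℝ (Fin n)} {φ : EuclideanSpace ℝ (Fin n) → ℝ}

/-- The components `∑ₗ gᵏˡ ∂ₗφ` of the gradient. -/
def gradCoord (G : EuclideanSpace ℝ (Fin n) → Matrix (Fin n) (Fin n) ℝ)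
    (φ : EuclideanSpace ℝ (Fin n) → ℝ) (k : Fin n) (y : EuclideanSpace ℝ (Fin n)) : ℝ :=
  ∑ l, (G y)⁻¹ k l * pd l φ y

/-- The Laplacian `∑ gⁱʲ (∇²φ)ᵢⱼ`. -/
def lapCoord (G : EuclideanSpace ℝ (Fin n) → Matrix (Fin n) (Fin n) ℝ)
    (φ : EuclideanSpace ℝ (Fin n) → ℝ) (y : EuclideanSpace ℝ (Fin n)) : ℝ :=
  ∑ i, ∑ j, (G y)⁻¹ i j * hessCoord G φ i j y

theorem IsMetricAt.mul_gradCoord (h : IsMetricAt G y) (i : Fin n) :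
    ∑ k, G y i k * gradCoord G φ k y = pd i φ y := by
  have : Matrix.mulVec (G y) (Matrix.mulVec (G y)⁻¹ fun l => pd l φ y) = fun l => pd l φ y := by
    rw [Matrix.mulVec_mulVec, Matrix.mul_nonsing_inv _ h.isUnit, Matrix.one_mulVec]
  exact congrFun this i

theorem IsMetricAt.contDiffAt_gradCoord (h : IsMetricAt G y) (hφ : ContDiffAt ℝ ∞ φ y)
    (k : Fin n) : ContDiffAt ℝ ∞ (gradCoord G φ k) y :=
  ContDiffAt.sum fun l _ => (h.smooth.inv h.det_ne k l).mul (contDiffAt_pd hφ l)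

/-- The derivative of g⁻¹ contributes two Christoffel terms: one cancels the trace term of the
divergence, the other is the correction in the Hessian. -/
theorem IsMetricAt.div_gradCoord (h : IsMetricAt G y) (hφ : ContDiffAt ℝ ∞ φ y) :
    (∑ k, pd k (gradCoord G φ k) y) + ∑ l, (∑ k, christoffel G k k l y) * gradCoord G φ l y =
      lapCoord G φ y := by
  have e1 : ∀ k, pd k (gradCoord G φ k) y = ∑ l, (pd k (fun z => (G z)⁻¹ k l) y * pd l φ y +
      (G y)⁻¹ k l * pd k (pd l φ) y) := by
    intro k
    have hd := fun l => (h.smooth.inv h.det_ne).diff k l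
    have hd' := fun l => (contDiffAt_pd hφ l).differentiableAt_of_smooth
    unfold pd gradCoord
    rw [fderiv_sum_apply (F := fun l z => (G z)⁻¹ k l * pd l φ z) _
      fun l _ => (hd l).mul (hd' l)]
    exact Finset.sum_congr rfl fun l _ => fderiv_mul_apply (hd l) (hd' l) _
  have e2 : ∑ l, (∑ k, christoffel G k k l y) * gradCoord G φ l y =
      ∑ k, ∑ l, (∑ m, christoffel G k k m y * (G y)⁻¹ m l) * pd l φ y := by
    simp only [gradCoord, Finset.mul_sum, Finset.sum_mul]
    refine (Finset.sum_congr rfl fun l _ => Finset.sum_comm).trans (Finset.sum_comm.trans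
      (Finset.sum_congr rfl fun i _ => Finset.sum_comm.trans ?_))
    exact Finset.sum_congr rfl fun x _ => Finset.sum_congr rfl fun l _ => by ring
  have e3 : ∑ k, ∑ l, (∑ m, (G y)⁻¹ k m * christoffel G l k m y) * pd l φ y =
      ∑ k, ∑ l, (G y)⁻¹ k l * ∑ m, christoffel G m k l y * pd m φ y := by
    refine Finset.sum_congr rfl fun k _ => ?_
    simp only [Finset.mul_sum, Finset.sum_mul]
    rw [Finset.sum_comm]
    exact Finset.sum_congr rfl fun l _ => Finset.sum_congr rfl fun m _ => by ring
  simp only [e1, e2, lapCoord, hessCoord, h.pd_inv, mul_sub, Finset.sum_sub_distrib, ← e3, neg_mul,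
    add_mul, Finset.sum_add_distrib, Finset.sum_neg_distrib]
  ring

theorem conf_isMetricAt (h : IsMetricAt G y) (hφ : ContDiffAt ℝ ∞ φ y) :
    IsMetricAt (fun z => Real.exp (2 * φ z) • G z) y where
  smooth := MatSmoothAt.smul (contDiffAt_const.mul hφ).exp h.smooth
  symm := h.symm.mono fun z hz => by rw [Matrix.transpose_smul, hz]
  det_ne := by
    rw [Matrix.det_smul]
    exact mul_ne_zero (pow_ne_zero _ (Real.exp_pos _).ne') h.det_ne

/-- By uniqueness it suffices that the right-hand side is symmetric and compatible with e^{2φ}g. The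
difference tensor, lowered and symmetrised, gives 2(∂ᵢφ)g, the derivative of the conformal factor.
-/
theorem conf_christoffel (h : IsMetricAt G y) (hφ : ContDiffAt ℝ ∞ φ y) (k i j : Fin n) :
    christoffel (fun z => Real.exp (2 * φ z) • G z) k i j y = christoffel G k i j y +
      confTensor (G y) (fun l => pd l φ y) (fun l => gradCoord G φ l y) k i j := by
  set a := fun l => pd l φ y with ha
  set u := fun l => gradCoord G φ l y with hu
  have hgs := h.apply_comm
  have hgu : ∀ i, ∑ k, G y i k * u k = a i := fun i => h.mul_gradCoord i
  have := (conf_isMetricAt h hφ).conn_unique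
    (fun i => Matrix.of fun k j => christoffel G k i j y + confTensor (G y) a u k i j) ?_ ?_ i
  · exact congrFun (congrFun this k) j
  · intro i j k
    simp only [Matrix.of_apply]
    rw [h.christoffel_comm, confTensor, confTensor, hgs]; ring
  · intro i
    rw [dMat_smul (contDiffAt_const.mul hφ).exp.differentiableAt_of_smooth h.smooth, h.dMat_eq]
    have e : fderiv ℝ (fun z => Real.exp (2 * φ z)) y (stdVec i) =
        Real.exp (2 * φ y) * (2 * a i) := by
      rw [fderiv_exp (hφ.differentiableAt_of_smooth.const_mul _),
        fderiv_const_mul hφ.differentiableAt_of_smooth]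
      rfl
    ext l j
    rw [e]
    simp only [Matrix.add_apply, Matrix.smul_apply, smul_eq_mul, Matrix.mul_apply,
      Matrix.transpose_apply, Matrix.of_apply, conn_apply, mul_add, add_mul,
      Finset.sum_add_distrib]
    have e1 : ∀ l j, ∑ x, Real.exp (2 * φ y) * G y l x * confTensor (G y) a u x i j =
        Real.exp (2 * φ y) * (G y l i * a j + G y l j * a i - G y i j * a l) := by
      intro l j
      rw [← hgu l, ← sum_mul_confTensor (fun x => G y l x) i j, Finset.mul_sum]
      exact Finset.sum_congr rfl fun x _ => by ring
    have e2 : ∑ x, confTensor (G y) a u x i l * (Real.exp (2 * φ y) * G y x j) =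
        Real.exp (2 * φ y) * (G y j i * a l + G y j l * a i - G y i l * a j) := by
      rw [← e1 j l]
      exact Finset.sum_congr rfl fun x _ => by rw [hgs x j]; ring
    rw [e1, e2]
    simp only [mul_assoc, ← Finset.mul_sum]
    have e3 : ∑ x, christoffel G x i l y * (Real.exp (2 * φ y) * G y x j) =
        Real.exp (2 * φ y) * ∑ x, christoffel G x i l y * G y x j := by
      rw [Finset.mul_sum]
      exact Finset.sum_congr rfl fun x _ => by ring
    rw [e3, hgs j l, hgs j i, hgs l i]
    ring

/-- How the Ricci tensor depends on the connection. -/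
theorem ricciCoord_add {G' : EuclideanSpace ℝ (Fin n) → Matrix (Fin n) (Fin n) ℝ}
    {D : Fin n → Fin n → Fin n → EuclideanSpace ℝ (Fin n) → ℝ}
    (hG : ∀ k i j, DifferentiableAt ℝ (christoffel G k i j) y)
    (hD : ∀ k i j, DifferentiableAt ℝ (D k i j) y)
    (h : ∀ᶠ z in 𝓝 y, ∀ k i j, christoffel G' k i j z = christoffel G k i j z + D k i j z)
    (i j : Fin n) :
    ricciCoord G' i j y = ricciCoord G i j y +
      (((∑ k, pd k (D k i j) y) - ∑ k, pd j (D k i k) y) +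
      ((∑ k, ∑ l, christoffel G k k l y * D l i j y) + (∑ k, ∑ l, D k k l y * christoffel G l i j y)
       + (∑ k, ∑ l, D k k l y * D l i j y) - (∑ k, ∑ l, christoffel G k j l y * D l i k y)
       - (∑ k, ∑ l, D k j l y * christoffel G l i k y) - ∑ k, ∑ l, D k j l y * D l i k y)) := by
  have e : ∀ m k i j, pd m (christoffel G' k i j) y =
      pd m (christoffel G k i j) y + pd m (D k i j) y := by
    intro m k i j
    rw [pd_congr (F' := fun z => christoffel G k i j z + D k i j z) (h.mono fun z hz => hz k i j)]
    unfold pd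
    rw [fderiv_fun_add (hG _ _ _) (hD _ _ _)]; rfl
  simp only [ricciCoord, e, h.self_of_nhds, ← Finset.sum_add_distrib, ← Finset.sum_sub_distrib]
  refine Finset.sum_congr rfl fun k _ => ?_
  have e2 : ∀ x, (christoffel G k k x y + D k k x y) * (christoffel G x i j y + D x i j y) -
      (christoffel G k j x y + D k j x y) * (christoffel G x i k y + D x i k y) =
      (christoffel G k k x y * christoffel G x i j y - christoffel G k j x y * christoffel G x i k y)
      + (christoffel G k k x y * D x i j y + D k k x y * christoffel G x i j y +
        D k k x y * D x i j y - christoffel G k j x y * D x i k y -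
        D k j x y * christoffel G x i k y - D k j x y * D x i k y) := fun x => by ring
  rw [Finset.sum_congr rfl fun x _ => e2 x, Finset.sum_add_distrib]
  ring

/-- Expand Ricci of Γ + D. The derivatives of D (`d1`, `d2`) and the cross terms with Γ (`q1`, `q2`,
`q4`, `q5`) assemble into ∇²φ and Δφ; the terms quadratic in D (`q3`, `q6`) give dφ⊗dφ and |dφ|²g.
-/
theorem conf_ricciCoord (h : ∀ᶠ z in 𝓝 y, IsMetricAt G z) (hφ : ∀ᶠ z in 𝓝 y, ContDiffAt ℝ ∞ φ z)
    (i j : Fin n) :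
    ricciCoord (fun z => Real.exp (2 * φ z) • G z) i j y = ricciCoord G i j y -
      (n - 2) * (hessCoord G φ i j y - pd i φ y * pd j φ y) -
      (lapCoord G φ y + (n - 2) * ∑ k, pd k φ y * gradCoord G φ k y) * G y i j := by
  have h0 := h.self_of_nhds
  have hφ0 := hφ.self_of_nhds
  have hgs := h0.apply_comm
  set a := fun l => pd l φ y with ha
  set u := fun l => gradCoord G φ l y with hu
  have hgu : ∀ i, ∑ k, G y i k * u k = a i := fun i => h0.mul_gradCoord i
  let D : Fin n → Fin n → Fin n → EuclideanSpace ℝ (Fin n) → ℝ := fun k i j z =>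
    confTensor (G z) (fun l => pd l φ z) (fun l => gradCoord G φ l z) k i j
  have hpd : ∀ i, DifferentiableAt ℝ (pd i φ) y := fun i =>
    (contDiffAt_pd hφ0 i).differentiableAt_of_smooth
  have hgrad : ∀ i, DifferentiableAt ℝ (gradCoord G φ i) y := fun i =>
    (h0.contDiffAt_gradCoord hφ0 i).differentiableAt_of_smooth
  have hif : ∀ (p : Prop) [Decidable p] (i : Fin n),
      DifferentiableAt ℝ (fun z => if p then pd i φ z else 0) y := by
    intro p _ i
    split_ifs
    · exact hpd i
    · exact differentiableAt_const _
  have hDd : ∀ k i j, DifferentiableAt ℝ (D k i j) y := fun k i j =>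
    ((hif (k = i) j).add (hif (k = j) i)).sub ((h0.smooth.diff i j).mul (hgrad k))
  rw [ricciCoord_add (D := D)
    (fun k i j => (contDiffAt_christoffel h0.smooth h0.det_ne k i j).differentiableAt_of_smooth) hDd
    (by filter_upwards [h, hφ] with z hz hz' k i j using conf_christoffel hz hz' k i j)]
  have d1 : ∑ k, pd j (D k i k) y = n * pd j (pd i φ) y := by
    have : ∑ k, pd j (D k i k) y = pd j (fun z => ∑ k, D k i k z) y :=
      (fderiv_sum_apply _ (fun k _ => hDd k i k) _).symm
    rw [this, pd_congr (F' := fun z => (n : ℝ) * pd i φ z)]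
    · have := fderiv_const_mul (hpd i) (n : ℝ)
      exact congrArg (fun L => L (stdVec j)) this
    · filter_upwards [h] with z hz
      exact confTensor_trace' hz.apply_comm (fun i => hz.mul_gradCoord i) i
  have d2 : ∑ k, pd k (D k i j) y = pd i (pd j φ) y + pd j (pd i φ) y -
      ((∑ k, pd k (fun z => G z i j) y * u k) + G y i j * ∑ k, pd k (gradCoord G φ k) y) := by
    have : ∀ k, pd k (D k i j) y = (if k = i then pd i (pd j φ) y else 0) +
        (if k = j then pd j (pd i φ) y else 0) -
        (pd k (fun z => G z i j) y * u k + G y i j * pd k (gradCoord G φ k) y) := by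
      intro k
      have e : pd k (D k i j) y = pd k (fun z => if k = i then pd j φ z else 0) y +
          pd k (fun z => if k = j then pd i φ z else 0) y -
          pd k (fun z => G z i j * gradCoord G φ k z) y := by
        unfold pd
        have := fderiv_fun_sub ((hif (k = i) j).add (hif (k = j) i))
          ((h0.smooth.diff i j).mul (hgrad k))
        have h2 := fderiv_fun_add (hif (k = i) j) (hif (k = j) i)
        exact congrArg (fun L => L (stdVec k)) (this.trans (congrArg (· - _) h2))
      rw [e]
      congr 1
      · congr 1
        · split_ifs with hk
          · rw [hk]
          · simp [pd]
        · split_ifs with hk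
          · rw [hk]
          · simp [pd]
      · exact fderiv_mul_apply (h0.smooth.diff i j) (hgrad k) _
    simp only [this, Finset.sum_add_distrib, Finset.sum_sub_distrib, Finset.sum_ite_eq',
      Finset.mem_univ, if_true, Finset.mul_sum]
  have q1 : ∑ k, ∑ l, christoffel G k k l y * D l i j y =
      (∑ k, christoffel G k k i y) * a j + (∑ k, christoffel G k k j y) * a i -
        G y i j * ∑ l, (∑ k, christoffel G k k l y) * u l := by
    rw [Finset.sum_comm]
    simp only [← Finset.sum_mul]
    exact sum_mul_confTensor (fun l => ∑ k, christoffel G k k l y) i j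
  have t : ∀ l, ∑ k, D k k l y = n * a l := fun l => confTensor_trace hgs hgu l
  have q2 : ∑ k, ∑ l, D k k l y * christoffel G l i j y = n * ∑ l, christoffel G l i j y * a l := by
    rw [Finset.sum_comm, Finset.mul_sum]
    simp only [← Finset.sum_mul, t]
    exact Finset.sum_congr rfl fun l _ => by ring
  have q3 : ∑ k, ∑ l, D k k l y * D l i j y =
      n * (2 * (a i * a j) - G y i j * ∑ l, a l * u l) := by
    rw [Finset.sum_comm]
    simp only [← Finset.sum_mul, t, mul_assoc, ← Finset.mul_sum]
    have := sum_mul_confTensor (g := G y) (a := a) (u := u) a i j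
    rw [show ∑ l, a l * D l i j y = _ from this]; ring
  have q4 : ∑ k, ∑ l, christoffel G k j l y * D l i k y = (∑ l, christoffel G l i j y * a l) +
      (∑ k, christoffel G k k j y) * a i - ∑ k, (∑ l, G y i l * christoffel G l k j y) * u k := by
    have := sum_confTensor_mul (g := G y) (a := a) (u := u) (Matrix.of fun l k => christoffel G l j k y) i
    rw [Finset.sum_comm]
    simp only [Matrix.of_apply] at this
    have e : ∑ k, ∑ l, christoffel G l j k y * D k i l y =
        ∑ k, ∑ l, confTensor (G y) a u k i l * christoffel G l j k y :=
      Finset.sum_congr rfl fun k _ => Finset.sum_congr rfl fun l _ => mul_comm _ _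
    rw [e, this]
    simp only [mul_comm (a _), fun l k => h0.christoffel_comm l j k]
  have q5 : ∑ k, ∑ l, D k j l y * christoffel G l i k y = (∑ l, christoffel G l i j y * a l) +
      (∑ k, christoffel G k k i y) * a j - ∑ k, (∑ l, christoffel G l k i y * G y l j) * u k := by
    have := sum_confTensor_mul (g := G y) (a := a) (u := u) (Matrix.of fun l k => christoffel G l i k y) j
    simp only [Matrix.of_apply] at this
    rw [show ∑ k, ∑ l, D k j l y * christoffel G l i k y = _ from this]
    simp only [mul_comm (a _), fun k => h0.christoffel_comm k i k, hgs j]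
    simp only [mul_comm (G y _ _), fun l k => h0.christoffel_comm l i k]
  have q6 : ∑ k, ∑ l, D k j l y * D l i k y =
      (n + 2) * (a i * a j) - 2 * (G y i j * ∑ l, a l * u l) := confTensor_sq hgs hgu i j
  rw [d1, d2, q1, q2, q3, q4, q5, q6, ← h0.div_gradCoord hφ0, pd_comm hφ0 j i]
  simp only [h0.pd_eq, add_mul, Finset.sum_add_distrib, hessCoord]
  ring

theorem conf_hessCoord (h : IsMetricAt G y) (hφ : ContDiffAt ℝ ∞ φ y)
    (f : EuclideanSpace ℝ (Fin n) → ℝ) (i j : Fin n) :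
    hessCoord (fun z => Real.exp (2 * φ z) • G z) f i j y = hessCoord G f i j y -
      pd i f y * pd j φ y - pd i φ y * pd j f y +
      G y i j * ∑ k, pd k f y * gradCoord G φ k y := by
  have := sum_mul_confTensor (g := G y) (a := fun l => pd l φ y)
    (u := fun l => gradCoord G φ l y) (fun k => pd k f y) i j
  simp only [hessCoord, conf_christoffel h hφ, add_mul, Finset.sum_add_distrib]
  rw [Finset.sum_congr rfl fun k _ => mul_comm (confTensor _ _ _ k i j) (pd k f y), this]
  ring

end Conformal


/-! ### From the Euler-Lagrange equation to the quasi-Einstein equation. -/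

section QuasiEinstein

variable {n : ℕ} {G : EuclideanSpace ℝ (Fin n) → Matrix (Fin n) (Fin n) ℝ}
    {y : EuclideanSpace ℝ (Fin n)} {ρ : EuclideanSpace ℝ (Fin n) → ℝ}

theorem IsMetricAt.sum_inv_mul_self (h : IsMetricAt G y) :
    ∑ i, ∑ j, (G y)⁻¹ i j * G y i j = n := by
  have : ((G y)⁻¹ * G y).trace = n := by
    rw [Matrix.nonsing_inv_mul _ h.isUnit]; simp
  rw [← this]
  simp only [Matrix.trace, Matrix.diag, Matrix.mul_apply]
  exact Finset.sum_congr rfl fun i _ => Finset.sum_congr rfl fun j _ => by rw [h.apply_comm]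

/-- The Euler-Lagrange expression of `∫ R² dV`. -/
def gradS2 (G : EuclideanSpace ℝ (Fin n) → Matrix (Fin n) (Fin n) ℝ) (i j : Fin n)
    (y : EuclideanSpace ℝ (Fin n)) : ℝ :=
  2 * hessCoord G (scalarCoord G) i j y - 2 * lapCoord G (scalarCoord G) y * G y i j
    - 2 * scalarCoord G y * ricciCoord G i j y + scalarCoord G y ^ 2 / 2 * G y i j

/-- The metric trace of the Euler-Lagrange equation, using that g has trace n. -/
theorem lapCoord_of_gradS2 (h : IsMetricAt G y) (hE : ∀ i j, gradS2 G i j y = 0) :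
    4 * ((n : ℝ) - 1) * lapCoord G (scalarCoord G) y = (n - 4) * scalarCoord G y ^ 2 := by
  have : ∑ i, ∑ j, (G y)⁻¹ i j * gradS2 G i j y = 0 := by simp [hE]
  have e : ∑ i, ∑ j, (G y)⁻¹ i j * gradS2 G i j y = 2 * lapCoord G (scalarCoord G) y -
      2 * lapCoord G (scalarCoord G) y * (∑ i, ∑ j, (G y)⁻¹ i j * G y i j) -
      2 * scalarCoord G y * (∑ i, ∑ j, (G y)⁻¹ i j * ricciCoord G i j y) +
      scalarCoord G y ^ 2 / 2 * (∑ i, ∑ j, (G y)⁻¹ i j * G y i j) := by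
    conv_rhs => enter [1, 1, 1]; rw [lapCoord]
    simp only [Finset.mul_sum, ← Finset.sum_add_distrib, ← Finset.sum_sub_distrib]
    refine Finset.sum_congr rfl fun i _ => Finset.sum_congr rfl fun j _ => ?_
    rw [gradS2]; ring
  rw [e, h.sum_inv_mul_self, show ∑ i, ∑ j, (G y)⁻¹ i j * ricciCoord G i j y = scalarCoord G y
    from rfl] at this
  linarith

/-- `Real.log` is even, so the absolute value disappears and no sign of ρ is needed. -/
theorem pd_const_mul_log {ρ : EuclideanSpace ℝ (Fin n) → ℝ} (hρ : DifferentiableAt ℝ ρ y)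
    (h0 : ρ y ≠ 0) (c : ℝ) (i : Fin n) :
    pd i (fun z => c * Real.log |ρ z|) y = c * (pd i ρ y / ρ y) := by
  simp only [Real.log_abs]
  unfold pd
  rw [((hρ.hasFDerivAt.log h0).const_mul c).fderiv]
  simp only [_root_.smul_apply, smul_eq_mul]
  ring

theorem contDiffAt_const_mul_log (hρ : ContDiffAt ℝ ∞ ρ y) (h0 : ρ y ≠ 0) (c : ℝ) :
    ContDiffAt ℝ ∞ (fun z => c * Real.log |ρ z|) y := by
  simp only [Real.log_abs]
  exact contDiffAt_const.mul (hρ.log h0)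

theorem pd_pd_const_mul_log (hρ : ∀ᶠ z in 𝓝 y, ContDiffAt ℝ ∞ ρ z) (h0 : ρ y ≠ 0) (c : ℝ)
    (i j : Fin n) :
    pd i (pd j (fun z => c * Real.log |ρ z|)) y =
      c * (pd i (pd j ρ) y / ρ y - pd i ρ y * pd j ρ y / ρ y ^ 2) := by
  have hρ0 := hρ.self_of_nhds
  have hd := hρ0.differentiableAt_of_smooth
  have hdj := (contDiffAt_pd hρ0 j).differentiableAt_of_smooth
  have e : pd j (fun z => c * Real.log |ρ z|) =ᶠ[𝓝 y] fun z => c * (pd j ρ z * (ρ z)⁻¹) := by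
    filter_upwards [hρ, hρ0.continuousAt.eventually_ne h0] with z h1 h2
    rw [pd_const_mul_log h1.differentiableAt_of_smooth h2, div_eq_mul_inv]
  rw [pd_congr e]
  have h1 : HasFDerivAt (fun z => c * (pd j ρ z * (ρ z)⁻¹)) _ y :=
    (hdj.hasFDerivAt.mul ((hasDerivAt_inv h0).comp_hasFDerivAt y hd.hasFDerivAt)).const_mul c
  rw [pd, h1.fderiv]
  simp only [_root_.smul_apply, _root_.add_apply, smul_eq_mul, Function.comp_apply]
  unfold pd
  field_simp
  ring

theorem gradCoord_const_mul_log (hρ : DifferentiableAt ℝ ρ y)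
    (h0 : ρ y ≠ 0) (c : ℝ) (k : Fin n) :
    gradCoord G (fun z => c * Real.log |ρ z|) k y = c / ρ y * gradCoord G ρ k y := by
  simp only [gradCoord, pd_const_mul_log hρ h0, Finset.mul_sum]
  exact Finset.sum_congr rfl fun l _ => by ring

theorem hessCoord_const_mul_log (hρ : ∀ᶠ z in 𝓝 y, ContDiffAt ℝ ∞ ρ z) (h0 : ρ y ≠ 0) (c : ℝ)
    (i j : Fin n) :
    hessCoord G (fun z => c * Real.log |ρ z|) i j y =
      c * (hessCoord G ρ i j y / ρ y - pd i ρ y * pd j ρ y / ρ y ^ 2) := by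
  have hd := hρ.self_of_nhds.differentiableAt_of_smooth
  simp only [hessCoord, pd_pd_const_mul_log hρ h0, pd_const_mul_log hd h0]
  have : ∑ k, christoffel G k i j y * (c * (pd k ρ y / ρ y)) =
      c / ρ y * ∑ k, christoffel G k i j y * pd k ρ y := by
    rw [Finset.mul_sum]
    exact Finset.sum_congr rfl fun k _ => by ring
  rw [this]; ring

theorem lapCoord_const_mul_log (hρ : ∀ᶠ z in 𝓝 y, ContDiffAt ℝ ∞ ρ z) (h0 : ρ y ≠ 0) (c : ℝ) :
    lapCoord G (fun z => c * Real.log |ρ z|) y =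
      c * (lapCoord G ρ y / ρ y - (∑ k, pd k ρ y * gradCoord G ρ k y) / ρ y ^ 2) := by
  simp only [lapCoord, gradCoord, hessCoord_const_mul_log hρ h0, Finset.mul_sum, Finset.sum_div,
    ← Finset.sum_sub_distrib]
  exact Finset.sum_congr rfl fun i _ => Finset.sum_congr rfl fun j _ => by ring

/-- With φ = b log|R| and f = a log|R|, the ∇²R terms cancel when 1 - (n-2)b + a = 0, which is also
what removes |dR|²g. The remaining multiple of g, R/4 - (1+b)ΔR/R, vanishes by the trace equation
when b = 3/(n-4). This forces a = 2(n-1)/(n-4), and the coefficient of dR⊗dR then determines μ. -/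
theorem quasiEinstein_coord (hn : 5 ≤ n) (h : ∀ᶠ z in 𝓝 y, IsMetricAt G z)
    (hneg : scalarCoord G y ≠ 0) (hE : ∀ i j, gradS2 G i j y = 0) (i j : Fin n) :
    ricciCoord (fun z => Real.exp (2 * (3 / ((n : ℝ) - 4) * Real.log |scalarCoord G z|)) • G z)
        i j y +
      hessCoord (fun z => Real.exp (2 * (3 / ((n : ℝ) - 4) * Real.log |scalarCoord G z|)) • G z)
        (fun z => 2 * ((n : ℝ) - 1) / ((n : ℝ) - 4) * Real.log |scalarCoord G z|) i j y -
      ((n : ℝ) - 10) / (4 * ((n : ℝ) - 1)) *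
        (pd i (fun z => 2 * ((n : ℝ) - 1) / ((n : ℝ) - 4) * Real.log |scalarCoord G z|) y *
          pd j (fun z => 2 * ((n : ℝ) - 1) / ((n : ℝ) - 4) * Real.log |scalarCoord G z|) y) = 0 := by
  have h0 := h.self_of_nhds
  have hρ : ∀ᶠ z in 𝓝 y, ContDiffAt ℝ ∞ (scalarCoord G) z :=
    h.mono fun z hz => contDiffAt_scalarCoord hz.smooth hz.det_ne
  have hd := hρ.self_of_nhds.differentiableAt_of_smooth
  have hφ : ∀ᶠ z in 𝓝 y,
      ContDiffAt ℝ ∞ (fun z => 3 / ((n : ℝ) - 4) * Real.log |scalarCoord G z|) z := by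
    filter_upwards [hρ, hρ.self_of_nhds.continuousAt.eventually_ne hneg] with z h1 h2
    exact contDiffAt_const_mul_log h1 h2 _
  have hL := lapCoord_of_gradS2 h0 hE
  have hEij := hE i j
  rw [conf_ricciCoord h hφ, conf_hessCoord h0 hφ.self_of_nhds, lapCoord_const_mul_log hρ hneg,
    hessCoord_const_mul_log hρ hneg, hessCoord_const_mul_log hρ hneg]
  simp only [pd_const_mul_log hd hneg, gradCoord_const_mul_log hd hneg]
  have eN : ∀ c d : ℝ, ∑ k, c * (pd k (scalarCoord G) y / scalarCoord G y) *
      (d / scalarCoord G y * gradCoord G (scalarCoord G) k y) = c * d / scalarCoord G y ^ 2 *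
      ∑ k, pd k (scalarCoord G) y * gradCoord G (scalarCoord G) k y := by
    intro c d
    rw [Finset.mul_sum]
    exact Finset.sum_congr rfl fun k _ => by field_simp
  simp only [eN]
  unfold gradS2 at hEij
  have hn' : (5 : ℝ) ≤ n := by exact_mod_cast hn
  have h4 : (n : ℝ) - 4 ≠ 0 := by linarith
  have h1 : (n : ℝ) - 1 ≠ 0 := by linarith
  generalize ∑ k, pd k (scalarCoord G) y * gradCoord G (scalarCoord G) k y = N at *
  generalize lapCoord G (scalarCoord G) y = L at *
  generalize hessCoord G (scalarCoord G) i j y = H at *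
  generalize ricciCoord G i j y = Rc at *
  generalize pd i (scalarCoord G) y = a at *
  generalize pd j (scalarCoord G) y = b at *
  generalize scalarCoord G y = r at *
  generalize G y i j = g at *
  -- Eliminating Ric and ΔR leaves an identity of rational functions in n, R and the components of
  -- dR, ∇²R and g.
  have eRc : Rc = (H - L * g + r ^ 2 / 4 * g) / r := by
    field_simp; linarith
  have eL : L = (n - 4) * r ^ 2 / (4 * (n - 1)) := by
    field_simp; linarith
  rw [eRc, eL]
  generalize (n : ℝ) = m at *
  field_simp
  ring

end QuasiEinstein


/-! ### Variations G + tH and their derivatives at t = 0. -/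

section Variation

variable {n : ℕ}

/-- The derivative at `t = 0` of a family of functions. -/
def dot (F : ℝ → EuclideanSpace ℝ (Fin n) → ℝ) (y : EuclideanSpace ℝ (Fin n)) : ℝ :=
  deriv (fun t => F t y) 0

/-- Joint smoothness of a family of functions at `(0, y)`. -/
def JointSmoothAt (F : ℝ → EuclideanSpace ℝ (Fin n) → ℝ) (y : EuclideanSpace ℝ (Fin n)) : Prop :=
  ContDiffAt ℝ ∞ (fun q : ℝ × EuclideanSpace ℝ (Fin n) => F q.1 q.2) (0, y)

variable {F F' : ℝ → EuclideanSpace ℝ (Fin n) → ℝ} {y : EuclideanSpace ℝ (Fin n)}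

theorem JointSmoothAt.hasDerivAt (hF : JointSmoothAt F y) :
    HasDerivAt (fun t => F t y) (dot F y) 0 :=
  (ContDiffAt.slice_left (F := F) hF).differentiableAt_of_smooth.hasDerivAt

theorem JointSmoothAt.contDiffAt_dot (hF : JointSmoothAt F y) : ContDiffAt ℝ ∞ (dot F) y := by
  have h : ContDiffAt ℝ ∞ (fun z => fderiv ℝ (fun t => F t z) 0) y := by
    refine ContDiffAt.fderiv (n := ∞) (f := fun z t => F t z) (g := fun _ => (0 : ℝ)) ?_
      contDiffAt_const (by simp)
    exact ContDiffAt.comp ((y, (0 : ℝ)) : EuclideanSpace ℝ (Fin n) × ℝ)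
      (g := fun q : ℝ × EuclideanSpace ℝ (Fin n) => F q.1 q.2)
      (f := fun r : EuclideanSpace ℝ (Fin n) × ℝ => (r.2, r.1)) hF (by fun_prop)
  exact h.clm_apply contDiffAt_const

/-- Derivatives in the parameter and in the space variables commute. -/
theorem JointSmoothAt.hasDerivAt_pd (hF : JointSmoothAt F y) (k : Fin n) :
    HasDerivAt (fun t => CriticalMetric.pd k (F t) y) (CriticalMetric.pd k (dot F) y) 0 := by
  set f : ℝ × EuclideanSpace ℝ (Fin n) → ℝ := fun q => F q.1 q.2 with hf
  have hsm : ContDiffAt ℝ ∞ f (0, y) := hF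
  have hev : ∀ᶠ q in 𝓝 ((0 : ℝ), y), DifferentiableAt ℝ f q :=
    ((hsm.of_le (m := 1) (by exact_mod_cast le_top)).eventually (by simp)).mono
      fun q hq => hq.differentiableAt (by simp)
  have hd : DifferentiableAt ℝ (fderiv ℝ f) (0, y) :=
    (hsm.fderiv_right (m := ∞) (by simp)).differentiableAt_of_smooth
  -- Both iterated derivatives become entries of the second derivative of the joint function on ℝ ×
  -- ℝⁿ, whose symmetry is the claim.
  have h1 : ∀ᶠ t in 𝓝 (0 : ℝ), CriticalMetric.pd k (F t) y = fderiv ℝ f (t, y) (0, stdVec k) := by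
    have : ∀ᶠ t in 𝓝 (0 : ℝ), DifferentiableAt ℝ f (t, y) :=
      (Continuous.continuousAt (f := fun t : ℝ => (t, y)) (by fun_prop)).eventually hev
    filter_upwards [this] with t ht
    have hc : HasFDerivAt (fun z : EuclideanSpace ℝ (Fin n) => (t, z))
        (ContinuousLinearMap.inr ℝ ℝ (EuclideanSpace ℝ (Fin n))) y := hasFDerivAt_prodMk_right t y
    have := (ht.hasFDerivAt.comp y hc).fderiv
    exact congrArg (fun L => L (stdVec k)) this
  have h2 : dot F =ᶠ[𝓝 y] fun z => fderiv ℝ f (0, z) (1, 0) := by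
    have : ∀ᶠ z in 𝓝 y, DifferentiableAt ℝ f (0, z) :=
      (Continuous.continuousAt (f := fun z : EuclideanSpace ℝ (Fin n) => ((0 : ℝ), z))
        (by fun_prop)).eventually hev
    filter_upwards [this] with z hz
    have hc : HasFDerivAt (fun t : ℝ => (t, z))
        (ContinuousLinearMap.inl ℝ ℝ (EuclideanSpace ℝ (Fin n))) 0 := hasFDerivAt_prodMk_left 0 z
    have := (hz.hasFDerivAt.comp (0 : ℝ) hc).fderiv
    exact congrArg (fun L => L (1 : ℝ)) this
  have e1 : HasDerivAt (fun t : ℝ => fderiv ℝ f (t, y) (0, stdVec k))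
      (fderiv ℝ (fderiv ℝ f) (0, y) (1, 0) (0, stdVec k)) 0 := by
    have hc : HasFDerivAt (fun t : ℝ => (t, y))
        (ContinuousLinearMap.inl ℝ ℝ (EuclideanSpace ℝ (Fin n))) 0 := hasFDerivAt_prodMk_left 0 y
    have h3 := ((hd.hasFDerivAt.comp (0 : ℝ) hc).clm_apply
      (hasFDerivAt_const ((0 : ℝ), stdVec k) (0 : ℝ))).hasDerivAt
    simpa using h3
  have e2 : CriticalMetric.pd k (fun z => fderiv ℝ f (0, z) (1, 0)) y =
      fderiv ℝ (fderiv ℝ f) (0, y) (0, stdVec k) (1, 0) := by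
    have hc : HasFDerivAt (fun z : EuclideanSpace ℝ (Fin n) => ((0 : ℝ), z))
        (ContinuousLinearMap.inr ℝ ℝ (EuclideanSpace ℝ (Fin n))) y := hasFDerivAt_prodMk_right 0 y
    have h3 := ((hd.hasFDerivAt.comp y hc).clm_apply
      (hasFDerivAt_const ((1 : ℝ), (0 : EuclideanSpace ℝ (Fin n))) y)).fderiv
    have h4 := congrArg (fun L => L (stdVec k)) h3
    refine h4.trans ?_
    simp
  rw [pd_congr h2, e2, (hsm.isSymmSndFDerivAt (by simpa using ENat.LEInfty.out)).eq]
  exact e1.congr_of_eventuallyEq h1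

/-- The affine family `G + t H`. -/
def varG (G H : EuclideanSpace ℝ (Fin n) → Matrix (Fin n) (Fin n) ℝ) (t : ℝ)
    (z : EuclideanSpace ℝ (Fin n)) : Matrix (Fin n) (Fin n) ℝ := G z + t • H z

/-- The density `√(det g) gⁱʲ`. -/
def dens (G : EuclideanSpace ℝ (Fin n) → Matrix (Fin n) (Fin n) ℝ) (i j : Fin n)
    (z : EuclideanSpace ℝ (Fin n)) : ℝ := Real.sqrt (G z).det * (G z)⁻¹ i j

/-- Near a point, `G` is a metric and `H` is a smooth symmetric matrix-valued function. -/
structure IsVariationAt (G H : EuclideanSpace ℝ (Fin n) → Matrix (Fin n) (Fin n) ℝ)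
    (y : EuclideanSpace ℝ (Fin n)) : Prop extends IsMetricAt G y where
  pos : 0 < (G y).det
  smoothH : MatSmoothAt H y
  symmH : ∀ᶠ z in 𝓝 y, (H z).transpose = H z

variable {G H : EuclideanSpace ℝ (Fin n) → Matrix (Fin n) (Fin n) ℝ}

theorem varG_zero : varG G H 0 = G := by
  funext z; simp [varG]

theorem IsVariationAt.joint (h : IsVariationAt G H y) (t : ℝ) :
    MatSmoothAt (fun q : ℝ × EuclideanSpace ℝ (Fin n) => varG G H q.1 q.2) (t, y) := fun i j =>
  (ContDiffAt.comp (t, y) (f := fun q : ℝ × EuclideanSpace ℝ (Fin n) => q.2)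
    (h.smooth i j) contDiffAt_snd).add
  (contDiffAt_fst.mul (ContDiffAt.comp (t, y)
    (f := fun q : ℝ × EuclideanSpace ℝ (Fin n) => q.2) (h.smoothH i j) contDiffAt_snd))

theorem IsVariationAt.det_varG_zero (h : IsVariationAt G H y) : 0 < (varG G H 0 y).det := by
  rw [varG_zero]; exact h.pos

theorem IsVariationAt.eventually_pos (h : IsVariationAt G H y) :
    ∀ᶠ t in 𝓝 (0 : ℝ), 0 < (varG G H t y).det := by
  have h1 : ContinuousAt (fun q : ℝ × EuclideanSpace ℝ (Fin n) => (varG G H q.1 q.2).det) (0, y) :=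
    (h.joint 0).det.continuousAt
  have h2 : ContinuousAt (fun t : ℝ => (varG G H t y).det) 0 :=
    ContinuousAt.comp (f := fun t : ℝ => (t, y)) h1 (by fun_prop)
  exact h2.eventually_const_lt h.det_varG_zero

theorem IsVariationAt.isMetricAt (h : IsVariationAt G H y) {t : ℝ} (ht : 0 < (varG G H t y).det) :
    IsMetricAt (varG G H t) y where
  smooth := fun i j => (h.smooth i j).add (contDiffAt_const.mul (h.smoothH i j))
  symm := by
    filter_upwards [h.symm, h.symmH] with z h1 h2
    rw [varG, Matrix.transpose_add, Matrix.transpose_smul, h1, h2]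
  det_ne := ht.ne'

theorem IsVariationAt.joint_christoffel (h : IsVariationAt G H y) (k i j : Fin n) :
    JointSmoothAt (fun t => christoffel (varG G H t) k i j) y :=
  contDiffAt_christoffel_param (h.joint 0) h.det_varG_zero.ne' k i j

theorem IsVariationAt.joint_scalarCoord (h : IsVariationAt G H y) :
    JointSmoothAt (fun t => scalarCoord (varG G H t)) y :=
  contDiffAt_scalarCoord_param (h.joint 0) h.det_varG_zero.ne'

theorem IsVariationAt.joint_sqrt (h : IsVariationAt G H y) :
    JointSmoothAt (fun t z => Real.sqrt (varG G H t z).det) y :=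
  (h.joint 0).sqrt_det h.det_varG_zero

theorem IsVariationAt.joint_dens (h : IsVariationAt G H y) (i j : Fin n) :
    JointSmoothAt (fun t => dens (varG G H t) i j) y :=
  ContDiffAt.mul ((h.joint 0).sqrt_det h.det_varG_zero)
    (((h.joint 0).inv h.det_varG_zero.ne') i j)

/-- The variation of the Christoffel symbols. -/
def dotGamma (G H : EuclideanSpace ℝ (Fin n) → Matrix (Fin n) (Fin n) ℝ) (k i j : Fin n) :
    EuclideanSpace ℝ (Fin n) → ℝ := dot fun t => christoffel (varG G H t) k i j

/-- The variation of the densities `√(det g) gⁱʲ`. -/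
def dotDens (G H : EuclideanSpace ℝ (Fin n) → Matrix (Fin n) (Fin n) ℝ) (i j : Fin n) :
    EuclideanSpace ℝ (Fin n) → ℝ := dot fun t => dens (varG G H t) i j

/-- The trace of `H` with respect to `G`. -/
def trH (G H : EuclideanSpace ℝ (Fin n) → Matrix (Fin n) (Fin n) ℝ)
    (z : EuclideanSpace ℝ (Fin n)) : ℝ := ((G z)⁻¹ * H z).trace

/-- The variation of the Ricci tensor in terms of that of the Christoffel symbols. -/
def dotRicci (G H : EuclideanSpace ℝ (Fin n) → Matrix (Fin n) (Fin n) ℝ) (i j : Fin n)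
    (y : EuclideanSpace ℝ (Fin n)) : ℝ :=
  (∑ k, (pd k (dotGamma G H k i j) y - pd j (dotGamma G H k i k) y)) +
    ∑ k, ∑ l, ((dotGamma G H k k l y * christoffel G l i j y +
        christoffel G k k l y * dotGamma G H l i j y) -
      (dotGamma G H k j l y * christoffel G l i k y +
        christoffel G k j l y * dotGamma G H l i k y))

theorem IsVariationAt.hasDerivAt_christoffel (h : IsVariationAt G H y) (k i j : Fin n) :
    HasDerivAt (fun t => christoffel (varG G H t) k i j y) (dotGamma G H k i j y) 0 :=
  (h.joint_christoffel k i j).hasDerivAt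

theorem IsVariationAt.hasDerivAt_dens (h : IsVariationAt G H y) (i j : Fin n) :
    HasDerivAt (fun t => dens (varG G H t) i j y) (dotDens G H i j y) 0 :=
  (h.joint_dens i j).hasDerivAt

theorem IsVariationAt.hasDerivAt_ricciCoord (h : IsVariationAt G H y) (i j : Fin n) :
    HasDerivAt (fun t => ricciCoord (varG G H t) i j y) (dotRicci G H i j y) 0 := by
  unfold ricciCoord dotRicci
  have hc := h.hasDerivAt_christoffel
  have hp := fun m k i j => (h.joint_christoffel k i j).hasDerivAt_pd m
  refine (HasDerivAt.fun_sum fun k _ => (hp k k i j).sub (hp j k i k)).add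
    (HasDerivAt.fun_sum fun k _ => HasDerivAt.fun_sum fun l _ => ?_)
  have := ((hc k k l).fun_mul (hc l i j)).fun_sub ((hc k j l).fun_mul (hc l i k))
  simpa only [varG_zero] using this

/-- At a fixed point the variation is a line of matrices, so the matrix calculus applies with the
parameter line ℝ as domain. -/
theorem dMat_line (A B : Matrix (Fin n) (Fin n) ℝ) (t : ℝ) :
    dMat (fun s : ℝ => A + s • B) t 1 = B := by
  ext i j
  have h : HasDerivAt (fun s : ℝ => A i j + s * B i j) (B i j) t := by
    simpa using ((hasDerivAt_id t).mul_const (B i j)).const_add (A i j)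
  exact h.deriv

theorem matSmoothAt_line (A B : Matrix (Fin n) (Fin n) ℝ) (t : ℝ) :
    MatSmoothAt (fun s : ℝ => A + s • B) t := fun _ _ =>
  contDiffAt_const.add (contDiffAt_id.mul contDiffAt_const)

theorem dot_sqrt (hpos : 0 < (G y).det) :
    dot (fun t z => Real.sqrt (varG G H t z).det) y = Real.sqrt (G y).det * (trH G H y / 2) := by
  have h := fderiv_sqrt_det_apply (matSmoothAt_line (G y) (H y) 0) (by simpa using hpos) 1
  rw [dMat_line, zero_smul, add_zero] at h
  exact h

theorem hasDerivAt_sqrt (hpos : 0 < (G y).det) :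
    HasDerivAt (fun t => Real.sqrt (varG G H t y).det)
      (Real.sqrt (G y).det * (trH G H y / 2)) 0 := by
  rw [← dot_sqrt hpos]
  exact ((matSmoothAt_line (G y) (H y) 0).sqrt_det
    (by simpa using hpos)).differentiableAt_of_smooth.hasDerivAt

theorem hasDerivAt_inv_varG (hpos : 0 < (G y).det) (i j : Fin n) :
    HasDerivAt (fun t => (varG G H t y)⁻¹ i j) (-((G y)⁻¹ * H y * (G y)⁻¹) i j) 0 := by
  have hne : (G y + (0 : ℝ) • H y).det ≠ 0 := by simpa using hpos.ne'
  have hs := matSmoothAt_line (G y) (H y) 0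
  have h := congrFun (congrFun (dMat_inv hs hne 1) i) j
  rw [dMat_line] at h
  simp only [zero_smul, add_zero] at h
  rw [← Matrix.neg_apply, ← h]
  exact ((hs.inv hne) i j).differentiableAt_of_smooth.hasDerivAt

theorem dotDens_eq (hpos : 0 < (G y).det) (i j : Fin n) :
    dotDens G H i j y = trH G H y / 2 * dens G i j y -
      Real.sqrt (G y).det * ((G y)⁻¹ * H y * (G y)⁻¹) i j := by
  have := ((hasDerivAt_sqrt (H := H) hpos).mul (hasDerivAt_inv_varG (H := H) hpos i j)).deriv
  simp only [varG_zero] at this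
  refine Eq.trans this ?_
  rw [dens]; ring

/-- This says that √(det g)gⁱʲ is parallel as a tensor density; the trace term comes from the
density weight. -/
theorem pd_dens (h : IsMetricAt G y) (hpos : 0 < (G y).det) (k i j : Fin n) :
    pd k (dens G i j) y = (∑ l, christoffel G l k l y) * dens G i j y -
      (∑ l, christoffel G i k l y * dens G l j y) - ∑ l, christoffel G j k l y * dens G i l y := by
  have e : pd k (dens G i j) y = pd k (fun z => Real.sqrt (G z).det) y * (G y)⁻¹ i j +
      Real.sqrt (G y).det * pd k (fun z => (G z)⁻¹ i j) y :=
    fderiv_mul_apply (h.smooth.sqrt_det hpos).differentiableAt_of_smooth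
      ((h.smooth.inv h.det_ne).diff i j) _
  rw [e, h.pd_sqrt_det hpos, h.pd_inv]
  simp only [dens, mul_neg, mul_add, Finset.mul_sum, Finset.sum_mul]
  have e1 : ∑ l, Real.sqrt (G y).det * (christoffel G i k l y * (G y)⁻¹ l j) =
      ∑ l, christoffel G i k l y * (Real.sqrt (G y).det * (G y)⁻¹ l j) :=
    Finset.sum_congr rfl fun _ _ => by ring
  have e2 : ∑ l, Real.sqrt (G y).det * ((G y)⁻¹ i l * christoffel G j k l y) =
      ∑ l, christoffel G j k l y * (Real.sqrt (G y).det * (G y)⁻¹ i l) :=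
    Finset.sum_congr rfl fun _ _ => by ring
  have e3 : ∑ l, Real.sqrt (G y).det * christoffel G l k l y * (G y)⁻¹ i j =
      ∑ l, christoffel G l k l y * (Real.sqrt (G y).det * (G y)⁻¹ i j) :=
    Finset.sum_congr rfl fun _ _ => by ring
  rw [e1, e2, e3]; ring

theorem dens_comm (h : IsMetricAt G y) (i j : Fin n) : dens G i j y = dens G j i y := by
  rw [dens, dens, h.inv_apply_comm]

theorem div_dens (h : IsMetricAt G y) (hpos : 0 < (G y).det) (k : Fin n) :
    ∑ j, pd j (dens G j k) y = -∑ i, ∑ j, dens G i j y * christoffel G k i j y := by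
  simp only [pd_dens h hpos, Finset.sum_sub_distrib, Finset.sum_mul]
  have e1 : ∑ j, ∑ l, christoffel G j j l y * dens G l k y =
      ∑ j, ∑ l, christoffel G l j l y * dens G j k y := by
    rw [Finset.sum_comm]
    exact Finset.sum_congr rfl fun j _ => Finset.sum_congr rfl fun l _ => by
      rw [h.christoffel_comm l l j]
  have e2 : ∑ j, ∑ l, christoffel G k j l y * dens G j l y =
      ∑ i, ∑ j, dens G i j y * christoffel G k i j y :=
    Finset.sum_congr rfl fun j _ => Finset.sum_congr rfl fun l _ => mul_comm _ _
  rw [e1, e2]; ring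

/-- The t-derivative of `div_dens` for the metrics G + tH. It relates δ(√(det g)gⁱʲ) to δΓ without a
formula for δΓ. -/
theorem IsVariationAt.div_dotDens (h : IsVariationAt G H y) (k : Fin n) :
    ∑ j, pd j (dotDens G H j k) y = -∑ i, ∑ j, (dotDens G H i j y * christoffel G k i j y +
      dens G i j y * dotGamma G H k i j y) := by
  have h1 : HasDerivAt (fun t => ∑ j, pd j (dens (varG G H t) j k) y)
      (∑ j, pd j (dotDens G H j k) y) 0 :=
    HasDerivAt.fun_sum fun j _ => (h.joint_dens j k).hasDerivAt_pd j
  have h2 : HasDerivAt (fun t => -∑ i, ∑ j, dens (varG G H t) i j y *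
      christoffel (varG G H t) k i j y) (-∑ i, ∑ j, (dotDens G H i j y * christoffel G k i j y +
      dens G i j y * dotGamma G H k i j y)) 0 := by
    refine (HasDerivAt.fun_sum fun i _ => HasDerivAt.fun_sum fun j _ => ?_).fun_neg
    have := (h.hasDerivAt_dens i j).fun_mul (h.hasDerivAt_christoffel k i j)
    simpa only [varG_zero] using this
  refine h1.unique (h2.congr_of_eventuallyEq ?_)
  filter_upwards [h.eventually_pos] with t ht
  exact div_dens (h.isMetricAt ht) ht k

theorem IsVariationAt.contDiffAt_trH (h : IsVariationAt G H y) : ContDiffAt ℝ ∞ (trH G H) y := by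
  unfold trH Matrix.trace Matrix.diag
  exact ContDiffAt.sum fun i _ => ((h.smooth.inv h.det_ne).mul h.smoothH) i i

/-- Differentiate ∂ᵢ√(det g) = √(det g)Γᵏᵢₖ in t, and compare with ∂ᵢ applied to δ√(det g) = √(det
g) tr(h)/2. -/
theorem IsVariationAt.sum_dotGamma (h : IsVariationAt G H y) (i : Fin n) :
    ∑ j, dotGamma G H j i j y = pd i (trH G H) y / 2 := by
  have h1 : HasDerivAt (fun t => pd i (fun z => Real.sqrt (varG G H t z).det) y)
      (pd i (dot (fun t z => Real.sqrt (varG G H t z).det)) y) 0 := h.joint_sqrt.hasDerivAt_pd i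
  have h2 : HasDerivAt (fun t => Real.sqrt (varG G H t y).det *
      ∑ k, christoffel (varG G H t) k i k y)
      (Real.sqrt (G y).det * (trH G H y / 2) * (∑ k, christoffel G k i k y) +
        Real.sqrt (G y).det * ∑ k, dotGamma G H k i k y) 0 := by
    have := (hasDerivAt_sqrt (H := H) h.pos).fun_mul
      (HasDerivAt.fun_sum (u := Finset.univ) fun k _ => h.hasDerivAt_christoffel k i k)
    simpa only [varG_zero] using this
  have h3 := h1.unique (h2.congr_of_eventuallyEq (by
    filter_upwards [h.eventually_pos] with t ht
    exact (h.isMetricAt ht).pd_sqrt_det ht i))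
  have h4 : pd i (dot (fun t z => Real.sqrt (varG G H t z).det)) y =
      pd i (fun z => Real.sqrt (G z).det) y * (trH G H y / 2) +
        Real.sqrt (G y).det * (pd i (trH G H) y / 2) := by
    have e : dot (fun t z => Real.sqrt (varG G H t z).det) =ᶠ[𝓝 y]
        fun z => Real.sqrt (G z).det * (trH G H z * (1 / 2)) := by
      filter_upwards [h.smooth.det.continuousAt.eventually_const_lt h.pos] with z hz
      rw [dot_sqrt hz]; ring
    have hd := h.contDiffAt_trH.differentiableAt_of_smooth
    rw [pd_congr e]
    have e2 : pd i (fun z => Real.sqrt (G z).det * (trH G H z * (1 / 2))) y = _ :=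
      fderiv_mul_apply (h.smooth.sqrt_det h.pos).differentiableAt_of_smooth (hd.mul_const _) _
    rw [e2, fderiv_mul_const hd]
    simp only [_root_.smul_apply, smul_eq_mul, pd]
    ring
  rw [h4, h.pd_sqrt_det h.pos] at h3
  have hw : Real.sqrt (G y).det ≠ 0 := (Real.sqrt_pos.2 h.pos).ne'
  apply mul_left_cancel₀ hw
  linarith

/-- The vector density whose divergence is `√(det g) gⁱʲ δRicᵢⱼ`. -/
def palatini (G H : EuclideanSpace ℝ (Fin n) → Matrix (Fin n) (Fin n) ℝ) (k : Fin n)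
    (z : EuclideanSpace ℝ (Fin n)) : ℝ :=
  (∑ i, ∑ j, dens G i j z * dotGamma G H k i j z) -
    ∑ i, ∑ j, dens G i k z * dotGamma G H j i j z

end Variation


/-! ### The Palatini identity: PⁱʲδRicᵢⱼ is a divergence. -/

section Palatini

variable {n : ℕ} {G H : EuclideanSpace ℝ (Fin n) → Matrix (Fin n) (Fin n) ℝ}
  {y : EuclideanSpace ℝ (Fin n)}

theorem sum_swap₂₃ (f : Fin n → Fin n → Fin n → ℝ) :
    ∑ a, ∑ b, ∑ c, f a b c = ∑ a, ∑ c, ∑ b, f a b c :=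
  Finset.sum_congr rfl fun _ _ => Finset.sum_comm

theorem sum_swap₃₄ (f : Fin n → Fin n → Fin n → Fin n → ℝ) :
    ∑ a, ∑ b, ∑ c, ∑ d, f a b c d = ∑ a, ∑ b, ∑ d, ∑ c, f a b c d :=
  Finset.sum_congr rfl fun a _ => sum_swap₂₃ (f a)

theorem sum_rotate₄ (f : Fin n → Fin n → Fin n → Fin n → ℝ) :
    ∑ a, ∑ b, ∑ c, ∑ d, f a b c d = ∑ b, ∑ c, ∑ d, ∑ a, f a b c d :=
  Finset.sum_comm.trans ((sum_swap₂₃ _).trans (sum_swap₃₄ _))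

theorem sum_dcab (f : Fin n → Fin n → Fin n → Fin n → ℝ) :
    ∑ a, ∑ b, ∑ c, ∑ d, f a b c d = ∑ d, ∑ c, ∑ a, ∑ b, f a b c d := by
  rw [sum_swap₃₄, sum_swap₂₃, Finset.sum_comm]
  refine Finset.sum_congr rfl fun d _ => ?_
  exact (sum_swap₂₃ _).trans Finset.sum_comm

theorem sum_bdca (f : Fin n → Fin n → Fin n → Fin n → ℝ) :
    ∑ a, ∑ b, ∑ c, ∑ d, f a b c d = ∑ b, ∑ d, ∑ c, ∑ a, f a b c d := by
  rw [sum_rotate₄]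
  exact Finset.sum_congr rfl fun d _ => Finset.sum_comm

/-- The index bookkeeping in the Palatini identity. -/
theorem palatini_sums (P : Fin n → Fin n → ℝ) (Γ C : Fin n → Fin n → Fin n → ℝ)
    (hΓ : ∀ k i j, Γ k i j = Γ k j i) (hC : ∀ k i j, C k i j = C k j i) :
    ∑ k, ∑ i, ∑ j, ((∑ l, Γ l k l) * P i j - (∑ l, Γ i k l * P l j) - ∑ l, Γ j k l * P i l) *
      C k i j =
      (∑ i, ∑ j, ∑ k, ∑ l, P i j * (Γ k k l * C l i j)) -
      (∑ i, ∑ j, ∑ k, ∑ l, P i j * (C k j l * Γ l i k)) -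
      ∑ i, ∑ j, ∑ k, ∑ l, P i j * (Γ k j l * C l i k) := by
  simp only [sub_mul, Finset.sum_sub_distrib, Finset.sum_mul]
  rw [sum_rotate₄ (fun k i j l => Γ l k l * P i j * C k i j),
    sum_dcab (fun k i j l => Γ i k l * P l j * C k i j),
    sum_bdca (fun k i j l => Γ j k l * P i l * C k i j)]
  congr 1
  · congr 1
    · refine Finset.sum_congr rfl fun i _ => Finset.sum_congr rfl fun j _ =>
        Finset.sum_congr rfl fun l _ => Finset.sum_congr rfl fun k _ => ?_
      rw [hΓ l k l]; ring
    · refine Finset.sum_congr rfl fun l _ => Finset.sum_congr rfl fun j _ =>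
        Finset.sum_congr rfl fun k _ => Finset.sum_congr rfl fun i _ => ?_
      rw [hΓ i k l, hC k i j]; ring
  · refine Finset.sum_congr rfl fun i _ => Finset.sum_congr rfl fun l _ =>
      Finset.sum_congr rfl fun j _ => Finset.sum_congr rfl fun k _ => ?_
    rw [hΓ j k l]; ring

theorem palatini_sums_trace (P : Fin n → Fin n → ℝ) (Γ C : Fin n → Fin n → Fin n → ℝ)
    (hC : ∀ k i j, C k i j = C k j i) :
    ∑ i, (-∑ a, ∑ b, P a b * Γ i a b) * ∑ j, C j i j =
      -∑ i, ∑ j, ∑ k, ∑ l, P i j * (C k k l * Γ l i j) := by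
  simp only [neg_mul, Finset.sum_neg_distrib, Finset.sum_mul, Finset.mul_sum]
  rw [sum_rotate₄ (fun i k a b => P a b * Γ i a b * C k i k)]
  congr 1
  refine (Finset.sum_comm.trans (sum_swap₂₃ _)).trans ?_
  refine Finset.sum_congr rfl fun a _ => Finset.sum_congr rfl fun b _ =>
    Finset.sum_congr rfl fun k _ => Finset.sum_congr rfl fun i _ => ?_
  rw [hC k i k]; ring

theorem IsVariationAt.contDiffAt_dotGamma (h : IsVariationAt G H y) (k i j : Fin n) :
    ContDiffAt ℝ ∞ (dotGamma G H k i j) y := (h.joint_christoffel k i j).contDiffAt_dot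

theorem IsVariationAt.contDiffAt_dotDens (h : IsVariationAt G H y) (i j : Fin n) :
    ContDiffAt ℝ ∞ (dotDens G H i j) y := (h.joint_dens i j).contDiffAt_dot

theorem IsVariationAt.contDiffAt_dens (h : IsVariationAt G H y) (i j : Fin n) :
    ContDiffAt ℝ ∞ (dens G i j) y :=
  (h.smooth.sqrt_det h.pos).mul ((h.smooth.inv h.det_ne) i j)

theorem IsVariationAt.contDiffAt_palatini (h : IsVariationAt G H y) (k : Fin n) :
    ContDiffAt ℝ ∞ (palatini G H k) y :=
  (ContDiffAt.sum fun i _ => ContDiffAt.sum fun j _ =>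
    (h.contDiffAt_dens i j).mul (h.contDiffAt_dotGamma k i j)).sub
  (ContDiffAt.sum fun i _ => ContDiffAt.sum fun j _ =>
    (h.contDiffAt_dens i k).mul (h.contDiffAt_dotGamma j i j))

theorem IsVariationAt.dotGamma_comm (h : IsVariationAt G H y) (k i j : Fin n) :
    dotGamma G H k i j y = dotGamma G H k j i y := by
  refine (h.hasDerivAt_christoffel k i j).unique
    ((h.hasDerivAt_christoffel k j i).congr_of_eventuallyEq ?_)
  filter_upwards [h.eventually_pos] with t ht
  exact (h.isMetricAt ht).christoffel_comm k i j

theorem pd_sum {ι : Type*} (s : Finset ι) {F : ι → EuclideanSpace ℝ (Fin n) → ℝ}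
    (hF : ∀ i ∈ s, ContDiffAt ℝ ∞ (F i) y) (k : Fin n) :
    pd k (fun z => ∑ i ∈ s, F i z) y = ∑ i ∈ s, pd k (F i) y :=
  fderiv_sum_apply s (fun i hi => (hF i hi).differentiableAt_of_smooth) _

theorem pd_mul {F F' : EuclideanSpace ℝ (Fin n) → ℝ} (hF : ContDiffAt ℝ ∞ F y)
    (hF' : ContDiffAt ℝ ∞ F' y) (k : Fin n) :
    pd k (fun z => F z * F' z) y = pd k F y * F' y + F y * pd k F' y :=
  fderiv_mul_apply hF.differentiableAt_of_smooth hF'.differentiableAt_of_smooth _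

/-- The Palatini identity. -/
theorem IsVariationAt.palatini_identity (h : IsVariationAt G H y) :
    ∑ i, ∑ j, dens G i j y * dotRicci G H i j y = ∑ k, pd k (palatini G H k) y := by
  have hm := h.toIsMetricAt
  have hds := h.contDiffAt_dens
  have hcs := h.contDiffAt_dotGamma
  -- In the product rule, derivatives of δΓ match those in `dotRicci`; derivatives of the parallel
  -- density turn into the ΓδΓ terms. About δΓ only its symmetry is used.
  have p1 : ∀ k, pd k (palatini G H k) y =
      (∑ i, ∑ j, (pd k (dens G i j) y * dotGamma G H k i j y +
        dens G i j y * pd k (dotGamma G H k i j) y)) -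
      ∑ i, ∑ j, (pd k (dens G i k) y * dotGamma G H j i j y +
        dens G i k y * pd k (dotGamma G H j i j) y) := by
    intro k
    have a1 : ∀ i j, ContDiffAt ℝ ∞ (fun z => dens G i j z * dotGamma G H k i j z) y :=
      fun i j => (hds i j).mul (hcs k i j)
    have a2 : ∀ i j, ContDiffAt ℝ ∞ (fun z => dens G i k z * dotGamma G H j i j z) y :=
      fun i j => (hds i k).mul (hcs j i j)
    have b1 := fun i => ContDiffAt.sum (s := Finset.univ) fun j _ => a1 i j
    have b2 := fun i => ContDiffAt.sum (s := Finset.univ) fun j _ => a2 i j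
    have e : pd k (palatini G H k) y =
        pd k (fun z => ∑ i, ∑ j, dens G i j z * dotGamma G H k i j z) y -
        pd k (fun z => ∑ i, ∑ j, dens G i k z * dotGamma G H j i j z) y := by
      have := fderiv_fun_sub
        (ContDiffAt.sum (s := Finset.univ) fun i _ => b1 i).differentiableAt_of_smooth
        (ContDiffAt.sum (s := Finset.univ) fun i _ => b2 i).differentiableAt_of_smooth
      exact congrArg (fun L => L (stdVec k)) this
    rw [e, pd_sum _ fun i _ => b1 i, pd_sum _ fun i _ => b2 i]
    congr 1
    · refine Finset.sum_congr rfl fun i _ => ?_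
      rw [pd_sum _ fun j _ => a1 i j]
      exact Finset.sum_congr rfl fun j _ => pd_mul (hds i j) (hcs k i j) k
    · refine Finset.sum_congr rfl fun i _ => ?_
      rw [pd_sum _ fun j _ => a2 i j]
      exact Finset.sum_congr rfl fun j _ => pd_mul (hds i k) (hcs j i j) k
  -- second derivatives
  have s1 : ∑ k, ∑ i, ∑ j, dens G i j y * pd k (dotGamma G H k i j) y =
      ∑ i, ∑ j, ∑ k, dens G i j y * pd k (dotGamma G H k i j) y :=
    Finset.sum_comm.trans (sum_swap₂₃ _)
  have s2 : ∑ k, ∑ i, ∑ j, dens G i k y * pd k (dotGamma G H j i j) y =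
      ∑ i, ∑ j, ∑ k, dens G i j y * pd j (dotGamma G H k i k) y := Finset.sum_comm
  -- first derivatives of the density
  have t1 : ∑ k, ∑ i, ∑ j, pd k (dens G i j) y * dotGamma G H k i j y =
      (∑ i, ∑ j, ∑ k, ∑ l, dens G i j y * (christoffel G k k l y * dotGamma G H l i j y)) -
      (∑ i, ∑ j, ∑ k, ∑ l, dens G i j y * (dotGamma G H k j l y * christoffel G l i k y)) -
      ∑ i, ∑ j, ∑ k, ∑ l, dens G i j y * (christoffel G k j l y * dotGamma G H l i k y) := by
    simp only [pd_dens hm h.pos]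
    exact palatini_sums (fun i j => dens G i j y) (fun k i j => christoffel G k i j y)
      (fun k i j => dotGamma G H k i j y) hm.christoffel_comm h.dotGamma_comm
  have t2 : ∑ k, ∑ i, ∑ j, pd k (dens G i k) y * dotGamma G H j i j y =
      -∑ i, ∑ j, ∑ k, ∑ l, dens G i j y * (dotGamma G H k k l y * christoffel G l i j y) := by
    have e : ∀ i, ∑ k, pd k (dens G i k) y = -∑ a, ∑ b, dens G a b y * christoffel G i a b y := by
      intro i
      rw [← div_dens hm h.pos]
      refine Finset.sum_congr rfl fun k _ => ?_
      rw [pd_dens hm h.pos, pd_dens hm h.pos, dens_comm hm i k]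
      rw [Finset.sum_congr rfl fun l _ => congrArg (christoffel G i k l y * ·) (dens_comm hm l k),
        Finset.sum_congr rfl fun l _ => congrArg (christoffel G k k l y * ·) (dens_comm hm i l)]
      ring
    have e2 : ∑ k, ∑ i, ∑ j, pd k (dens G i k) y * dotGamma G H j i j y =
        ∑ i, (∑ k, pd k (dens G i k) y) * ∑ j, dotGamma G H j i j y := by
      rw [Finset.sum_comm]
      refine Finset.sum_congr rfl fun i _ => ?_
      rw [Finset.sum_mul]
      exact Finset.sum_congr rfl fun k _ => by rw [Finset.mul_sum]
    rw [e2]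
    simp only [e]
    exact palatini_sums_trace (fun i j => dens G i j y) (fun k i j => christoffel G k i j y)
      (fun k i j => dotGamma G H k i j y) h.dotGamma_comm
  simp only [p1, Finset.sum_sub_distrib, Finset.sum_add_distrib, s1, s2, t1, t2, dotRicci, mul_add,
    mul_sub, Finset.mul_sum]
  ring

end Palatini


/-! ### The pointwise first variation of R²√(det g). -/

section FirstVariation

variable {n : ℕ} {G H : EuclideanSpace ℝ (Fin n) → Matrix (Fin n) (Fin n) ℝ}
  {y : EuclideanSpace ℝ (Fin n)} {ψ : EuclideanSpace ℝ (Fin n) → ℝ}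

/-- The vector density `√(det g) ∇ψ`. -/
def gradDens (G : EuclideanSpace ℝ (Fin n) → Matrix (Fin n) (Fin n) ℝ)
    (ψ : EuclideanSpace ℝ (Fin n) → ℝ) (k : Fin n) (z : EuclideanSpace ℝ (Fin n)) : ℝ :=
  ∑ l, dens G k l z * pd l ψ z

/-- The boundary term in the integration by parts of `ψ √(det g) gⁱʲ δRicᵢⱼ`. -/
def current (G H : EuclideanSpace ℝ (Fin n) → Matrix (Fin n) (Fin n) ℝ)
    (ψ : EuclideanSpace ℝ (Fin n) → ℝ) (k : Fin n) (z : EuclideanSpace ℝ (Fin n)) : ℝ :=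
  ψ z * palatini G H k z + (∑ j, pd j ψ z * dotDens G H k j z) +
    trH G H z * (1 / 2) * gradDens G ψ k z

theorem IsVariationAt.contDiffAt_gradDens (h : IsVariationAt G H y) (hψ : ContDiffAt ℝ ∞ ψ y)
    (k : Fin n) : ContDiffAt ℝ ∞ (gradDens G ψ k) y :=
  ContDiffAt.sum fun l _ => (h.contDiffAt_dens k l).mul (contDiffAt_pd hψ l)

theorem IsVariationAt.contDiffAt_current (h : IsVariationAt G H y) (hψ : ContDiffAt ℝ ∞ ψ y)
    (k : Fin n) : ContDiffAt ℝ ∞ (current G H ψ k) y :=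
  ((hψ.mul (h.contDiffAt_palatini k)).add
    (ContDiffAt.sum fun j _ => (contDiffAt_pd hψ j).mul (h.contDiffAt_dotDens k j))).add
    ((h.contDiffAt_trH.mul contDiffAt_const).mul (h.contDiffAt_gradDens hψ k))

theorem IsVariationAt.div_gradDens (h : IsVariationAt G H y) (hψ : ContDiffAt ℝ ∞ ψ y) :
    ∑ k, pd k (gradDens G ψ k) y = Real.sqrt (G y).det * lapCoord G ψ y := by
  have hm := h.toIsMetricAt
  have e1 : ∀ k, pd k (gradDens G ψ k) y =
      ∑ l, (pd k (dens G k l) y * pd l ψ y + dens G k l y * pd k (pd l ψ) y) := by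
    intro k
    refine (pd_sum (F := fun l z => dens G k l z * pd l ψ z) _
      (fun l _ => (h.contDiffAt_dens k l).mul (contDiffAt_pd hψ l)) k).trans ?_
    exact Finset.sum_congr rfl fun l _ => pd_mul (h.contDiffAt_dens k l) (contDiffAt_pd hψ l) k
  have e2 : ∑ k, ∑ l, pd k (dens G k l) y * pd l ψ y =
      -∑ i, ∑ j, dens G i j y * ∑ l, christoffel G l i j y * pd l ψ y := by
    rw [Finset.sum_comm]
    simp only [← Finset.sum_mul, div_dens hm h.pos]
    simp only [neg_mul, Finset.sum_neg_distrib, Finset.sum_mul, Finset.mul_sum]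
    rw [Finset.sum_comm, sum_swap₂₃ (fun i l j => dens G i j y * christoffel G l i j y * pd l ψ y)]
    simp only [mul_assoc]
  simp only [e1, Finset.sum_add_distrib, e2, lapCoord, hessCoord, dens, mul_sub,
    Finset.sum_sub_distrib, Finset.mul_sum]
  simp only [mul_assoc]
  ring

/-- Integration by parts, twice, in pointwise form. The last two terms of `current` are chosen so
that their divergence absorbs ∂ψ times the Palatini density: the δΓ terms cancel through
`div_dotDens`, the derivative of tr(h) through `sum_dotGamma`. -/
theorem IsVariationAt.div_current (h : IsVariationAt G H y) (hψ : ContDiffAt ℝ ∞ ψ y) :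
    ψ y * ∑ i, ∑ j, dens G i j y * dotRicci G H i j y =
      (∑ k, pd k (current G H ψ k) y) - (∑ i, ∑ j, dotDens G H i j y * hessCoord G ψ i j y) -
        trH G H y / 2 * (Real.sqrt (G y).det * lapCoord G ψ y) := by
  have hm := h.toIsMetricAt
  have hτ := h.contDiffAt_trH.mul (contDiffAt_const (c := (1 / 2 : ℝ)))
  have e1 : ∀ k, pd k (current G H ψ k) y =
      (pd k ψ y * palatini G H k y + ψ y * pd k (palatini G H k) y) +
      (∑ j, (pd k (pd j ψ) y * dotDens G H k j y + pd j ψ y * pd k (dotDens G H k j) y)) +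
      (pd k (trH G H) y * (1 / 2) * gradDens G ψ k y +
        trH G H y * (1 / 2) * pd k (gradDens G ψ k) y) := by
    intro k
    have a1 := hψ.mul (h.contDiffAt_palatini k)
    have a2 := fun j => (contDiffAt_pd hψ j).mul (h.contDiffAt_dotDens k j)
    have a3 := hτ.mul (h.contDiffAt_gradDens hψ k)
    have b2 := ContDiffAt.sum (s := Finset.univ) fun j _ => a2 j
    have e : pd k (current G H ψ k) y = pd k (fun z => ψ z * palatini G H k z) y +
        pd k (fun z => ∑ j, pd j ψ z * dotDens G H k j z) y +
        pd k (fun z => trH G H z * (1 / 2) * gradDens G ψ k z) y := by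
      have f1 := fderiv_fun_add (a1.add b2).differentiableAt_of_smooth
        a3.differentiableAt_of_smooth
      have f2 := fderiv_fun_add a1.differentiableAt_of_smooth b2.differentiableAt_of_smooth
      exact congrArg (fun L => L (stdVec k)) (f1.trans (congrArg (· + _) f2))
    rw [e, pd_mul hψ (h.contDiffAt_palatini k), pd_mul hτ (h.contDiffAt_gradDens hψ k),
      pd_sum _ fun j _ => a2 j]
    congr 1
    · congr 1
      exact Finset.sum_congr rfl fun j _ => pd_mul (contDiffAt_pd hψ j) (h.contDiffAt_dotDens k j) k
    · congr 2
      have := fderiv_mul_const h.contDiffAt_trH.differentiableAt_of_smooth (1 / 2 : ℝ)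
      refine (congrArg (fun L => L (stdVec k)) this).trans ?_
      simp only [_root_.smul_apply, smul_eq_mul, pd]; ring
  have e2 : ∑ k, pd k ψ y * palatini G H k y =
      (∑ k, pd k ψ y * ∑ i, ∑ j, dens G i j y * dotGamma G H k i j y) -
      ∑ k, pd k (trH G H) y * (1 / 2) * gradDens G ψ k y := by
    have : ∀ k, ∑ i, ∑ j, dens G i k y * dotGamma G H j i j y =
        ∑ i, dens G i k y * (pd i (trH G H) y / 2) := fun k =>
      Finset.sum_congr rfl fun i _ => by rw [← Finset.mul_sum, h.sum_dotGamma]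
    simp only [palatini, mul_sub, Finset.sum_sub_distrib, this]
    congr 1
    simp only [gradDens, Finset.mul_sum]
    rw [Finset.sum_comm]
    exact Finset.sum_congr rfl fun i _ => Finset.sum_congr rfl fun k _ => by ring
  have e3 : ∑ k, ∑ j, pd j ψ y * pd k (dotDens G H k j) y =
      -(∑ j, pd j ψ y * ∑ a, ∑ b, dotDens G H a b y * christoffel G j a b y) -
      ∑ k, pd k ψ y * ∑ i, ∑ j, dens G i j y * dotGamma G H k i j y := by
    rw [Finset.sum_comm]
    simp only [← Finset.mul_sum, h.div_dotDens, Finset.sum_add_distrib]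
    rw [← Finset.sum_neg_distrib, ← Finset.sum_sub_distrib]
    exact Finset.sum_congr rfl fun j _ => by ring
  have e4 : ∑ i, ∑ j, dotDens G H i j y * hessCoord G ψ i j y =
      (∑ k, ∑ j, pd k (pd j ψ) y * dotDens G H k j y) -
      ∑ j, pd j ψ y * ∑ a, ∑ b, dotDens G H a b y * christoffel G j a b y := by
    have : ∑ j, pd j ψ y * ∑ a, ∑ b, dotDens G H a b y * christoffel G j a b y =
        ∑ a, ∑ b, dotDens G H a b y * ∑ j, christoffel G j a b y * pd j ψ y := by
      simp only [Finset.mul_sum]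
      rw [Finset.sum_comm]
      rw [sum_swap₂₃ (fun a j b => pd j ψ y * (dotDens G H a b y * christoffel G j a b y))]
      exact Finset.sum_congr rfl fun a _ => Finset.sum_congr rfl fun b _ =>
        Finset.sum_congr rfl fun j _ => by ring
    rw [this, ← Finset.sum_sub_distrib]
    refine Finset.sum_congr rfl fun a _ => ?_
    rw [← Finset.sum_sub_distrib]
    exact Finset.sum_congr rfl fun b _ => by rw [hessCoord]; ring
  rw [h.palatini_identity]
  simp only [e1, Finset.sum_add_distrib, e2, e3, e4, ← Finset.mul_sum, h.div_gradDens hψ]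
  ring

/-- The pointwise first variation of `R² √(det g)`. -/
theorem IsVariationAt.hasDerivAt_lagrangian (h : IsVariationAt G H y) :
    HasDerivAt (fun t => scalarCoord (varG G H t) y ^ 2 * Real.sqrt (varG G H t y).det)
      (Real.sqrt (G y).det * (∑ i, ∑ j, ((G y)⁻¹ * H y * (G y)⁻¹) i j * gradS2 G i j y) +
        2 * ∑ k, pd k (current G H (scalarCoord G) k) y) 0 := by
  have hm := h.toIsMetricAt
  have hρ := contDiffAt_scalarCoord h.smooth h.det_ne
  set ρ := scalarCoord G y with hρdef
  set w := Real.sqrt (G y).det with hw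
  set τ := trH G H y with hτ
  have d1 : HasDerivAt (fun t => scalarCoord (varG G H t) y)
    (dot (fun t => scalarCoord (varG G H t)) y) 0 := h.joint_scalarCoord.hasDerivAt
  have d2 : HasDerivAt (fun t => Real.sqrt (varG G H t y).det) (w * (τ / 2)) 0 :=
    hasDerivAt_sqrt h.pos
  -- R√(det g) is differentiated as PⁱʲRicᵢⱼ, the form to which the Palatini identity applies.
  have d3 : HasDerivAt (fun t => scalarCoord (varG G H t) y * Real.sqrt (varG G H t y).det)
      (∑ i, ∑ j, (dotDens G H i j y * ricciCoord G i j y + dens G i j y * dotRicci G H i j y))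
      0 := by
    have : (fun t => scalarCoord (varG G H t) y * Real.sqrt (varG G H t y).det) =
        fun t => ∑ i, ∑ j, dens (varG G H t) i j y * ricciCoord (varG G H t) i j y := by
      funext t
      simp only [scalarCoord, dens, Finset.sum_mul]
      exact Finset.sum_congr rfl fun i _ => Finset.sum_congr rfl fun j _ => by ring
    rw [this]
    refine HasDerivAt.fun_sum fun i _ => HasDerivAt.fun_sum fun j _ => ?_
    have := (h.hasDerivAt_dens i j).fun_mul (h.hasDerivAt_ricciCoord i j)
    simpa only [varG_zero] using this
  have d3' := d1.fun_mul d2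
  -- Comparison with the plain product rule determines √(det g)δR, so δR needs no formula of its
  -- own.
  have hu := d3'.unique d3
  simp only [varG_zero] at hu
  have d4 := d1.fun_mul d3
  simp only [varG_zero] at d4
  have : (fun t => scalarCoord (varG G H t) y ^ 2 * Real.sqrt (varG G H t y).det) =
    fun t => scalarCoord (varG G H t) y *
      (scalarCoord (varG G H t) y * Real.sqrt (varG G H t y).det) := by
    funext t; ring
  rw [this]
  refine d4.congr_deriv ?_
  have hdiv := h.div_current hρ
  simp only [Finset.sum_add_distrib] at hu ⊢
  rw [← hρdef, ← hw, ← hτ] at *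
  have p1 : ∑ i, ∑ j, dotDens G H i j y * ricciCoord G i j y =
      τ / 2 * (w * ρ) - w * ∑ i, ∑ j, ((G y)⁻¹ * H y * (G y)⁻¹) i j * ricciCoord G i j y := by
    have : ρ = ∑ i, ∑ j, (G y)⁻¹ i j * ricciCoord G i j y := rfl
    rw [this]
    simp only [dotDens_eq h.pos, dens, Finset.mul_sum, ← Finset.sum_sub_distrib]
    exact Finset.sum_congr rfl fun i _ => Finset.sum_congr rfl fun j _ => by ring
  have p2 : ∑ i, ∑ j, dotDens G H i j y * hessCoord G (scalarCoord G) i j y =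
      τ / 2 * (w * lapCoord G (scalarCoord G) y) -
      w * ∑ i, ∑ j, ((G y)⁻¹ * H y * (G y)⁻¹) i j * hessCoord G (scalarCoord G) i j y := by
    rw [lapCoord]
    simp only [dotDens_eq h.pos, dens, Finset.mul_sum, ← Finset.sum_sub_distrib]
    exact Finset.sum_congr rfl fun i _ => Finset.sum_congr rfl fun j _ => by ring
  have p3 : ∑ i, ∑ j, ((G y)⁻¹ * H y * (G y)⁻¹) i j * G y i j = τ := by
    have : τ = ((G y)⁻¹ * H y * (G y)⁻¹ * G y).trace := by
      rw [hτ, Matrix.nonsing_inv_mul_cancel_right _ _ hm.isUnit]; rfl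
    rw [this]
    generalize (G y)⁻¹ * H y * (G y)⁻¹ = B
    simp only [Matrix.trace, Matrix.diag, Matrix.mul_apply]
    exact Finset.sum_congr rfl fun i _ => Finset.sum_congr rfl fun j _ => by rw [hm.apply_comm]
  have p4 : ∑ i, ∑ j, ((G y)⁻¹ * H y * (G y)⁻¹) i j * gradS2 G i j y =
      2 * (∑ i, ∑ j, ((G y)⁻¹ * H y * (G y)⁻¹) i j * hessCoord G (scalarCoord G) i j y) -
      2 * lapCoord G (scalarCoord G) y * τ -
      2 * ρ * (∑ i, ∑ j, ((G y)⁻¹ * H y * (G y)⁻¹) i j * ricciCoord G i j y) +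
      ρ ^ 2 / 2 * τ := by
    rw [← p3]
    simp only [Finset.mul_sum, ← Finset.sum_add_distrib, ← Finset.sum_sub_distrib]
    refine Finset.sum_congr rfl fun i _ => Finset.sum_congr rfl fun j _ => ?_
    rw [gradS2]; ring
  rw [p4]
  rw [p2] at hdiv
  rw [p1] at hu ⊢
  linear_combination ρ * hu + 2 * hdiv

/-- Only ∂ⱼΓᵏᵢₖ is not visibly symmetric; it is a second derivative of log √(det g), so mixed
partials of √(det g) settle it. -/
theorem IsMetricAt.ricciCoord_comm (h : ∀ᶠ z in 𝓝 y, IsMetricAt G z)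
    (hpos : ∀ᶠ z in 𝓝 y, 0 < (G z).det) (i j : Fin n) :
    ricciCoord G i j y = ricciCoord G j i y := by
  have h0 := h.self_of_nhds
  have hp0 := hpos.self_of_nhds
  have hc := fun k i j => contDiffAt_christoffel h0.smooth h0.det_ne k i j
  have hγ : ∀ i, ContDiffAt ℝ ∞ (fun z => ∑ k, christoffel G k i k z) y := fun i =>
    ContDiffAt.sum fun k _ => hc k i k
  have hw := h0.smooth.sqrt_det hp0
  have e1 : ∀ i j, ∑ k, pd j (christoffel G k i k) y = ∑ k, pd i (christoffel G k j k) y := by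
    have key : ∀ i j, pd j (pd i fun z => Real.sqrt (G z).det) y =
        Real.sqrt (G y).det * (∑ k, christoffel G k j k y) * (∑ k, christoffel G k i k y) +
        Real.sqrt (G y).det * ∑ k, pd j (christoffel G k i k) y := by
      intro i j
      have e : pd i (fun z => Real.sqrt (G z).det) =ᶠ[𝓝 y]
          fun z => Real.sqrt (G z).det * ∑ k, christoffel G k i k z := by
        filter_upwards [h, hpos] with z h1 h2 using h1.pd_sqrt_det h2 i
      rw [pd_congr e, pd_mul hw (hγ i), h0.pd_sqrt_det hp0, pd_sum _ fun k _ => hc k i k]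
    intro i j
    have h1 := key i j
    rw [pd_comm hw, key j i] at h1
    apply mul_left_cancel₀ (Real.sqrt_pos.2 hp0).ne'
    linear_combination -h1
  have e2 : ∀ k i j, pd k (christoffel G k i j) y = pd k (christoffel G k j i) y := fun k i j =>
    pd_congr (h.mono fun z hz => hz.christoffel_comm k i j) k
  have e3 : ∑ k, ∑ l, christoffel G k j l y * christoffel G l i k y =
      ∑ k, ∑ l, christoffel G k i l y * christoffel G l j k y := by
    rw [Finset.sum_comm]
    exact Finset.sum_congr rfl fun k _ => Finset.sum_congr rfl fun l _ => mul_comm _ _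
  simp only [ricciCoord, Finset.sum_sub_distrib, e1 i j, e3, fun k => e2 k i j,
    fun l => h0.christoffel_comm l i j]

end FirstVariation


/-! ### Integration, and the Euler-Lagrange equation in coordinates. -/

section Integration

variable {n : ℕ}

/-- The tube lemma gives an interval of t that works for all of K; on the resulting compact box the
t-derivative is bounded, and the bound is the dominating constant. -/
theorem hasDerivAt_setIntegral_of_contDiffAt {K : Set (EuclideanSpace ℝ (Fin n))}
    (hK : IsCompact K) {Ω : Set (ℝ × EuclideanSpace ℝ (Fin n))} (hΩ : IsOpen Ω)
    {L : ℝ × EuclideanSpace ℝ (Fin n) → ℝ} (hL : ∀ q ∈ Ω, ContDiffAt ℝ ∞ L q)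
    (hKΩ : ∀ y ∈ K, ((0 : ℝ), y) ∈ Ω) :
    HasDerivAt (fun t => ∫ y in K, L (t, y)) (∫ y in K, fderiv ℝ L (0, y) (1, 0)) 0 := by
  obtain ⟨u, v, hu, -, h0u, hKv, huv⟩ := generalized_tube_lemma
    (isCompact_singleton (x := (0 : ℝ))) hK hΩ (by rintro ⟨t, y⟩ ⟨rfl, hy⟩; exact hKΩ y hy)
  obtain ⟨ε, hε, hball⟩ := Metric.isOpen_iff.1 hu 0 (h0u rfl)
  have hsub : ∀ t ∈ Metric.closedBall (0 : ℝ) (ε / 2), ∀ y ∈ K, (t, y) ∈ Ω := fun t ht y hy =>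
    huv ⟨hball (Metric.closedBall_subset_ball (by linarith) ht), hKv hy⟩
  have hcL : ContinuousOn L Ω := fun q hq => (hL q hq).continuousAt.continuousWithinAt
  have hcD : ContinuousOn (fun q => fderiv ℝ L q (1, 0)) Ω := fun q hq =>
    (((hL q hq).fderiv_right (m := ∞) (by simp)).continuousAt.clm_apply
      continuousAt_const).continuousWithinAt
  have hslice : ∀ t : ℝ, Continuous fun y : EuclideanSpace ℝ (Fin n) => (t, y) := fun t => by fun_prop
  have hcLt : ∀ t ∈ Metric.closedBall (0 : ℝ) (ε / 2), ContinuousOn (fun y => L (t, y)) K :=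
    fun t ht => hcL.comp (hslice t).continuousOn fun y hy => hsub t ht y hy
  have hcDt : ∀ t ∈ Metric.closedBall (0 : ℝ) (ε / 2),
      ContinuousOn (fun y => fderiv ℝ L (t, y) (1, 0)) K :=
    fun t ht => hcD.comp (hslice t).continuousOn fun y hy => hsub t ht y hy
  have h0 : (0 : ℝ) ∈ Metric.closedBall (0 : ℝ) (ε / 2) := Metric.mem_closedBall_self (by linarith)
  have hnhds : Metric.closedBall (0 : ℝ) (ε / 2) ∈ 𝓝 (0 : ℝ) :=
    Metric.closedBall_mem_nhds 0 (by linarith)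
  obtain ⟨C, hC⟩ := ((isCompact_closedBall (0 : ℝ) (ε / 2)).prod hK).exists_bound_of_continuousOn
    (f := fun q => fderiv ℝ L q (1, 0)) (hcD.mono fun q hq => hsub q.1 hq.1 q.2 hq.2)
  refine (hasDerivAt_integral_of_dominated_loc_of_deriv_le (μ := volume.restrict K)
    (F := fun t y => L (t, y)) (F' := fun t y => fderiv ℝ L (t, y) (1, 0)) (bound := fun _ => C)
    hnhds ?_ ?_ ?_ ?_ ?_ ?_).2
  · filter_upwards [hnhds] with t ht
    exact (hcLt t ht).aestronglyMeasurable hK.measurableSet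
  · exact (hcLt 0 h0).integrableOn_compact hK
  · exact (hcDt 0 h0).aestronglyMeasurable hK.measurableSet
  · refine (ae_restrict_iff' hK.measurableSet).2 (Filter.Eventually.of_forall fun y hy t ht => ?_)
    exact hC (t, y) ⟨ht, hy⟩
  · exact integrableOn_const hK.measure_lt_top.ne
  · refine (ae_restrict_iff' hK.measurableSet).2 (Filter.Eventually.of_forall fun y hy t ht => ?_)
    have hd := (hL (t, y) (hsub t ht y hy)).differentiableAt_of_smooth.hasFDerivAt
    have hc : HasFDerivAt (fun s : ℝ => (s, y))
        (ContinuousLinearMap.inl ℝ ℝ (EuclideanSpace ℝ (Fin n))) t := hasFDerivAt_prodMk_left t y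
    exact (hd.comp t hc).hasDerivAt

theorem integral_pd_eq_zero {Z : EuclideanSpace ℝ (Fin n) → ℝ} (hZ : ContDiff ℝ ∞ Z)
    (hc : HasCompactSupport Z) (k : Fin n) : ∫ y, pd k Z y = 0 := by
  have hd : Differentiable ℝ Z := hZ.differentiable (by simp)
  have hcont : Continuous fun x => fderiv ℝ Z x (stdVec k) :=
    (hZ.continuous_fderiv (by simp)).clm_apply continuous_const
  have h := integral_mul_fderiv_eq_neg_fderiv_mul_of_integrable (μ := volume)
    (f := fun _ : EuclideanSpace ℝ (Fin n) => (1 : ℝ)) (g := Z) (v := stdVec k)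
    (by simp) (by simpa using hcont.integrable_of_hasCompactSupport (hc.fderiv_apply ℝ (stdVec k)))
    (by simpa using hZ.continuous.integrable_of_hasCompactSupport hc)
    (fun x _ => differentiableAt_const _) (fun x _ => hd x)
  simpa [pd] using h

theorem christoffel_congr {G G' : EuclideanSpace ℝ (Fin n) → Matrix (Fin n) (Fin n) ℝ}
    {y : EuclideanSpace ℝ (Fin n)} (h : G =ᶠ[𝓝 y] G') (k i j : Fin n) :
    christoffel G k i j y = christoffel G' k i j y := by
  have : ∀ l i j, pd l (fun z => G z i j) y = pd l (fun z => G' z i j) y := fun l i j =>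
    pd_congr (h.mono fun z hz => by simp only [hz]) l
  simp only [christoffel, h.self_of_nhds, this]

theorem ricciCoord_congr {G G' : EuclideanSpace ℝ (Fin n) → Matrix (Fin n) (Fin n) ℝ}
    {y : EuclideanSpace ℝ (Fin n)} (h : G =ᶠ[𝓝 y] G') (i j : Fin n) :
    ricciCoord G i j y = ricciCoord G' i j y := by
  have h1 : ∀ k i j, christoffel G k i j =ᶠ[𝓝 y] christoffel G' k i j := fun k i j =>
    (eventually_eventuallyEq_nhds.2 h).mono fun z hz => christoffel_congr hz k i j
  simp only [ricciCoord, christoffel_congr h, fun m k i j => pd_congr (h1 k i j) m]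

theorem scalarCoord_congr {G G' : EuclideanSpace ℝ (Fin n) → Matrix (Fin n) (Fin n) ℝ}
    {y : EuclideanSpace ℝ (Fin n)} (h : G =ᶠ[𝓝 y] G') :
    scalarCoord G y = scalarCoord G' y := by
  simp only [scalarCoord, ricciCoord_congr h, h.self_of_nhds]

theorem hessCoord_congr {G G' : EuclideanSpace ℝ (Fin n) → Matrix (Fin n) (Fin n) ℝ}
    {F F' : EuclideanSpace ℝ (Fin n) → ℝ}
    {y : EuclideanSpace ℝ (Fin n)} (h : G =ᶠ[𝓝 y] G') (hF : F =ᶠ[𝓝 y] F') (i j : Fin n) :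
    hessCoord G F i j y = hessCoord G' F' i j y := by
  simp only [hessCoord, christoffel_congr h, pd_congr (pd_eventuallyEq hF j),
    fun k => pd_congr hF k]

/-- Where H vanishes near y the family is constant in t, so every variation is zero. Nothing is
assumed on G or ψ there, which allows the current to be treated as a function on all of ℝⁿ. -/
theorem current_eq_zero {G H : EuclideanSpace ℝ (Fin n) → Matrix (Fin n) (Fin n) ℝ}
    {ψ : EuclideanSpace ℝ (Fin n) → ℝ} {y : EuclideanSpace ℝ (Fin n)}
    (hH : ∀ᶠ z in 𝓝 y, H z = 0) (k : Fin n) : current G H ψ k y = 0 := by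
  have hv : ∀ t, varG G H t =ᶠ[𝓝 y] G := fun t => hH.mono fun z hz => by simp [varG, hz]
  have h1 : ∀ k i j, dotGamma G H k i j y = 0 := fun k i j => by
    simp [dotGamma, dot, christoffel_congr (hv _)]
  have h2 : ∀ i j, dotDens G H i j y = 0 := fun i j => by
    simp [dotDens, dot, dens, (hv _).self_of_nhds]
  have h3 : trH G H y = 0 := by simp [trH, hH.self_of_nhds]
  simp [current, palatini, h1, h2, h3]

/-- The Euler-Lagrange equation of `∫ R² dV`, in coordinates. -/
theorem gradS2_eq_zero {U : Set (EuclideanSpace ℝ (Fin n))} (hU : IsOpen U)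
    {G : EuclideanSpace ℝ (Fin n) → Matrix (Fin n) (Fin n) ℝ} (hG : ∀ y ∈ U, IsMetricAt G y)
    (hpos : ∀ y ∈ U, 0 < (G y).det)
    (hcrit : ∀ η : EuclideanSpace ℝ (Fin n) → ℝ, ContDiff ℝ ∞ η → HasCompactSupport η →
      tsupport η ⊆ U → ∀ S : Matrix (Fin n) (Fin n) ℝ, S.transpose = S →
      HasDerivAt (fun t => ∫ y in tsupport η, scalarCoord (varG G (fun z => η z • S) t) y ^ 2 *
        Real.sqrt (varG G (fun z => η z • S) t y).det) 0 0) :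
    ∀ y ∈ U, ∀ i j, gradS2 G i j y = 0 := by
  have hρ : ∀ y ∈ U, ContDiffAt ℝ ∞ (scalarCoord G) y := fun y hy =>
    contDiffAt_scalarCoord (hG y hy).smooth (hG y hy).det_ne
  have hEc : ∀ i j, ContinuousOn (gradS2 G i j) U := by
    intro i j y hy
    have hs := hρ y hy
    have hm := hG y hy
    have hh : ∀ i j, ContDiffAt ℝ ∞ (hessCoord G (scalarCoord G) i j) y := fun i j =>
      (contDiffAt_pd (contDiffAt_pd hs j) i).sub (ContDiffAt.sum fun k _ =>
        (contDiffAt_christoffel hm.smooth hm.det_ne k i j).mul (contDiffAt_pd hs k))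
    have hl : ContDiffAt ℝ ∞ (lapCoord G (scalarCoord G)) y :=
      ContDiffAt.sum fun i _ => ContDiffAt.sum fun j _ =>
        (hm.smooth.inv hm.det_ne i j).mul (hh i j)
    have : ContDiffAt ℝ ∞ (gradS2 G i j) y :=
      (((contDiffAt_const.mul (hh i j)).sub ((contDiffAt_const.mul hl).mul (hm.smooth i j))).sub
        ((contDiffAt_const.mul hs).mul (contDiffAt_ricciCoord hm.smooth hm.det_ne i j))).add
        (((hs.pow 2).div_const 2).mul (hm.smooth i j))
    exact this.continuousAt.continuousWithinAt
  have key : ∀ S : Matrix (Fin n) (Fin n) ℝ, S.transpose = S → ∀ y ∈ U,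
      Real.sqrt (G y).det * (∑ i, ∑ j, ((G y)⁻¹ * S * (G y)⁻¹) i j * gradS2 G i j y) = 0 := by
    intro S hS
    set f := fun y => Real.sqrt (G y).det *
      (∑ i, ∑ j, ((G y)⁻¹ * S * (G y)⁻¹) i j * gradS2 G i j y) with hf
    have hfc : ContinuousOn f U := by
      have hw : ContinuousOn (fun y => Real.sqrt (G y).det) U := fun y hy =>
        ((hG y hy).smooth.sqrt_det (hpos y hy)).continuousAt.continuousWithinAt
      refine hw.mul (continuousOn_finsetSum _ fun i _ => continuousOn_finsetSum _ fun j _ =>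
        ContinuousOn.mul (fun y hy => ?_) (hEc i j))
      have hi := (hG y hy).smooth.inv (hG y hy).det_ne
      have hS : MatSmoothAt (fun _ => S) y := fun _ _ => contDiffAt_const
      exact (((hi.mul hS).mul hi) i j).continuousAt.continuousWithinAt
    -- The fundamental lemma gives vanishing almost everywhere on U; continuity of `f` upgrades this
    -- to every point.
    have hae := hU.ae_eq_zero_of_integral_contDiff_smul_eq_zero (μ := volume) (f := f)
      (hfc.locallyIntegrableOn hU.measurableSet) ?_
    · have := Measure.eqOn_open_of_ae_eq (μ := volume) (f := f) (g := fun _ => 0)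
        ((ae_restrict_iff' hU.measurableSet).2 hae) hU hfc continuousOn_const
      exact fun y hy => this hy
    intro η hη hηc hηU
    set H : EuclideanSpace ℝ (Fin n) → Matrix (Fin n) (Fin n) ℝ := fun z => η z • S with hH
    have hv : ∀ y ∈ U, IsVariationAt G H y := fun y hy =>
      { hG y hy with
        pos := hpos y hy
        smoothH := MatSmoothAt.smul hη.contDiffAt fun _ _ => contDiffAt_const
        symmH := Filter.Eventually.of_forall fun z => by rw [hH, Matrix.transpose_smul, hS] }
    have hoff : ∀ y ∉ tsupport η, ∀ᶠ z in 𝓝 y, H z = 0 := fun y hy => by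
      filter_upwards [(isClosed_tsupport η).isOpen_compl.mem_nhds hy] with z hz
      rw [hH]; simp only [image_eq_zero_of_notMem_tsupport hz, zero_smul]
    set Z := current G H (scalarCoord G) with hZ
    have hZs : ∀ k, ContDiff ℝ ∞ (Z k) := fun k => contDiff_iff_contDiffAt.2 fun y => by
      by_cases hy : y ∈ tsupport η
      · exact (hv y (hηU hy)).contDiffAt_current (hρ y (hηU hy)) k
      · refine (contDiffAt_const (c := (0 : ℝ))).congr_of_eventuallyEq ?_
        exact (eventually_eventually_nhds.2 (hoff y hy)).mono fun z hz => current_eq_zero hz k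
    have hZsub : ∀ k, Function.support (Z k) ⊆ tsupport η := fun k y hy => by
      by_contra hy'
      exact hy (current_eq_zero (hoff y hy') k)
    have hZc : ∀ k, HasCompactSupport (Z k) := fun k =>
      HasCompactSupport.of_support_subset_isCompact hηc (hZsub k)
    have hpdZ : ∀ k, ∀ y ∉ tsupport η, pd k (Z k) y = 0 := fun k y hy => by
      have : Z k =ᶠ[𝓝 y] fun _ => 0 :=
        (eventually_eventually_nhds.2 (hoff y hy)).mono fun z hz => current_eq_zero hz k
      rw [pd_congr this]; simp [pd]
    have hpdi : ∀ k, Integrable (pd k (Z k)) := fun k =>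
      Continuous.integrable_of_hasCompactSupport
        (((hZs k).continuous_fderiv (by simp)).clm_apply continuous_const)
        ((hZc k).fderiv_apply ℝ (stdVec k))
    -- differentiate under the integral sign
    set Ω : Set (ℝ × EuclideanSpace ℝ (Fin n)) :=
      {q | q.2 ∈ U} ∩ {q | 0 < (varG G H q.1 q.2).det} with hΩdef
    have hΩ : IsOpen Ω := by
      have hUo : IsOpen {q : ℝ × EuclideanSpace ℝ (Fin n) | q.2 ∈ U} := hU.preimage continuous_snd
      refine ContinuousOn.isOpen_inter_preimage (f := fun q : ℝ × EuclideanSpace ℝ (Fin n) =>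
        (varG G H q.1 q.2).det) (t := Set.Ioi 0) ?_ hUo isOpen_Ioi
      exact fun q hq => ((hv q.2 hq).joint q.1).det.continuousAt.continuousWithinAt
    have hL : ∀ q ∈ Ω, ContDiffAt ℝ ∞ (fun q : ℝ × EuclideanSpace ℝ (Fin n) =>
        scalarCoord (varG G H q.1) q.2 ^ 2 * Real.sqrt (varG G H q.1 q.2).det) q := fun q hq =>
      ((contDiffAt_scalarCoord_param ((hv q.2 hq.1).joint q.1) (ne_of_gt hq.2)).pow 2).mul
        (((hv q.2 hq.1).joint q.1).sqrt_det hq.2)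
    have hKΩ : ∀ y ∈ tsupport η, ((0 : ℝ), y) ∈ Ω := fun y hy =>
      ⟨hηU hy, (hv y (hηU hy)).det_varG_zero⟩
    have hder := hasDerivAt_setIntegral_of_contDiffAt hηc hΩ hL hKΩ
    have h0 := hder.unique (hcrit η hη hηc hηU S hS)
    have hpt : ∀ y ∈ tsupport η, fderiv ℝ (fun q : ℝ × EuclideanSpace ℝ (Fin n) =>
        scalarCoord (varG G H q.1) q.2 ^ 2 * Real.sqrt (varG G H q.1 q.2).det) (0, y) (1, 0) =
        η y • f y + 2 * ∑ k, pd k (Z k) y := by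
      intro y hy
      have hc : HasFDerivAt (fun s : ℝ => (s, y))
        (ContinuousLinearMap.inl ℝ ℝ (EuclideanSpace ℝ (Fin n))) 0 := hasFDerivAt_prodMk_left 0 y
      have h1 := ((hL (0, y) (hKΩ y hy)).differentiableAt_of_smooth.hasFDerivAt.comp
        (0 : ℝ) hc).hasDerivAt
      refine (h1.unique (hv y (hηU hy)).hasDerivAt_lagrangian).trans ?_
      rw [← hZ]
      congr 1
      simp only [hH, hf, Matrix.mul_smul, Matrix.smul_mul, Matrix.smul_apply, smul_eq_mul,
        Finset.mul_sum]
      exact Finset.sum_congr rfl fun i _ => Finset.sum_congr rfl fun j _ => by ring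
    rw [setIntegral_congr_fun hηc.measurableSet hpt] at h0
    have hηf : Integrable fun y => η y • f y := by
      have hc : Continuous fun y => η y • f y := by
        rw [continuous_iff_continuousAt]
        intro y
        by_cases hy : y ∈ tsupport η
        · exact hη.continuous.continuousAt.smul (hfc.continuousAt (hU.mem_nhds (hηU hy)))
        · refine (continuousAt_const (y := (0 : ℝ))).congr ?_
          filter_upwards [(isClosed_tsupport η).isOpen_compl.mem_nhds hy] with z hz
          rw [image_eq_zero_of_notMem_tsupport hz, zero_smul]
      exact hc.integrable_of_hasCompactSupport (hηc.smul_right)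
    have hsum : Integrable fun y => 2 * ∑ k, pd k (Z k) y :=
      (integrable_finsetSum _ fun k _ => hpdi k).const_mul 2
    -- The integrand vanishes off the support of η, so the integral extends to ℝⁿ, where the
    -- divergence integrates to zero.
    rw [setIntegral_eq_integral_of_forall_compl_eq_zero (fun y hy => by
      rw [image_eq_zero_of_notMem_tsupport hy, zero_smul,
        Finset.sum_eq_zero fun k _ => hpdZ k y hy]; simp), integral_add hηf hsum,
      integral_const_mul, integral_finsetSum _ fun k _ => hpdi k,
      Finset.sum_eq_zero fun k _ => integral_pd_eq_zero (hZs k) (hZc k) k] at h0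
    simpa using h0
  intro y hy a b
  have hm := hG y hy
  -- Symmetric tests detect only the symmetric part of the Euler-Lagrange expression, hence its
  -- symmetry is needed.
  have hsym : gradS2 G a b y = gradS2 G b a y := by
    have hev : ∀ᶠ z in 𝓝 y, IsMetricAt G z := by
      filter_upwards [hU.mem_nhds hy] with z hz using hG z hz
    have hev' : ∀ᶠ z in 𝓝 y, 0 < (G z).det := by
      filter_upwards [hU.mem_nhds hy] with z hz using hpos z hz
    rw [gradS2, gradS2, IsMetricAt.ricciCoord_comm hev hev' a b, hm.apply_comm a b]
    have : hessCoord G (scalarCoord G) a b y = hessCoord G (scalarCoord G) b a y := by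
      simp only [hessCoord, pd_comm (hρ y hy) a b, fun k => hm.christoffel_comm k a b]
    rw [this]
  set B : Matrix (Fin n) (Fin n) ℝ := Matrix.single a b 1 + Matrix.single b a 1 with hB
  have hBt : B.transpose = B := by
    rw [hB, Matrix.transpose_add, Matrix.transpose_single, Matrix.transpose_single, add_comm]
  -- Lowering the indices of B at this fixed point cancels the two inverse metrics, so that B itself
  -- is paired with the expression.
  have h1 := key (G y * B * G y) (by
    rw [Matrix.transpose_mul, Matrix.transpose_mul, hm.symm.self_of_nhds, hBt, mul_assoc]) y hy
  have h2 : (G y)⁻¹ * (G y * B * G y) * (G y)⁻¹ = B := by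
    rw [mul_assoc (G y), Matrix.nonsing_inv_mul_cancel_left _ _ hm.isUnit,
      Matrix.mul_nonsing_inv_cancel_right _ _ hm.isUnit]
  rw [h2] at h1
  have h3 := (mul_eq_zero.1 h1).resolve_left (Real.sqrt_pos.2 (hpos y hy)).ne'
  have h4 : ∑ i, ∑ j, B i j * gradS2 G i j y = gradS2 G a b y + gradS2 G b a y := by
    simp [hB, Matrix.single_apply, add_mul, Finset.sum_add_distrib, ite_and]
  rw [h4, ← hsym] at h3
  linarith

end Integration


/-! ### Tensor fields in the preferred charts. -/

section Charts

/-- The coordinate space `ℝⁿ`. -/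
abbrev Coord (n : ℕ) : Type := EuclideanSpace ℝ (Fin n)

variable {n : ℕ} {M : Type*} [TopologicalSpace M] [ChartedSpace (EuclideanSpace ℝ (Fin n)) M]

/-- The image of a coordinate vector under the differential of the inverse of a chart. -/
def chartVec (c : OpenPartialHomeomorph M (Coord n)) (y : Coord n) : Coord n →L[ℝ] Coord n :=
  mfderiv (𝓡 n) (𝓡 n) c.symm y

/-- A field of bilinear forms, evaluated on vectors of the model space. -/
def evalAt (h : BilinField n M) (p : M) : Coord n →L[ℝ] Coord n →L[ℝ] ℝ := h p

theorem gram_apply (h : BilinField n M) (c : OpenPartialHomeomorph M (Coord n)) (y : Coord n)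
    (i j : Fin n) : gram h c y i j =
      evalAt h (c.symm y) (chartVec c y (stdVec i)) (chartVec c y (stdVec j)) := rfl

theorem gram_variation (g h : BilinField n M) (c : OpenPartialHomeomorph M (Coord n)) (t : ℝ) :
    gram (fun p => g p + t • h p) c = varG (gram g c) (gram h c) t := rfl

/-- The components of a field of bilinear forms are smooth in each of the preferred charts. -/
def ChartSmooth (h : BilinField n M) : Prop :=
  ∀ x : M, ∀ y ∈ (chartAt (Coord n) x).target, MatSmoothAt (gram h (chartAt (Coord n) x)) y

theorem ChartSmooth.variation {g h : BilinField n M} (hg : ChartSmooth g) (hh : ChartSmooth h)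
    (t : ℝ) : ChartSmooth fun p => g p + t • h p := fun x y hy i j =>
  (hg x y hy i j).add (contDiffAt_const.mul (hh x y hy i j))

theorem gram_transpose {h : BilinField n M}
    (hs : ∀ (x : M) (v w : TangentSpace (𝓡 n) x), h x v w = h x w v)
    (c : OpenPartialHomeomorph M (Coord n)) (y : Coord n) :
    (gram h c y).transpose = gram h c y := by
  ext i j
  exact hs _ _ _

variable [IsManifold (𝓡 n) ∞ M]

theorem contMDiffAt_chart_symm (x : M) {y : Coord n} (hy : y ∈ (chartAt (Coord n) x).target) :
    ContMDiffAt (𝓡 n) (𝓡 n) ∞ (chartAt (Coord n) x).symm y :=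
  (contMDiffOn_chart_symm (I := 𝓡 n) (n := ∞) (x := x)).contMDiffAt
    ((chartAt (Coord n) x).open_target.mem_nhds hy)

theorem contMDiffAt_chart (x : M) {p : M} (hp : p ∈ (chartAt (Coord n) x).source) :
    ContMDiffAt (𝓡 n) (𝓡 n) ∞ (chartAt (Coord n) x) p :=
  (contMDiffOn_chart (I := 𝓡 n) (n := ∞) (x := x)).contMDiffAt
    ((chartAt (Coord n) x).open_source.mem_nhds hp)

/-- Bridges the bundle description of smoothness and the coordinate fields used by `gram`. -/
theorem trivializationAt_symm_eq (x₀ p : M) (hp : p ∈ (chartAt (Coord n) x₀).source)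
    (u : Coord n) :
    (trivializationAt (Coord n) (fun x : M => TangentSpace (𝓡 n) x) x₀).symm p u =
      chartVec (chartAt (Coord n) x₀) (chartAt (Coord n) x₀ p) u := by
  have h1 := TangentBundle.symmL_trivializationAt (I := 𝓡 n) (x₀ := x₀) (x := p) hp
  have h2 := congrArg (fun L => L u) h1
  rw [Bundle.Trivialization.symmL_apply _ (by simpa using hp)] at h2
  refine h2.trans ?_
  simp only [extChartAt, mfld_simps, mfderivWithin_univ]
  rfl

set_option synthInstance.maxHeartbeats 400000 in
set_option maxHeartbeats 1000000 in
/-- The trivialization of the bundle of bilinear forms at `x₀`. -/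
abbrev homTriv (n : ℕ) {M : Type*} [TopologicalSpace M] [ChartedSpace (EuclideanSpace ℝ (Fin n)) M]
    [IsManifold (𝓡 n) ∞ M] (x₀ : M) :=
  trivializationAt (Coord n →L[ℝ] Coord n →L[ℝ] ℝ)
    (fun x : M => TangentSpace (𝓡 n) x →L[ℝ] TangentSpace (𝓡 n) x →L[ℝ] ℝ) x₀

set_option synthInstance.maxHeartbeats 400000 in
set_option maxHeartbeats 1000000 in
theorem homTriv_apply (x₀ p : M) (hp : p ∈ (chartAt (Coord n) x₀).source)
    (A : TangentSpace (𝓡 n) p →L[ℝ] TangentSpace (𝓡 n) p →L[ℝ] ℝ) (u w : Coord n) :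
    (homTriv n x₀ ⟨p, A⟩).2 u w =
      A (chartVec (chartAt (Coord n) x₀) (chartAt (Coord n) x₀ p) u)
        (chartVec (chartAt (Coord n) x₀) (chartAt (Coord n) x₀ p) w) := by
  rw [hom_trivializationAt_apply, ← trivializationAt_symm_eq x₀ p hp,
    ← trivializationAt_symm_eq x₀ p hp]
  refine (inCoordinates_apply_eq₂ (E₃ := Bundle.Trivial M ℝ) (by simpa using hp)
    (by simpa using hp) (by simp)).trans ?_
  simp

set_option synthInstance.maxHeartbeats 400000 in
set_option maxHeartbeats 1000000 in
theorem mem_homTriv_baseSet (x₀ p : M) :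
    p ∈ (homTriv n x₀).baseSet ↔ p ∈ (chartAt (Coord n) x₀).source := by
  simp [hom_trivializationAt_baseSet]

set_option synthInstance.maxHeartbeats 400000 in
set_option maxHeartbeats 1000000 in
theorem gram_eq_homTriv (h : BilinField n M) (x₀ : M) {y : Coord n}
    (hy : y ∈ (chartAt (Coord n) x₀).target) (i j : Fin n) :
    gram h (chartAt (Coord n) x₀) y i j =
      (homTriv n x₀ ⟨(chartAt (Coord n) x₀).symm y, h ((chartAt (Coord n) x₀).symm y)⟩).2
        (stdVec i) (stdVec j) := by
  rw [homTriv_apply x₀ _ ((chartAt (Coord n) x₀).map_target hy),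
    (chartAt (Coord n) x₀).right_inv hy]
  rfl

set_option synthInstance.maxHeartbeats 400000 in
set_option maxHeartbeats 1000000 in
-- The trivialised section, evaluated on pairs of basis vectors, is exactly the matrix of
-- components.
theorem SmoothField.chartSmooth {h : BilinField n M} (hh : SmoothField h) : ChartSmooth h := by
  intro x₀ y hy i j
  set c := chartAt (Coord n) x₀ with hc
  have h1 : ContMDiffAt (𝓡 n) 𝓘(ℝ, Coord n →L[ℝ] Coord n →L[ℝ] ℝ) ∞
      (fun p : M => (homTriv n x₀ ⟨p, h p⟩).2) (c.symm y) :=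
    ((homTriv n x₀).contMDiffAt_section_iff
      ((mem_homTriv_baseSet x₀ _).2 (c.map_target hy))).1 (hh (c.symm y))
  have h2 := (h1.comp y (contMDiffAt_chart_symm x₀ hy)).contDiffAt
  have h3 : ContDiffAt ℝ ∞ (fun z => (homTriv n x₀ ⟨c.symm z, h (c.symm z)⟩).2
      (stdVec i) (stdVec j)) y :=
    (ContDiffAt.clm_apply h2 contDiffAt_const).clm_apply contDiffAt_const
  refine h3.congr_of_eventuallyEq ?_
  filter_upwards [c.open_target.mem_nhds hy] with z hz using gram_eq_homTriv h x₀ hz i j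

/-- The change of coordinates between two of the preferred charts. -/
def transition (n : ℕ) {M : Type*} [TopologicalSpace M]
    [ChartedSpace (EuclideanSpace ℝ (Fin n)) M] (x₀ x₁ : M) (z : Coord n) : Coord n :=
  chartAt (Coord n) x₁ ((chartAt (Coord n) x₀).symm z)

theorem contDiffAt_transition (x₀ x₁ : M) {y : Coord n} (hy : y ∈ (chartAt (Coord n) x₀).target)
    (hy' : (chartAt (Coord n) x₀).symm y ∈ (chartAt (Coord n) x₁).source) :
    ContDiffAt ℝ ∞ (transition n x₀ x₁) y :=
  ((contMDiffAt_chart x₁ hy').comp y (contMDiffAt_chart_symm x₀ hy)).contDiffAt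

theorem eventually_mem_transition (x₀ x₁ : M) {y : Coord n}
    (hy : y ∈ (chartAt (Coord n) x₀).target)
    (hy' : (chartAt (Coord n) x₀).symm y ∈ (chartAt (Coord n) x₁).source) :
    ∀ᶠ z in 𝓝 y, z ∈ (chartAt (Coord n) x₀).target ∧
      (chartAt (Coord n) x₀).symm z ∈ (chartAt (Coord n) x₁).source := by
  have h1 := (chartAt (Coord n) x₀).open_target.mem_nhds hy
  have h2 := ((chartAt (Coord n) x₀).continuousAt_symm hy).eventually
    ((chartAt (Coord n) x₁).open_source.mem_nhds hy')
  filter_upwards [h1, h2] with z h3 h4 using ⟨h3, h4⟩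

theorem chartVec_transition (x₀ x₁ : M) {y : Coord n} (hy : y ∈ (chartAt (Coord n) x₀).target)
    (hy' : (chartAt (Coord n) x₀).symm y ∈ (chartAt (Coord n) x₁).source) :
    chartVec (chartAt (Coord n) x₀) y = (chartVec (chartAt (Coord n) x₁) (transition n x₀ x₁ y)).comp
      (fderiv ℝ (transition n x₀ x₁) y) := by
  set φ := transition n x₀ x₁ with hφ
  have h1 : (chartAt (Coord n) x₀).symm =ᶠ[𝓝 y] (chartAt (Coord n) x₁).symm ∘ φ := by
    filter_upwards [eventually_mem_transition x₀ x₁ hy hy'] with z hz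
    exact ((chartAt (Coord n) x₁).left_inv hz.2).symm
  have ht : φ y ∈ (chartAt (Coord n) x₁).target := (chartAt (Coord n) x₁).map_source hy'
  have h2 : MDifferentiableAt (𝓡 n) (𝓡 n) (chartAt (Coord n) x₁).symm (φ y) :=
    (contMDiffAt_chart_symm x₁ ht).mdifferentiableAt (by simp)
  have h3 : DifferentiableAt ℝ φ y := (contDiffAt_transition x₀ x₁ hy hy').differentiableAt_of_smooth
  have h4 := mfderiv_comp y h2 h3.mdifferentiableAt
  rw [mfderiv_eq_fderiv] at h4
  exact h1.mfderiv_eq.trans h4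

theorem gram_transition (h : BilinField n M) (x₀ x₁ : M) {y : Coord n}
    (hy : y ∈ (chartAt (Coord n) x₀).target)
    (hy' : (chartAt (Coord n) x₀).symm y ∈ (chartAt (Coord n) x₁).source) :
    gram h (chartAt (Coord n) x₀) y = (jac (transition n x₀ x₁) y).transpose *
      gram h (chartAt (Coord n) x₁) (transition n x₀ x₁ y) * jac (transition n x₀ x₁) y := by
  set φ := transition n x₀ x₁ with hφ
  have hd : DifferentiableAt ℝ φ y := (contDiffAt_transition x₀ x₁ hy hy').differentiableAt_of_smooth
  have hv : ∀ i, chartVec (chartAt (Coord n) x₀) y (stdVec i) =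
      ∑ a, jac φ y a i • chartVec (chartAt (Coord n) x₁) (φ y) (stdVec a) := by
    intro i
    rw [chartVec_transition x₀ x₁ hy hy', ContinuousLinearMap.comp_apply]
    conv_lhs => rw [← sum_smul_stdVec (fderiv ℝ (transition n x₀ x₁) y (stdVec i))]
    rw [map_sum]
    refine Finset.sum_congr rfl fun a _ => ?_
    rw [map_smul]
    congr 1
    have := ((EuclideanSpace.proj (𝕜 := ℝ) a).hasFDerivAt.comp y hd.hasFDerivAt).fderiv
    exact (congrArg (fun L => L (stdVec i)) this).symm
  have hp : (chartAt (Coord n) x₁).symm (φ y) = (chartAt (Coord n) x₀).symm y :=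
    (chartAt (Coord n) x₁).left_inv hy'
  ext i j
  rw [gram_apply, hv, hv, Matrix.mul_apply]
  simp only [map_sum, map_smul, _root_.sum_apply, _root_.smul_apply, smul_eq_mul,
    Matrix.mul_apply, Matrix.transpose_apply, Finset.sum_mul, Finset.mul_sum]
  rw [← hp]
  refine Finset.sum_congr rfl fun b _ => Finset.sum_congr rfl fun a _ => ?_
  rw [gram_apply]; ring

theorem chartVec_injective (x₀ : M) {y : Coord n} (hy : y ∈ (chartAt (Coord n) x₀).target) :
    Function.Injective (chartVec (chartAt (Coord n) x₀) y) := by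
  set c := chartAt (Coord n) x₀ with hc
  have h1 : MDifferentiableAt (𝓡 n) (𝓡 n) c.symm y :=
    (contMDiffAt_chart_symm x₀ hy).mdifferentiableAt (by simp)
  have h2 : MDifferentiableAt (𝓡 n) (𝓡 n) c (c.symm y) :=
    (contMDiffAt_chart x₀ (c.map_target hy)).mdifferentiableAt (by simp)
  have h3 := mfderiv_comp y h2 h1
  have h4 : c ∘ c.symm =ᶠ[𝓝 y] id := by
    filter_upwards [c.open_target.mem_nhds hy] with z hz using c.right_inv hz
  rw [h4.mfderiv_eq, mfderiv_id] at h3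
  intro u w huw
  have h5 := congrArg (fun L => L u) h3
  have h6 := congrArg (fun L => L w) h3
  have h7 : (mfderiv (𝓡 n) (𝓡 n) c (c.symm y)) (chartVec c y u) =
    (mfderiv (𝓡 n) (𝓡 n) c (c.symm y)) (chartVec c y w) := by rw [huw]
  exact h5.trans (h7.trans h6.symm)

theorem gram_posDef (g : Metric n M) (x₀ : M) {y : Coord n}
    (hy : y ∈ (chartAt (Coord n) x₀).target) :
    (gram g.inner (chartAt (Coord n) x₀) y).PosDef := by
  refine Matrix.PosDef.of_dotProduct_mulVec_pos ?_ ?_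
  · rw [Matrix.IsHermitian, Matrix.conjTranspose_eq_transpose_of_trivial]
    exact gram_transpose g.symm _ y
  · intro x hx
    set v := chartVec (chartAt (Coord n) x₀) y (WithLp.toLp 2 x) with hv
    have hv0 : v ≠ 0 := by
      intro h0
      have : WithLp.toLp 2 x = 0 := chartVec_injective x₀ hy (h0.trans (map_zero _).symm)
      exact hx (by simpa using this)
    have hpos : 0 < evalAt g.inner ((chartAt (Coord n) x₀).symm y) v v := g.pos _ v hv0
    have e : v = ∑ i, x i • chartVec (chartAt (Coord n) x₀) y (stdVec i) := by
      rw [hv]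
      conv_lhs => rw [← sum_smul_stdVec (WithLp.toLp 2 x)]
      simp only [map_sum, map_smul]
    have e2 : dotProduct (star x) ((gram g.inner (chartAt (Coord n) x₀) y).mulVec x) =
        evalAt g.inner ((chartAt (Coord n) x₀).symm y) v v := by
      rw [e]
      simp only [map_sum, map_smul, _root_.sum_apply, _root_.smul_apply, smul_eq_mul,
        dotProduct, Matrix.mulVec, gram_apply, Finset.mul_sum, Pi.star_apply, star_trivial]
      rw [Finset.sum_comm]
      refine Finset.sum_congr rfl fun i _ => Finset.sum_congr rfl fun j _ => ?_
      ring
    rw [e2]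
    exact hpos

theorem isMetricAt_gram {h : BilinField n M} (hh : ChartSmooth h)
    (hs : ∀ (x : M) (v w : TangentSpace (𝓡 n) x), h x v w = h x w v)
    (x₀ : M) {y : Coord n} (hy : y ∈ (chartAt (Coord n) x₀).target)
    (hdet : (gram h (chartAt (Coord n) x₀) y).det ≠ 0) :
    ∀ᶠ z in 𝓝 y, IsMetricAt (gram h (chartAt (Coord n) x₀)) z := by
  filter_upwards [(chartAt (Coord n) x₀).open_target.mem_nhds hy,
    (hh x₀ y hy).eventually_det_ne hdet] with z hz hz'
  exact ⟨hh x₀ z hz, Filter.Eventually.of_forall fun w => gram_transpose hs _ w, hz'⟩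

/-- Each value of `scalarCurvature` uses its own chart, and invariance moves it to a fixed one.
Requiring only symmetry and nondegeneracy lets this apply to g + th before positivity is discussed.
-/
theorem scalarCurvature_chart {h : BilinField n M} (hh : ChartSmooth h)
    (hs : ∀ (x : M) (v w : TangentSpace (𝓡 n) x), h x v w = h x w v)
    (x₀ : M) {y : Coord n} (hy : y ∈ (chartAt (Coord n) x₀).target)
    (hdet : (gram h (chartAt (Coord n) x₀) y).det ≠ 0) :
    scalarCurvature h ((chartAt (Coord n) x₀).symm y) =
      scalarCoord (gram h (chartAt (Coord n) x₀)) y := by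
  set p := (chartAt (Coord n) x₀).symm y with hp
  have hy' : p ∈ (chartAt (Coord n) p).source := mem_chart_source _ p
  have ht : transition n x₀ p y ∈ (chartAt (Coord n) p).target :=
    (chartAt (Coord n) p).map_source hy'
  have hdet' : (gram h (chartAt (Coord n) p) (transition n x₀ p y)).det ≠ 0 := by
    rw [gram_transition h x₀ p hy hy', Matrix.det_mul, Matrix.det_mul] at hdet
    exact right_ne_zero_of_mul (left_ne_zero_of_mul hdet)
  have hev := eventually_mem_transition x₀ p hy hy'
  exact (scalarCoord_change (isMetricAt_gram hh hs x₀ hy hdet) (isMetricAt_gram hh hs p ht hdet')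
    (hev.mono fun z hz => contDiffAt_transition x₀ p hz.1 hz.2)
    (hev.mono fun z hz => gram_transition h x₀ p hz.1 hz.2)).symm

end Charts


/-! ### The Riemannian volume inside one chart. -/

section Volume

theorem measurableSet_inter_preimage_of_continuousOn {X Y : Type*} [TopologicalSpace X]
    [MeasurableSpace X] [BorelSpace X] [TopologicalSpace Y] [MeasurableSpace Y] [BorelSpace Y]
    {s : Set X} (hs : MeasurableSet s) {f : X → Y} (hf : ContinuousOn f s) {A : Set Y}
    (hA : MeasurableSet A) : MeasurableSet (s ∩ f ⁻¹' A) := by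
  have h1 : MeasurableSet {z : s | f z ∈ A} :=
    (continuousOn_iff_continuous_domRestrict.1 hf).measurable hA
  have h2 := hs.subtype_image h1
  convert h2 using 1
  ext z
  simp [and_comm]

theorem det_fderiv_eq_jac {n : ℕ} {φ : Coord n → Coord n} {y : Coord n}
    (hφ : DifferentiableAt ℝ φ y) : (fderiv ℝ φ y).det = (jac φ y).det := by
  rw [ContinuousLinearMap.det, ← LinearMap.det_toMatrix (EuclideanSpace.basisFun (Fin n) ℝ).toBasis]
  congr 1
  ext a i
  rw [LinearMap.toMatrix_apply, jac_apply]
  have := ((EuclideanSpace.proj (𝕜 := ℝ) a).hasFDerivAt.comp y hφ.hasFDerivAt).fderiv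
  have h2 := congrArg (fun L => L (stdVec i)) this
  simpa [stdVec, pd, Function.comp_def] using h2.symm

variable {n : ℕ} {M : Type*} [TopologicalSpace M] [ChartedSpace (EuclideanSpace ℝ (Fin n)) M]

/-- The density of the Riemannian volume in a chart. -/
def chartDensity (h : BilinField n M) (c : OpenPartialHomeomorph M (Coord n)) (y : Coord n) :
    ENNReal := ENNReal.ofReal (Real.sqrt (gram h c y).det)

variable [MeasurableSpace M] [BorelSpace M]

theorem aemeasurable_chart_symm (h : BilinField n M) (c : OpenPartialHomeomorph M (Coord n)) :
    AEMeasurable c.symm ((volume.restrict c.target).withDensity (chartDensity h c)) :=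
  AEMeasurable.mono_ac (c.continuousOn_symm.aemeasurable c.open_target.measurableSet)
    (withDensity_absolutelyContinuous _ _)

theorem measurableSet_target_inter (c : OpenPartialHomeomorph M (Coord n)) {A : Set M}
    (hA : MeasurableSet A) : MeasurableSet (c.target ∩ c.symm ⁻¹' A) :=
  measurableSet_inter_preimage_of_continuousOn c.open_target.measurableSet c.continuousOn_symm hA

theorem chartVolume_apply (h : BilinField n M) (c : OpenPartialHomeomorph M (Coord n)) {A : Set M}
    (hA : MeasurableSet A) :
    chartVolume h c A = ∫⁻ y in c.target ∩ c.symm ⁻¹' A, chartDensity h c y := by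
  change (((volume.restrict c.target).withDensity (chartDensity h c)).map c.symm) A = _
  rw [Measure.map_apply_of_aemeasurable (aemeasurable_chart_symm h c) hA]
  have h1 : NullMeasurableSet (c.symm ⁻¹' A) (volume.restrict c.target) :=
    (c.continuousOn_symm.aemeasurable c.open_target.measurableSet).nullMeasurable hA
  rw [withDensity_apply₀ _ h1, Measure.restrict_restrict₀ h1, Set.inter_comm]

theorem chartVolume_inter_source (h : BilinField n M) (c : OpenPartialHomeomorph M (Coord n))
    {A : Set M} (hA : MeasurableSet A) :
    chartVolume h c A = chartVolume h c (A ∩ c.source) := by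
  rw [chartVolume_apply h c hA, chartVolume_apply h c (hA.inter c.open_source.measurableSet)]
  congr 2
  ext z
  constructor
  · rintro ⟨h1, h2⟩
    exact ⟨h1, h2, c.map_target h1⟩
  · rintro ⟨h1, h2, -⟩
    exact ⟨h1, h2⟩

variable [IsManifold (𝓡 n) ∞ M]

/-- Change of variables: the determinant of the components scales by (det J)², whose root is the
Jacobian factor |det J|. Positivity of the form plays no role. -/
theorem chartVolume_eq_of_subset (h : BilinField n M) (x₀ x₁ : M) {A : Set M}
    (hA : MeasurableSet A) (h0 : A ⊆ (chartAt (Coord n) x₀).source)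
    (h1 : A ⊆ (chartAt (Coord n) x₁).source) :
    chartVolume h (chartAt (Coord n) x₀) A = chartVolume h (chartAt (Coord n) x₁) A := by
  set c := chartAt (Coord n) x₀ with hc
  set c' := chartAt (Coord n) x₁ with hc'
  set φ := transition n x₀ x₁ with hφ
  set B := c.target ∩ c.symm ⁻¹' A with hB
  have hBm : MeasurableSet B := measurableSet_target_inter c hA
  have himg : c'.target ∩ c'.symm ⁻¹' A = φ '' B := by
    ext z
    constructor
    · rintro ⟨hz, hz'⟩
      refine ⟨c (c'.symm z), ⟨c.map_source (h0 hz'), ?_⟩, ?_⟩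
      · simpa [c.left_inv (h0 hz')] using hz'
      · change c' (c.symm (c (c'.symm z))) = z
        rw [c.left_inv (h0 hz'), c'.right_inv hz]
    · rintro ⟨w, ⟨hw, hw'⟩, rfl⟩
      refine ⟨c'.map_source (h1 hw'), ?_⟩
      change c'.symm (c' (c.symm w)) ∈ A
      rwa [c'.left_inv (h1 hw')]
  have hinj : Set.InjOn φ B := by
    intro z hz w hw hzw
    exact c.symm.injOn hz.1 hw.1 (c'.injOn (h1 hz.2) (h1 hw.2) hzw)
  have hd : ∀ y ∈ B, DifferentiableAt ℝ φ y := fun y hy =>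
    (contDiffAt_transition x₀ x₁ hy.1 (h1 hy.2)).differentiableAt_of_smooth
  rw [chartVolume_apply h c hA, chartVolume_apply h c' hA, himg,
    lintegral_image_eq_lintegral_abs_det_fderiv_mul volume hBm
      (fun y hy => (hd y hy).hasFDerivAt.hasFDerivWithinAt) hinj]
  refine setLIntegral_congr_fun hBm fun y hy => ?_
  simp only [chartDensity]
  rw [gram_transition h x₀ x₁ hy.1 (h1 hy.2), Matrix.det_mul, Matrix.det_mul,
    Matrix.det_transpose, det_fderiv_eq_jac (hd y hy), ← ENNReal.ofReal_mul (abs_nonneg _)]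
  congr 1
  rw [mul_right_comm, ← pow_two, Real.sqrt_mul (sq_nonneg _), Real.sqrt_sq_eq_abs]

theorem riemannianVolume_apply_of_subset (h : BilinField n M) (x₀ : M) {A : Set M}
    (hA : MeasurableSet A) (h0 : A ⊆ (chartAt (Coord n) x₀).source) :
    riemannianVolume h A = chartVolume h (chartAt (Coord n) x₀) A := by
  set c := chartAt (Coord n) x₀ with hc
  have hs : MeasurableSet c.source := c.open_source.measurableSet
  refine le_antisymm ?_ ((le_iSup (fun x : M => chartVolume h (chartAt (Coord n) x)) x₀) A)
  -- A supremum of measures is not computed set by set, so a single measure dominating all chart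
  -- volumes is exhibited. Inside the domain of `c` the charts agree with `c`; outside, the supremum
  -- bounds itself.
  have hle : riemannianVolume h ≤ chartVolume h c + (riemannianVolume h).restrict c.sourceᶜ := by
    refine iSup_le fun x => Measure.le_iff.2 fun B hB => ?_
    rw [← measure_inter_add_sdiff B hs, Measure.add_apply, Measure.restrict_apply hB]
    refine add_le_add ?_ ((le_iSup (fun x : M => chartVolume h (chartAt (Coord n) x)) x) _)
    rw [chartVolume_inter_source h (chartAt (Coord n) x) (hB.inter hs),
      chartVolume_eq_of_subset h x x₀
        ((hB.inter hs).inter (chartAt (Coord n) x).open_source.measurableSet)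
        Set.inter_subset_right (Set.inter_subset_left.trans Set.inter_subset_right)]
    exact measure_mono (Set.inter_subset_left.trans Set.inter_subset_left)
  refine (hle A).trans_eq ?_
  rw [Measure.add_apply, Measure.restrict_apply hA]
  have : A ∩ c.sourceᶜ = ∅ := by
    ext z
    simp only [Set.mem_inter_iff, Set.mem_compl_iff, Set.mem_empty_iff_false, iff_false, not_and,
      not_not]
    exact fun hz => h0 hz
  simp [this]

theorem setIntegral_riemannianVolume [T2Space M] [SecondCountableTopology M]
    {h : BilinField n M} (hh : ChartSmooth h) (x₀ : M)
    {T : Set (Coord n)} (hT : IsCompact T) (hTt : T ⊆ (chartAt (Coord n) x₀).target) {F : M → ℝ}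
    (hF : ContinuousOn F ((chartAt (Coord n) x₀).symm '' T)) :
    ∫ x in (chartAt (Coord n) x₀).symm '' T, F x ∂(riemannianVolume h) =
      ∫ y in T, F ((chartAt (Coord n) x₀).symm y) *
        Real.sqrt (gram h (chartAt (Coord n) x₀) y).det := by
  set c := chartAt (Coord n) x₀ with hc
  set K := c.symm '' T with hK
  have hKc : IsCompact K := hT.image_of_continuousOn (c.continuousOn_symm.mono hTt)
  have hKm : MeasurableSet K := hKc.isClosed.measurableSet
  have hKs : K ⊆ c.source := by
    rintro _ ⟨y, hy, rfl⟩
    exact c.map_target (hTt hy)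
  have hpre : ∀ y ∈ c.target, (c.symm y ∈ K ↔ y ∈ T) := by
    intro y hy
    constructor
    · rintro ⟨z, hz, hzy⟩
      rwa [← c.symm.injOn (hTt hz) hy hzy]
    · exact fun hy' => ⟨y, hy', rfl⟩
  have hr : (riemannianVolume h).restrict K = (chartVolume h c).restrict K := by
    ext A hA
    rw [Measure.restrict_apply hA, Measure.restrict_apply hA]
    exact riemannianVolume_apply_of_subset h x₀ (hA.inter hKm)
      (Set.inter_subset_right.trans hKs)
  rw [hr, ← integral_indicator hKm]
  have hFm : AEStronglyMeasurable (K.indicator F) (chartVolume h c) :=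
    (aestronglyMeasurable_indicator_iff hKm).2 (hF.aestronglyMeasurable hKm)
  change ∫ x, K.indicator F x ∂(((volume.restrict c.target).withDensity
    (chartDensity h c)).map c.symm) = _
  rw [integral_map (aemeasurable_chart_symm h c) hFm]
  have hdm : AEMeasurable (chartDensity h c) (volume.restrict c.target) := by
    have : ContinuousOn (fun y => Real.sqrt (gram h c y).det) c.target := fun y hy =>
      (Real.continuous_sqrt.continuousAt.comp (hh x₀ y hy).det.continuousAt).continuousWithinAt
    exact (this.aemeasurable c.open_target.measurableSet).ennreal_ofReal
  rw [integral_withDensity_eq_integral_toReal_smul₀ hdm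
    (Filter.Eventually.of_forall fun _ => ENNReal.ofReal_lt_top)]
  have hTm : MeasurableSet T := hT.isClosed.measurableSet
  calc ∫ y in c.target, (chartDensity h c y).toReal • K.indicator F (c.symm y)
      = ∫ y in c.target, T.indicator (fun y => F (c.symm y) * Real.sqrt (gram h c y).det) y := by
        refine setIntegral_congr_fun c.open_target.measurableSet fun y hy => ?_
        by_cases hy' : y ∈ T
        · simp only [Set.indicator_of_mem hy', Set.indicator_of_mem ((hpre y hy).2 hy'),
            chartDensity, ENNReal.toReal_ofReal (Real.sqrt_nonneg _), smul_eq_mul]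
          ring
        · have : c.symm y ∉ K := fun h' => hy' ((hpre y hy).1 h')
          simp only [Set.indicator_of_notMem hy', Set.indicator_of_notMem this, smul_zero]
    _ = _ := by
        rw [setIntegral_indicator hTm, Set.inter_eq_right.2 hTt]

end Volume


/-! ### Test variations supported in a chart, and the equation on the manifold. -/

section Bump

theorem contDiff_smul_vec {E F : Type*} [NormedAddCommGroup E] [NormedSpace ℝ E]
    [NormedAddCommGroup F] [NormedSpace ℝ F] {η : E → ℝ} (hη : ContDiff ℝ ∞ η) (v : F) :
    ContDiff ℝ ∞ fun z => η z • v := hη.smul contDiff_const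

/-- The bilinear form with matrix `S`. -/
def matBilin {n : ℕ} (S : Matrix (Fin n) (Fin n) ℝ) : Coord n →L[ℝ] Coord n →L[ℝ] ℝ :=
  ∑ i, ∑ j, S i j • (EuclideanSpace.proj i : Coord n →L[ℝ] ℝ).smulRight
    (EuclideanSpace.proj j : Coord n →L[ℝ] ℝ)

theorem matBilin_apply {n : ℕ} (S : Matrix (Fin n) (Fin n) ℝ) (u w : Coord n) :
    matBilin S u w = ∑ i, ∑ j, S i j * (u i * w j) := by
  simp [matBilin]

theorem matBilin_stdVec {n : ℕ} (S : Matrix (Fin n) (Fin n) ℝ) (k l : Fin n) :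
    matBilin S (stdVec k) (stdVec l) = S k l := by
  simp [matBilin_apply, stdVec]

theorem matBilin_comm {n : ℕ} {S : Matrix (Fin n) (Fin n) ℝ} (hS : S.transpose = S)
    (u w : Coord n) : matBilin S u w = matBilin S w u := by
  rw [matBilin_apply, matBilin_apply, Finset.sum_comm]
  refine Finset.sum_congr rfl fun i _ => Finset.sum_congr rfl fun j _ => ?_
  rw [← Matrix.transpose_apply S, hS]
  ring

variable {n : ℕ} {M : Type*} [TopologicalSpace M] [ChartedSpace (EuclideanSpace ℝ (Fin n)) M]

/-- The differential of a chart. -/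
def chartCovec (c : OpenPartialHomeomorph M (Coord n)) (p : M) : Coord n →L[ℝ] Coord n :=
  mfderiv (𝓡 n) (𝓡 n) c p

/-- The field of bilinear forms with components `η S` in the chart `c`, extended by zero. -/
def bumpField (c : OpenPartialHomeomorph M (Coord n)) (η : Coord n → ℝ)
    (S : Matrix (Fin n) (Fin n) ℝ) : BilinField n M := fun p =>
  (c.source.indicator (η ∘ c) p •
    (matBilin S).bilinearComp (chartCovec c p) (chartCovec c p) :
      Coord n →L[ℝ] Coord n →L[ℝ] ℝ)

theorem bumpField_symm (c : OpenPartialHomeomorph M (Coord n)) (η : Coord n → ℝ)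
    {S : Matrix (Fin n) (Fin n) ℝ} (hS : S.transpose = S) (x : M) (v w : TangentSpace (𝓡 n) x) :
    bumpField c η S x v w = bumpField c η S x w v :=
  congrArg _ (matBilin_comm hS _ _)

theorem bumpField_eq_zero (c : OpenPartialHomeomorph M (Coord n)) (η : Coord n → ℝ)
    (S : Matrix (Fin n) (Fin n) ℝ) {x : M} (hx : x ∉ c.symm '' tsupport η) :
    bumpField c η S x = 0 := by
  have h1 : c.source.indicator (η ∘ c) x = 0 := by
    refine Set.indicator_apply_eq_zero.2 fun h => ?_
    by_contra h2
    exact hx ⟨c x, subset_tsupport η h2, c.left_inv h⟩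
  unfold bumpField
  rw [h1]
  exact zero_smul ℝ ((matBilin S).bilinearComp (chartCovec c x) (chartCovec c x))

variable [IsManifold (𝓡 n) ∞ M]

theorem chartCovec_chartVec (x₀ : M) {y : Coord n} (hy : y ∈ (chartAt (Coord n) x₀).target)
    (u : Coord n) :
    chartCovec (chartAt (Coord n) x₀) ((chartAt (Coord n) x₀).symm y)
      (chartVec (chartAt (Coord n) x₀) y u) = u := by
  set c := chartAt (Coord n) x₀ with hc
  have h1 : MDifferentiableAt (𝓡 n) (𝓡 n) c.symm y :=
    (contMDiffAt_chart_symm x₀ hy).mdifferentiableAt (by simp)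
  have h2 : MDifferentiableAt (𝓡 n) (𝓡 n) c (c.symm y) :=
    (contMDiffAt_chart x₀ (c.map_target hy)).mdifferentiableAt (by simp)
  have h3 := mfderiv_comp y h2 h1
  have h4 : c ∘ c.symm =ᶠ[𝓝 y] id := by
    filter_upwards [c.open_target.mem_nhds hy] with z hz using c.right_inv hz
  rw [h4.mfderiv_eq, mfderiv_id] at h3
  exact (congrArg (fun L => L u) h3).symm

theorem bumpField_chartVec (x₀ : M) (η : Coord n → ℝ) (S : Matrix (Fin n) (Fin n) ℝ) {y : Coord n}
    (hy : y ∈ (chartAt (Coord n) x₀).target) (u w : Coord n) :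
    evalAt (bumpField (chartAt (Coord n) x₀) η S) ((chartAt (Coord n) x₀).symm y)
      (chartVec (chartAt (Coord n) x₀) y u) (chartVec (chartAt (Coord n) x₀) y w) =
      η y * matBilin S u w := by
  have h1 := (chartAt (Coord n) x₀).map_target hy
  have h2 := chartCovec_chartVec x₀ hy
  change Set.indicator _ _ _ * matBilin S
    (chartCovec (chartAt (Coord n) x₀) ((chartAt (Coord n) x₀).symm y)
      (chartVec (chartAt (Coord n) x₀) y u))
    (chartCovec (chartAt (Coord n) x₀) ((chartAt (Coord n) x₀).symm y)
      (chartVec (chartAt (Coord n) x₀) y w)) = _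
  rw [Set.indicator_of_mem h1, Function.comp_apply, (chartAt (Coord n) x₀).right_inv hy, h2, h2]

theorem gram_bumpField (x₀ : M) (η : Coord n → ℝ) (S : Matrix (Fin n) (Fin n) ℝ) {y : Coord n}
    (hy : y ∈ (chartAt (Coord n) x₀).target) :
    gram (bumpField (chartAt (Coord n) x₀) η S) (chartAt (Coord n) x₀) y = η y • S := by
  ext i j
  rw [gram_apply, bumpField_chartVec x₀ η S hy, matBilin_stdVec]
  rfl

set_option synthInstance.maxHeartbeats 400000 in
set_option maxHeartbeats 1000000 in
-- In the chart domain the trivialised field is η times a constant form. Elsewhere it vanishes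
-- nearby, because the image of the support is compact and hence closed; this is where the Hausdorff
-- property enters.
theorem smoothField_bumpField [T2Space M] (x₀ : M) {η : Coord n → ℝ} (hη : ContDiff ℝ ∞ η)
    (hc : HasCompactSupport η) (ht : tsupport η ⊆ (chartAt (Coord n) x₀).target)
    (S : Matrix (Fin n) (Fin n) ℝ) :
    SmoothField (bumpField (chartAt (Coord n) x₀) η S) := by
  set c := chartAt (Coord n) x₀ with hcdef
  intro p
  by_cases hp : p ∈ c.source
  · refine ((homTriv n x₀).contMDiffAt_section_iff ((mem_homTriv_baseSet x₀ p).2 hp)).2 ?_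
    have h1 : ContMDiffAt (𝓡 n) 𝓘(ℝ, Coord n →L[ℝ] Coord n →L[ℝ] ℝ) ∞
        (fun q => η (c q) • matBilin S) p := by
      have h2 : ContDiff ℝ ∞ fun z : Coord n => η z • matBilin S :=
        contDiff_smul_vec hη _
      exact h2.contDiffAt.contMDiffAt.comp p (contMDiffAt_chart x₀ hp)
    refine h1.congr_of_eventuallyEq ?_
    filter_upwards [c.open_source.mem_nhds hp] with q hq
    ext u w
    rw [homTriv_apply x₀ q hq]
    have h3 := bumpField_chartVec x₀ η S (c.map_source hq) u w
    rw [← hcdef, c.left_inv hq] at h3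
    exact h3
  · have hK : IsClosed (c.symm '' tsupport η) :=
      (hc.isCompact.image_of_continuousOn (c.continuousOn_symm.mono ht)).isClosed
    have hpK : p ∉ c.symm '' tsupport η := by
      rintro ⟨y, hy, rfl⟩
      exact hp (c.map_target (ht hy))
    refine ((homTriv n p).contMDiffAt_section_iff
      ((mem_homTriv_baseSet p p).2 (mem_chart_source _ p))).2 ?_
    have h1 : ContMDiffAt (𝓡 n) 𝓘(ℝ, Coord n →L[ℝ] Coord n →L[ℝ] ℝ) ∞
        (fun _ : M => (0 : Coord n →L[ℝ] Coord n →L[ℝ] ℝ)) p := contMDiffAt_const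
    refine h1.congr_of_eventuallyEq ?_
    filter_upwards [(chartAt (Coord n) p).open_source.mem_nhds (mem_chart_source _ p),
      hK.isOpen_compl.mem_nhds hpK] with q hq hq'
    ext u w
    rw [homTriv_apply p q hq, bumpField_eq_zero c η S hq']
    rfl

/-- Criticality is tested on the fields `bumpField`, with K the image of the support; for small t
the integral over K equals the coordinate integral. -/
theorem gradS2_gram_eq_zero [T2Space M] [SecondCountableTopology M] [MeasurableSpace M]
    [BorelSpace M] {g : Metric n M} (hcrit : IsCritical g) (x₀ : M) :
    ∀ y ∈ (chartAt (Coord n) x₀).target, ∀ i j,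
      gradS2 (gram g.inner (chartAt (Coord n) x₀)) i j y = 0 := by
  set c := chartAt (Coord n) x₀ with hc
  have hgs : ChartSmooth g.inner := SmoothField.chartSmooth g.contMDiff
  have hpos : ∀ y ∈ c.target, 0 < (gram g.inner c y).det := fun y hy =>
    (gram_posDef g x₀ hy).det_pos
  refine gradS2_eq_zero c.open_target (fun y hy =>
    (isMetricAt_gram hgs g.symm x₀ hy (hpos y hy).ne').self_of_nhds) hpos ?_
  intro η hη hcs hts S hS
  set h := bumpField c η S with hh
  have hsm : SmoothField h := smoothField_bumpField x₀ hη hcs hts S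
  have hhs : ChartSmooth h := hsm.chartSmooth
  have hK : IsCompact (c.symm '' tsupport η) :=
    hcs.isCompact.image_of_continuousOn (c.continuousOn_symm.mono hts)
  have key := hcrit _ hK h hsm (bumpField_symm c η hS) (fun x hx => bumpField_eq_zero c η S hx)
  refine key.congr_of_eventuallyEq ?_
  -- Compactness of the support makes nondegeneracy of g + th uniform in y for small t.
  have hev : ∀ᶠ t : ℝ in 𝓝 0, ∀ y ∈ tsupport η,
      (varG (gram g.inner c) (gram h c) t y).det ≠ 0 := by
    refine hcs.isCompact.eventually_forall_of_forall_eventually fun y hy => ?_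
    have h1 : ContinuousAt (fun z : ℝ × Coord n =>
        (varG (gram g.inner c) (gram h c) z.1 z.2).det) (0, y) := by
      refine ContinuousAt.comp (g := Matrix.det) (continuous_id.matrix_det).continuousAt ?_
      refine continuousAt_pi.2 fun i => continuousAt_pi.2 fun j => ?_
      have a1 : ContinuousAt (fun z : ℝ × Coord n => gram g.inner c z.2 i j) (0, y) :=
        ContinuousAt.comp (f := Prod.snd) (x := ((0 : ℝ), y)) (hgs x₀ y (hts hy) i j).continuousAt
          continuousAt_snd
      have a2 : ContinuousAt (fun z : ℝ × Coord n => gram h c z.2 i j) (0, y) :=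
        ContinuousAt.comp (f := Prod.snd) (x := ((0 : ℝ), y)) (hhs x₀ y (hts hy) i j).continuousAt
          continuousAt_snd
      exact a1.add (continuousAt_fst.mul a2)
    refine h1.eventually_ne ?_
    simpa [varG] using (hpos y (hts hy)).ne'
  filter_upwards [hev] with t ht
  have hvs : ChartSmooth fun p => g.inner p + t • h p := hgs.variation hhs t
  have hvsymm : ∀ (x : M) (v w : TangentSpace (𝓡 n) x),
      (g.inner x + t • h x) v w = (g.inner x + t • h x) w v := fun x v w =>
    congrArg₂ (fun a b : ℝ => a + t * b) (g.symm x v w) (bumpField_symm c η hS x v w)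
  have hsc : ∀ y ∈ tsupport η, scalarCurvature (fun p => g.inner p + t • h p) (c.symm y) =
      scalarCoord (varG (gram g.inner c) (gram h c) t) y := fun y hy =>
    scalarCurvature_chart hvs hvsymm x₀ (hts hy) (ht y hy)
  have hcont : ContinuousOn (fun x => scalarCurvature (fun p => g.inner p + t • h p) x ^ 2)
      (c.symm '' tsupport η) := by
    have h1 : ContinuousOn (fun x => scalarCoord (varG (gram g.inner c) (gram h c) t) (c x) ^ 2)
        (c.symm '' tsupport η) := by
      rintro _ ⟨y, hy, rfl⟩
      have h2 : ContinuousAt (scalarCoord (varG (gram g.inner c) (gram h c) t)) (c (c.symm y)) := by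
        rw [c.right_inv (hts hy)]
        exact (contDiffAt_scalarCoord (hvs x₀ y (hts hy)) (ht y hy)).continuousAt
      exact ((h2.comp (c.continuousAt (c.map_target (hts hy)))).pow 2).continuousWithinAt
    refine h1.congr ?_
    rintro _ ⟨y, hy, rfl⟩
    simp only
    rw [hsc y hy, c.right_inv (hts hy)]
  rw [setIntegral_riemannianVolume hvs x₀ hcs.isCompact hts hcont]
  refine setIntegral_congr_fun (isClosed_tsupport η).measurableSet fun y hy => ?_
  -- The components of the bump field are known only on the chart's target; equality of germs
  -- suffices for curvature.
  have hG : varG (gram g.inner c) (fun z => η z • S) t =ᶠ[𝓝 y]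
      varG (gram g.inner c) (gram h c) t := by
    filter_upwards [c.open_target.mem_nhds (hts hy)] with z hz
    simp only [varG]
    rw [hh, gram_bumpField x₀ η S hz]
  rw [hsc y hy, scalarCoord_congr hG, hG.self_of_nhds, gram_variation]

end Bump


/-! ### The conformal metric on the manifold. -/

section Conformal

variable {n : ℕ} {M : Type*} [TopologicalSpace M] [ChartedSpace (EuclideanSpace ℝ (Fin n)) M]
  [IsManifold (𝓡 n) ∞ M]

set_option synthInstance.maxHeartbeats 400000 in
set_option maxHeartbeats 1000000 in
/-- The conformal metric `a g`, for a positive function `a`. -/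
def conformalMetric (g : Metric n M) (a : M → ℝ) (ha : ContMDiff (𝓡 n) 𝓘(ℝ, ℝ) ∞ a)
    (hpos : ∀ x, 0 < a x) : Metric n M where
  inner x := a x • g.inner x
  symm x v w := congrArg (fun b : ℝ => a x * b) (g.symm x v w)
  pos x v hv := mul_pos (hpos x) (g.pos x v hv)
  isVonNBounded x := by
    -- The unit ball of a·g lies in the image of that of g under scaling by a^{-1/2}.
    have h1 := (g.isVonNBounded x).image
      ((Real.sqrt (a x))⁻¹ • ContinuousLinearMap.id ℝ (TangentSpace (𝓡 n) x))
    have hs : Real.sqrt (a x) ≠ 0 := (Real.sqrt_pos.2 (hpos x)).ne'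
    refine Bornology.IsVonNBounded.subset (fun v hv => ?_) h1
    refine ⟨Real.sqrt (a x) • v, ?_, ?_⟩
    · have hv' : a x * g.inner x v v < 1 := hv
      have h2 : g.inner x (Real.sqrt (a x) • v) (Real.sqrt (a x) • v) = a x * g.inner x v v := by
        rw [map_smul, map_smul, _root_.smul_apply, smul_eq_mul, smul_eq_mul, ← mul_assoc,
          Real.mul_self_sqrt (hpos x).le]
      change g.inner x (Real.sqrt (a x) • v) (Real.sqrt (a x) • v) < 1
      rwa [h2]
    · change (Real.sqrt (a x))⁻¹ • (Real.sqrt (a x) • v) = v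
      rw [smul_smul, inv_mul_cancel₀ hs, one_smul]
  contMDiff := ha.smul_section g.contMDiff

theorem contMDiff_scalarCurvature (g : Metric n M) :
    ContMDiff (𝓡 n) 𝓘(ℝ, ℝ) ∞ (scalarCurvature g.inner) := by
  intro x
  set c := chartAt (Coord n) x with hc
  have hx : x ∈ c.source := mem_chart_source _ x
  have hgs : ChartSmooth g.inner := SmoothField.chartSmooth g.contMDiff
  have h1 : ContDiffAt ℝ ∞ (scalarCoord (gram g.inner c)) (c x) :=
    contDiffAt_scalarCoord (hgs x _ (c.map_source hx)) (gram_posDef g x (c.map_source hx)).det_pos.ne'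
  refine (h1.contMDiffAt.comp x (contMDiffAt_chart x hx)).congr_of_eventuallyEq ?_
  filter_upwards [c.open_source.mem_nhds hx] with p hp
  have h2 := scalarCurvature_chart hgs g.symm x (c.map_source hp)
    (gram_posDef g x (c.map_source hp)).det_pos.ne'
  rwa [← hc, c.left_inv hp] at h2

theorem contMDiff_const_mul_log {R : M → ℝ} (hR : ContMDiff (𝓡 n) 𝓘(ℝ, ℝ) ∞ R)
    (h0 : ∀ x, R x ≠ 0) (k : ℝ) :
    ContMDiff (𝓡 n) 𝓘(ℝ, ℝ) ∞ fun x => k * Real.log |R x| := by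
  intro x
  have h1 : ContDiffAt ℝ ∞ (fun s : ℝ => k * Real.log |s|) (R x) := by
    simp only [Real.log_abs]
    exact contDiffAt_const.mul (Real.contDiffAt_log.2 (h0 x))
  exact h1.contMDiffAt.comp x (hR x)

theorem differential_eq_sum {f : M → ℝ} (hf : ContMDiff (𝓡 n) 𝓘(ℝ, ℝ) ∞ f) (x : M)
    (v : TangentSpace (𝓡 n) x) :
    differential f x v = ∑ i, pd i (f ∘ (chartAt (Coord n) x).symm) (chartAt (Coord n) x x) *
      comp x v i := by
  set c := chartAt (Coord n) x with hc
  have hx : x ∈ c.source := mem_chart_source _ x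
  set F := f ∘ c.symm with hF
  have h1 : F ∘ c =ᶠ[𝓝 x] f := by
    filter_upwards [c.open_source.mem_nhds hx] with p hp
    exact congrArg f (c.left_inv hp)
  have h2 : ContDiffAt ℝ ∞ F (c x) :=
    ((hf (c.symm (c x))).comp (c x) (contMDiffAt_chart_symm x (c.map_source hx))).contDiffAt
  have h3 : DifferentiableAt ℝ F (c x) := h2.differentiableAt_of_smooth
  have h4 : MDifferentiableAt (𝓡 n) (𝓡 n) c x :=
    (contMDiffAt_chart x hx).mdifferentiableAt (by simp)
  have h5 := mfderiv_comp x h3.mdifferentiableAt h4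
  rw [h1.mfderiv_eq, mfderiv_eq_fderiv] at h5
  have h6 : differential f x v = fderiv ℝ F (c x) (chartCovec c x v) :=
    congrArg (fun L => L v) h5
  rw [h6, ← sum_smul_stdVec (chartCovec c x v), map_sum]
  refine Finset.sum_congr rfl fun i _ => ?_
  rw [map_smul, smul_eq_mul, mul_comm]
  rfl

/-- All tensors at x are already expressed in the chart at x. Only the values of R at nearby points
refer to other charts, so invariance of scalar curvature reduces the claim to the coordinate
identity, summed against the components of v and w. -/
theorem quasiEinstein_conformal [T2Space M] [SecondCountableTopology M] [MeasurableSpace M]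
    [BorelSpace M] (hn : 5 ≤ n) {g g' : Metric n M} (hcrit : IsCritical g)
    (hneg : ∀ x, scalarCurvature g.inner x < 0)
    (hg' : ∀ (x : M) (v w : TangentSpace (𝓡 n) x), g'.inner x v w =
      Real.exp (2 * (3 / ((n : ℝ) - 4) * Real.log |scalarCurvature g.inner x|)) * g.inner x v w)
    {f : M → ℝ}
    (hf : f = fun x => 2 * ((n : ℝ) - 1) / ((n : ℝ) - 4) * Real.log |scalarCurvature g.inner x|)
    (x : M) (v w : TangentSpace (𝓡 n) x) :
    ricci g'.inner x v w + hessian g'.inner f x v w -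
      ((n : ℝ) - 10) / (4 * ((n : ℝ) - 1)) * (differential f x v * differential f x w) = 0 := by
  have hfs : ContMDiff (𝓡 n) 𝓘(ℝ, ℝ) ∞ f := by
    rw [hf]
    exact contMDiff_const_mul_log (contMDiff_scalarCurvature g) (fun x => (hneg x).ne) _
  rw [differential_eq_sum hfs, differential_eq_sum hfs, ricci, hessian]
  set c := chartAt (Coord n) x with hc
  have hx : x ∈ c.source := mem_chart_source _ x
  have hy : c x ∈ c.target := c.map_source hx
  have hgs : ChartSmooth g.inner := SmoothField.chartSmooth g.contMDiff
  have hdet : ∀ z ∈ c.target, (gram g.inner c z).det ≠ 0 := fun z hz =>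
    (gram_posDef g x hz).det_pos.ne'
  have hsc : ∀ z ∈ c.target, scalarCurvature g.inner (c.symm z) = scalarCoord (gram g.inner c) z :=
    fun z hz => scalarCurvature_chart hgs g.symm x hz (hdet z hz)
  have hG : gram g'.inner c =ᶠ[𝓝 (c x)] fun z =>
      Real.exp (2 * (3 / ((n : ℝ) - 4) * Real.log |scalarCoord (gram g.inner c) z|)) •
        gram g.inner c z := by
    filter_upwards [c.open_target.mem_nhds hy] with z hz
    rw [← hsc z hz]
    ext i j
    exact hg' _ _ _
  have hF : f ∘ c.symm =ᶠ[𝓝 (c x)] fun z =>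
      2 * ((n : ℝ) - 1) / ((n : ℝ) - 4) * Real.log |scalarCoord (gram g.inner c) z| := by
    filter_upwards [c.open_target.mem_nhds hy] with z hz
    rw [← hsc z hz, hf]
    rfl
  have hne : scalarCoord (gram g.inner c) (c x) ≠ 0 := by
    rw [← hsc _ hy]
    exact (hneg _).ne
  have key := quasiEinstein_coord hn (isMetricAt_gram hgs g.symm x hy (hdet _ hy)) hne
    (gradS2_gram_eq_zero hcrit x _ hy)
  simp only [ricciCoord_congr hG, hessCoord_congr hG hF, pd_congr hF]
  rw [Finset.sum_mul_sum, Finset.mul_sum, ← Finset.sum_add_distrib, ← Finset.sum_sub_distrib]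
  refine Finset.sum_eq_zero fun i _ => ?_
  rw [Finset.mul_sum, ← Finset.sum_add_distrib, ← Finset.sum_sub_distrib]
  refine Finset.sum_eq_zero fun j _ => ?_
  linear_combination (comp x v i * comp x w j) * key i j

end Conformal

end CriticalMetric
end

theorem corollary2p4 {n : ℕ} (hn : 5 ≤ n)
    {M : Type*} [TopologicalSpace M] [T2Space M] [SecondCountableTopology M]
    [ChartedSpace (EuclideanSpace ℝ (Fin n)) M] [IsManifold (𝓡 n) ∞ M]
    [MeasurableSpace M] [BorelSpace M]
    (g : CriticalMetric.Metric n M) (hcrit : CriticalMetric.IsCritical g)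
    (R : M → ℝ) (hR : R = CriticalMetric.scalarCurvature g.inner) (hneg : ∀ x : M, R x < 0)
    (f : M → ℝ)
    (hf : f = fun x : M => 2 * ((n : ℝ) - 1) / ((n : ℝ) - 4) * Real.log |R x|) :
    ∃ g' : CriticalMetric.Metric n M,
      (∀ (x : M) (v w : TangentSpace (𝓡 n) x),
        g'.inner x v w = |R x| ^ (6 / ((n : ℝ) - 4)) * g.inner x v w) ∧
      (∀ (x : M) (v w : TangentSpace (𝓡 n) x),
        CriticalMetric.ricci g'.inner x v w + CriticalMetric.hessian g'.inner f x v w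
          - ((n : ℝ) - 10) / (4 * ((n : ℝ) - 1)) *
            (CriticalMetric.differential f x v * CriticalMetric.differential f x w) = 0) ∧
      CriticalMetric.IsQuasiEinstein g' f (((n : ℝ) - 10) / (4 * ((n : ℝ) - 1))) 0 ∧
      (n = 10 → CriticalMetric.IsGradientRicciSoliton g' f 0) := by
  subst hR
  have hsm := CriticalMetric.contMDiff_scalarCurvature g
  have h0 : ∀ x, CriticalMetric.scalarCurvature g.inner x ≠ 0 := fun x => (hneg x).ne
  have hexp : ContMDiff (𝓡 n) 𝓘(ℝ, ℝ) ∞ fun x => Real.exp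
      (2 * (3 / ((n : ℝ) - 4) * Real.log |CriticalMetric.scalarCurvature g.inner x|)) := by
    have h1 : ContDiff ℝ ∞ fun s : ℝ => Real.exp (2 * s) :=
      Real.contDiff_exp.comp (contDiff_const.mul contDiff_id)
    exact h1.contMDiff.comp (CriticalMetric.contMDiff_const_mul_log hsm h0 _)
  have hfs : ContMDiff (𝓡 n) 𝓘(ℝ, ℝ) ∞ f := by
    rw [hf]
    exact CriticalMetric.contMDiff_const_mul_log hsm h0 _
  set g' := CriticalMetric.conformalMetric g _ hexp fun x => Real.exp_pos _ with hg'
  have hq := CriticalMetric.quasiEinstein_conformal hn (g' := g') hcrit hneg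
    (fun _ _ _ => rfl) hf
  refine ⟨g', fun x v w => ?_, hq, ⟨hfs, fun x v w => ?_⟩, fun h10 => ⟨hfs, fun x v w => ?_⟩⟩
  -- |R|^{6/(n-4)} is e^{2φ} with φ = 3/(n-4) log|R|, the form in which the metric was built.
  · rw [Real.rpow_def_of_pos (abs_pos.2 (h0 x))]
    change Real.exp _ * _ = _
    congr 2
    ring
  · rw [hq, zero_mul]
  · have h1 := hq x v w
    have h2 : (n : ℝ) - 10 = 0 := by rw [h10]; norm_num
    rwa [h2, zero_div, zero_mul, sub_zero, ← zero_mul (g'.inner x v w)] at h1
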